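/- Let $K$ be a field of characteristic $0$ and $n\ge 0$. For $k,l\ge 0$ let $B_k^l(-2n)$ be the $K$-vector space with basis the $(k,l)$ Brauer diagrams (partitions of $k$ lower and $l$ upper nodes into pairs), with composition $D_1\circ D_2=(-2n)^{f}D$, where $D_1$ is placed above $D_2$, $f$ is the number of free loops of the concatenation and $D$ is the diagram that remains; let $\otimes$ be juxtaposition, and let $*D$ be $D$ reflected in a horizontal and in a vertical line, extended linearly. Let $B_{n+1}(-2n)=B_{n+1}^{n+1}(-2n)$ be the Brauer algebra, let $s_i,e_i$ $(1\le i\le n)$ be its standard generators ($s_i$: the strings $i,i+1$ cross; $e_i$: a cup and a cap at the positions $i,i+1$), and embed $\mathrm{Sym}_{n+1}$ in it as the diagrams all of whose strings are through strings. Put $$\Sigma=\sum_{\sigma\in \mathrm{Sym}_{n+1}}\sigma,\qquad \Phi=\sum_{k=0}^{\lfloor (n+1)/2\rfloor}\frac{1}{(2^k k!)^2\,(n+1-2k)!}\;\Sigma\; e_n e_{n-2}\cdots e_{n+2-2k}\;\Sigma ,$$ the product of the $e_i$ having $k$ factors (it is $1$ for $k=0$). Then: 1. $e_i\Phi=\Phi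 e_i=0$ for $1\le i\le n$. 2. $\Phi^2=(n+1)!\,\Phi$. 3. $*\Phi=\Phi$. 4. Let $V$ be a $K$-vector space of dimension $2n$ with a non-degenerate skew symmetric bilinear form $(\cdot,\cdot)$, and let $c_0=\sum_i b_i\otimes\bar b_i\in V\otimes V$, where $(b_i)$ is a basis of $V$ and $(\bar b_i)$ its dual basis, $(\bar b_i,b_j)=\delta_{ij}$. Let $F$ be the $K$-linear functor with $F(D):V^{\otimes k}\to V^{\otimes l}$ for $D\in B_k^l(-2n)$ which respects composition, identities and tensor products, and sends the single string to $\mathrm{id}_V$, the crossing $X$ to $v\otimes w\mapsto -w\otimes v$, the arc $A\in B_2^0$ to $v\otimes w\mapsto (v,w)$ and the arc $U\in B_0^2$ to $1\mapsto c_0$. (Explicitly, on a diagram $D$ with $c$ crossings, drawn with as few crossings as possible, $F(D)$ is $(-1)^c$ times the tensor formed from $\mathrm{id}_V$ for each through string, the form for each arc joining two lower nodes, and $c_0$ for each arc joining two upper nodes, the left end of an arc being the first tensor factor.) Then $F(\Phi)=0$. 5. There is exactly one $K$-algebra homomorphism $\rho_1:B_{n+1}(-2n)\to K$ with $\rho_1(s_i)=1$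 and $\rho_1(e_i)=0$ for all $i$ (the trivial representation). The element $z=\Phi/(n+1)!$ is the central idempotent which corresponds to $\rho_1$: it is central, $z^2=z$, $\rho_1(z)=1$ and $az=\rho_1(a)z$ for all $a\in B_{n+1}(-2n)$, and it is the only element with these properties. 6. The two-sided ideal of $B_{n+1}(-2n)$ generated by $z$ is $Kz$, and it has dimension $1$. -/

import Mathlib

namespace Brauer

/-- A `(k, l)` Brauer diagram: a partition of the `k` lower nodes `inl i` and the `l` upper nodes
`inr j` into pairs, recorded as the fixed-point-free involution exchanging the two ends of each
arc. Nodes are numbered from left to right, starting at `0`. -/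
@[ext]
structure Diagram (k l : ℕ) where
  partner : Fin k ⊕ Fin l → Fin k ⊕ Fin l
  partner_partner : ∀ x, partner (partner x) = x
  partner_ne : ∀ x, partner x ≠ x

namespace Diagram

section Composition

/-! The dihedral orbit of a point fixed by one of two involutions: a path with two ends. -/

theorem exists_unique_end_aux {S : Type} [Finite S] (a b : Equiv.Perm S)
    (ha : ∀ s, a (a s) = s) (hb : ∀ s, b (b s) = s) (x : S) (hbx : b x = x) (hax : a x ≠ x) :
    ∃! y, y ≠ x ∧ (a y = y ∨ b y = y) ∧ ∃ j : ℤ, y = ((a * b) ^ j) x := by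
  set c := a * b with hc
  have hainv : a⁻¹ = a := by ext s; rw [Equiv.Perm.inv_eq_iff_eq, ha]
  have hbinv : b⁻¹ = b := by ext s; rw [Equiv.Perm.inv_eq_iff_eq, hb]
  have hcinv : c⁻¹ = b * a := by rw [hc, mul_inv_rev, hainv, hbinv]
  have hbc : b * c * b⁻¹ = c⁻¹ := by rw [hcinv, hbinv, hc]; ext s; simp [hb]
  have hbj : ∀ j : ℤ, b ((c ^ j) x) = (c ^ (-j)) x := by
    intro j
    have h1 : b * c ^ j * b⁻¹ = c ^ (-j) := by
      rw [← conj_zpow, hbc, inv_zpow, zpow_neg]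
    have h2 := congrArg (fun p : Equiv.Perm S => p x) h1
    simpa [hbinv, hbx] using h2
  have haj : ∀ j : ℤ, a ((c ^ j) x) = (c ^ (1 - j)) x := by
    intro j
    have h1 : a ((c ^ j) x) = c (b ((c ^ j) x)) := by simp [hc, hb]
    rw [h1, hbj, sub_eq_add_neg, zpow_add, zpow_one]; rfl
  have heq : ∀ i j : ℤ, (c ^ i) x = (c ^ j) x ↔ (c ^ (i - j)) x = x := by
    intro i j
    rw [sub_eq_neg_add, zpow_add, zpow_neg, Equiv.Perm.mul_apply, Equiv.Perm.inv_eq_iff_eq]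
  let H : AddSubgroup ℤ :=
    { carrier := {j | (c ^ j) x = x}
      zero_mem' := by simp
      add_mem' := by
        intro i j hi hj
        simp only [Set.mem_ofPred_eq] at *
        rw [zpow_add, Equiv.Perm.mul_apply, hj, hi]
      neg_mem' := by
        intro i hi
        simp only [Set.mem_ofPred_eq] at *
        rw [zpow_neg, Equiv.Perm.inv_eq_iff_eq, hi] }
  obtain ⟨m, hm⟩ := Int.subgroup_cyclic H
  have hmem : ∀ j : ℤ, (c ^ j) x = x ↔ m ∣ j := by
    intro j
    have : j ∈ H ↔ m ∣ j := by
      rw [hm, AddSubgroup.mem_closure_singleton]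
      constructor
      · rintro ⟨k, rfl⟩; exact ⟨k, by simp [mul_comm]⟩
      · rintro ⟨k, rfl⟩; exact ⟨k, by simp [mul_comm]⟩
    exact this
  have hm0 : m ≠ 0 := by
    rintro rfl
    have := (hmem (orderOf c)).1 (by rw [zpow_natCast, pow_orderOf_eq_one]; rfl)
    rw [zero_dvd_iff] at this
    exact (orderOf_pos c).ne' (by exact_mod_cast this)
  have hfix : ∀ j : ℤ, (a ((c ^ j) x) = (c ^ j) x ∨ b ((c ^ j) x) = (c ^ j) x) ↔
      (m ∣ 1 - 2 * j ∨ m ∣ 2 * j) := by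
    intro j
    rw [haj, hbj, heq, heq, hmem, hmem, show 1 - j - j = 1 - 2 * j by ring,
      show -j - j = -(2 * j) by ring, dvd_neg]
  have hm1 : ¬ m ∣ 1 := by
    intro h
    have h1 := (hmem 1).2 h
    rw [zpow_one, hc, Equiv.Perm.mul_apply, hbx] at h1
    exact hax h1
  have hsol : ∃ j : ℤ, ¬ m ∣ j ∧ (m ∣ 1 - 2 * j ∨ m ∣ 2 * j) := by
    rcases Int.even_or_odd' m with ⟨t, ht | ht⟩
    · refine ⟨t, ?_, Or.inr (by rw [ht])⟩
      rintro ⟨u, hu⟩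
      have : t * (1 - 2 * u) = 0 := by rw [ht] at hu; linear_combination hu
      rcases mul_eq_zero.1 this with h | h
      · exact hm0 (by omega)
      · omega
    · refine ⟨t + 1, ?_, Or.inl ⟨-1, by rw [ht]; ring⟩⟩
      intro h
      apply hm1
      have h2 : m ∣ 2 * (t + 1) - m := dvd_sub (h.mul_left 2) dvd_rfl
      rwa [ht, show 2 * (t + 1) - (2 * t + 1) = 1 by ring, ← ht] at h2
  have huniq : ∀ i j : ℤ, ¬ m ∣ i → (m ∣ 1 - 2 * i ∨ m ∣ 2 * i) → ¬ m ∣ j →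
      (m ∣ 1 - 2 * j ∨ m ∣ 2 * j) → m ∣ i - j := by
    have key : ∀ i j : ℤ, ¬ m ∣ j → m ∣ 1 - 2 * i → m ∣ 2 * j → False := by
      rintro i j hj ⟨u, hu⟩ ⟨v, hv⟩
      apply hj
      exact ⟨j * u + i * v, by linear_combination j * hu + i * hv⟩
    rintro i j hi (hi' | hi') hj (hj' | hj')
    · obtain ⟨u, hu⟩ := hi'
      obtain ⟨v, hv⟩ := hj'
      exact ⟨(i - j) * u + i * (v - u), by linear_combination (i - j) * hu + i * (hv - hu)⟩
    · exact (key i j hj hi' hj').elim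
    · exact (key j i hi hj' hi').elim
    · obtain ⟨u, hu⟩ := hi'
      obtain ⟨v, hv⟩ := hj'
      have odd : ∀ (i u : ℤ), 2 * i = m * u → ¬ m ∣ i → ∃ t, u = 2 * t + 1 := by
        intro i u hu hi
        rcases Int.even_or_odd' u with ⟨t, ht | ht⟩
        · refine (hi ⟨t, ?_⟩).elim
          have : 2 * (i - m * t) = 0 := by rw [ht] at hu; linear_combination hu
          omega
        · exact ⟨t, ht⟩
      obtain ⟨s, rfl⟩ := odd i u hu hi
      obtain ⟨t, rfl⟩ := odd j v hv hj
      refine ⟨s - t, ?_⟩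
      have : 2 * (i - j - m * (s - t)) = 0 := by linear_combination hu - hv
      omega
  obtain ⟨j, hj, hj'⟩ := hsol
  refine ⟨(c ^ j) x, ⟨fun h => hj ((hmem j).1 h), (hfix j).2 hj', j, rfl⟩, ?_⟩
  rintro _ ⟨hy, hy', i, rfl⟩
  rw [heq, hmem]
  exact huniq i j (fun h => hy ((hmem i).2 h)) ((hfix i).1 hy') hj hj'


variable {k l p q : ℕ}

/-- The concatenation `D₁ # D₂` (`D₁` above `D₂`) as a graph: its vertices are the `k` lower nodes
of `D₂`, the `l` glued nodes (upper nodes of `D₂` = lower nodes of `D₁`) and the `p` upper nodes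
of `D₁`; two vertices are adjacent when they are joined by an arc of `D₂` or of `D₁`. -/
def concat (D₁ : Diagram l p) (D₂ : Diagram k l) : SimpleGraph (Fin k ⊕ Fin l ⊕ Fin p) :=
  SimpleGraph.fromRel fun x y =>
    (∃ s, x = Sum.map id Sum.inl s ∧ y = Sum.map id Sum.inl (D₂.partner s)) ∨
      (∃ s, x = Sum.inr s ∧ y = Sum.inr (D₁.partner s))

/-- The nodes of the concatenation which are not glued. -/
def outer (k l p : ℕ) : Fin k ⊕ Fin p → Fin k ⊕ Fin l ⊕ Fin p := Sum.map id Sum.inr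

/-- The free loops of `D₁ # D₂`: the connected components that contain only glued nodes. -/
abbrev FreeLoop (D₁ : Diagram l p) (D₂ : Diagram k l) : Type :=
  {C : (concat D₁ D₂).ConnectedComponent //
    ∀ s, (concat D₁ D₂).connectedComponentMk (outer k l p s) ≠ C}

/-- The number of free loops of `D₁ # D₂`. -/
noncomputable def loops (D₁ : Diagram l p) (D₂ : Diagram k l) : ℕ := Nat.card (FreeLoop D₁ D₂)

/-- The arcs of the lower diagram, extended by the identity to the concatenation. -/
def lowerFun (l : ℕ) (D₂ : Diagram k l) (p : ℕ) : Fin k ⊕ Fin l ⊕ Fin p → Fin k ⊕ Fin l ⊕ Fin p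
  | .inl i => Sum.map id Sum.inl (D₂.partner (.inl i))
  | .inr (.inl j) => Sum.map id Sum.inl (D₂.partner (.inr j))
  | .inr (.inr u) => .inr (.inr u)

/-- The arcs of the upper diagram, extended by the identity to the concatenation. -/
def upperFun (k : ℕ) (D₁ : Diagram l p) : Fin k ⊕ Fin l ⊕ Fin p → Fin k ⊕ Fin l ⊕ Fin p
  | .inl i => .inl i
  | .inr s => .inr (D₁.partner s)

theorem lowerFun_map (D₂ : Diagram k l) (s : Fin k ⊕ Fin l) :
    lowerFun l D₂ p (Sum.map id Sum.inl s) = Sum.map id Sum.inl (D₂.partner s) := by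
  rcases s with s | s <;> rfl

theorem lowerFun_lowerFun (D₂ : Diagram k l) (x) :
    lowerFun l D₂ p (lowerFun l D₂ p x) = x := by
  have h : ∀ s : Fin k ⊕ Fin l, lowerFun l D₂ p (lowerFun l D₂ p (Sum.map id Sum.inl s)) =
      Sum.map id Sum.inl s := by
    intro s; rw [lowerFun_map, lowerFun_map, D₂.partner_partner]
  rcases x with x | x | x
  · exact h (.inl x)
  · exact h (.inr x)
  · rfl

theorem upperFun_upperFun (D₁ : Diagram l p) (x) :
    upperFun k D₁ (upperFun k D₁ x) = x := by
  rcases x with x | x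
  · rfl
  · simp [upperFun, D₁.partner_partner]

theorem lowerFun_eq_iff (D₂ : Diagram k l) (x) :
    lowerFun l D₂ p x = x ↔ ∃ u, x = .inr (.inr u) := by
  have inj : Function.Injective (Sum.map id Sum.inl : Fin k ⊕ Fin l → Fin k ⊕ Fin l ⊕ Fin p) :=
    Function.injective_id.sumMap Sum.inl_injective
  have h : ∀ s : Fin k ⊕ Fin l, lowerFun l D₂ p (Sum.map id Sum.inl s) ≠
      Sum.map id Sum.inl s := by
    intro s hs; rw [lowerFun_map] at hs; exact D₂.partner_ne s (inj hs)
  rcases x with x | x | x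
  · simpa using h (.inl x)
  · simpa using h (.inr x)
  · simp [lowerFun]

theorem upperFun_eq_iff (D₁ : Diagram l p) (x) :
    upperFun k D₁ x = x ↔ ∃ i, x = .inl i := by
  rcases x with x | x
  · simp [upperFun]
  · simpa [upperFun] using D₁.partner_ne x

theorem concat_adj (D₁ : Diagram l p) (D₂ : Diagram k l) (x y) :
    (concat D₁ D₂).Adj x y ↔ x ≠ y ∧ (y = lowerFun l D₂ p x ∨ y = upperFun k D₁ x) := by
  have h : ∀ x y, ((∃ s, x = Sum.map id Sum.inl s ∧ y = Sum.map id Sum.inl (D₂.partner s)) ∨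
      (∃ s, x = Sum.inr s ∧ y = Sum.inr (D₁.partner s))) → 
      (y = lowerFun l D₂ p x ∨ y = upperFun k D₁ x) := by
    rintro x y (⟨s, rfl, rfl⟩ | ⟨s, rfl, rfl⟩)
    · left; rw [lowerFun_map]
    · right; rfl
  rw [concat, SimpleGraph.fromRel_adj]
  refine and_congr_right fun hxy => ⟨?_, ?_⟩
  · rintro (h1 | h1)
    · exact h _ _ h1
    · rcases h _ _ h1 with rfl | rfl
      · left; rw [lowerFun_lowerFun]
      · right; rw [upperFun_upperFun]
  · rintro (rfl | rfl)
    · left; left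
      rcases x with x | x | x
      · exact ⟨.inl x, rfl, rfl⟩
      · exact ⟨.inr x, rfl, rfl⟩
      · exact (hxy rfl).elim
    · left; right
      rcases x with x | x
      · exact (hxy rfl).elim
      · exact ⟨x, rfl, rfl⟩

theorem outer_iff (D₁ : Diagram l p) (D₂ : Diagram k l) (x) :
    (lowerFun l D₂ p x = x ∨ upperFun k D₁ x = x) ↔ ∃ s, x = outer k l p s := by
  rw [lowerFun_eq_iff, upperFun_eq_iff]
  simp [outer, or_comm]

theorem reachable_iff (D₁ : Diagram l p) (D₂ : Diagram k l) (a b : Equiv.Perm (Fin k ⊕ Fin l ⊕ Fin p))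
    (hab : (∀ x, a x = lowerFun l D₂ p x) ∧ (∀ x, b x = upperFun k D₁ x) ∨
      (∀ x, b x = lowerFun l D₂ p x) ∧ (∀ x, a x = upperFun k D₁ x)) (x y)
    (hx : b x = x) :
    (concat D₁ D₂).Reachable x y ↔ ∃ j : ℤ, y = ((a * b) ^ j) x := by
  have hadj : ∀ x y, (concat D₁ D₂).Adj x y ↔ x ≠ y ∧ (y = a x ∨ y = b x) := by
    intro x y
    rw [concat_adj]
    rcases hab with ⟨h1, h2⟩ | ⟨h1, h2⟩
    · rw [h1, h2]
    · rw [h1, h2, or_comm]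
  have ha : ∀ s, a (a s) = s := by
    rcases hab with ⟨h1, h2⟩ | ⟨h1, h2⟩ <;> intro s
    · rw [h1, h1, lowerFun_lowerFun]
    · rw [h2, h2, upperFun_upperFun]
  have hb : ∀ s, b (b s) = s := by
    rcases hab with ⟨h1, h2⟩ | ⟨h1, h2⟩ <;> intro s
    · rw [h2, h2, upperFun_upperFun]
    · rw [h1, h1, lowerFun_lowerFun]
  have hainv : a⁻¹ = a := by ext s; rw [Equiv.Perm.inv_eq_iff_eq, ha]
  have hbinv : b⁻¹ = b := by ext s; rw [Equiv.Perm.inv_eq_iff_eq, hb]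
  have hra : ∀ z, (concat D₁ D₂).Reachable z (a z) := by
    intro z
    by_cases h : z = a z
    · rw [← h]
    · exact ((hadj _ _).2 ⟨h, Or.inl rfl⟩).reachable
  have hrb : ∀ z, (concat D₁ D₂).Reachable z (b z) := by
    intro z
    by_cases h : z = b z
    · rw [← h]
    · exact ((hadj _ _).2 ⟨h, Or.inr rfl⟩).reachable
  set c := a * b with hc
  have hcinv : c⁻¹ = b * a := by rw [hc, mul_inv_rev, hainv, hbinv]
  have hbc : b * c * b⁻¹ = c⁻¹ := by rw [hcinv, hbinv, hc]; ext s; simp [hb]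
  have hbj : ∀ j : ℤ, b ((c ^ j) x) = (c ^ (-j)) x := by
    intro j
    have h1 : b * c ^ j * b⁻¹ = c ^ (-j) := by
      rw [← conj_zpow, hbc, inv_zpow, zpow_neg]
    have h2 := congrArg (fun p : Equiv.Perm _ => p x) h1
    simpa [hbinv, hx] using h2
  have haj : ∀ j : ℤ, a ((c ^ j) x) = (c ^ (1 - j)) x := by
    intro j
    have h1 : a ((c ^ j) x) = c (b ((c ^ j) x)) := by simp [hc, hb]
    rw [h1, hbj, sub_eq_add_neg, zpow_add, zpow_one]; rfl
  constructor
  · intro h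
    rw [SimpleGraph.reachable_iff_reflTransGen] at h
    induction h with
    | refl => exact ⟨0, by simp⟩
    | tail _ h ih =>
      obtain ⟨j, rfl⟩ := ih
      rcases ((hadj _ _).1 h).2 with rfl | rfl
      · exact ⟨_, haj j⟩
      · exact ⟨_, hbj j⟩
  · rintro ⟨j, rfl⟩
    have hrc : ∀ z, (concat D₁ D₂).Reachable z (c z) := fun z => (hrb z).trans (hra _)
    induction j with
    | zero => simp
    | succ i ih =>
      refine ih.trans ?_
      rw [add_comm, zpow_add, zpow_one]
      exact hrc _
    | pred i ih =>
      refine ih.trans ?_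
      refine SimpleGraph.Reachable.symm ?_
      have h1 := hrc ((c ^ (-(i : ℤ) - 1)) x)
      rwa [← Equiv.Perm.mul_apply, ← zpow_one_add, add_sub_cancel] at h1

/-- Every free end of `D₁ # D₂` is connected to exactly one other free end. -/
theorem existsUnique_partner (D₁ : Diagram l p) (D₂ : Diagram k l) (s : Fin k ⊕ Fin p) :
    ∃! t, t ≠ s ∧ (concat D₁ D₂).Reachable (outer k l p s) (outer k l p t) := by
  have inj : Function.Injective (outer k l p) :=
    Function.injective_id.sumMap Sum.inr_injective
  let A : Equiv.Perm (Fin k ⊕ Fin l ⊕ Fin p) :=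
    ⟨lowerFun l D₂ p, lowerFun l D₂ p, lowerFun_lowerFun D₂, lowerFun_lowerFun D₂⟩
  let B : Equiv.Perm (Fin k ⊕ Fin l ⊕ Fin p) :=
    ⟨upperFun k D₁, upperFun k D₁, upperFun_upperFun D₁, upperFun_upperFun D₁⟩
  have main : ∀ a b : Equiv.Perm (Fin k ⊕ Fin l ⊕ Fin p),
      ((∀ x, a x = lowerFun l D₂ p x) ∧ (∀ x, b x = upperFun k D₁ x) ∨
      (∀ x, b x = lowerFun l D₂ p x) ∧ (∀ x, a x = upperFun k D₁ x)) →
      b (outer k l p s) = outer k l p s → 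
      ∃! t, t ≠ s ∧ (concat D₁ D₂).Reachable (outer k l p s) (outer k l p t) := by
    intro a b hab hbs
    have hfix : ∀ x, (a x = x ∨ b x = x) ↔ ∃ s, x = outer k l p s := by
      intro x
      rw [← outer_iff D₁ D₂]
      rcases hab with ⟨h1, h2⟩ | ⟨h1, h2⟩
      · rw [h1, h2]
      · rw [h1, h2, or_comm]
    have has : a (outer k l p s) ≠ outer k l p s := by
      rcases hab with ⟨h1, h2⟩ | ⟨h1, h2⟩
      · rw [h1]; rw [h2] at hbs; intro h
        obtain ⟨i, hi⟩ := (lowerFun_eq_iff _ _).1 h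
        obtain ⟨j, hj⟩ := (upperFun_eq_iff _ _).1 hbs
        rw [hi] at hj; cases hj
      · rw [h2]; rw [h1] at hbs; intro h
        obtain ⟨i, hi⟩ := (lowerFun_eq_iff _ _).1 hbs
        obtain ⟨j, hj⟩ := (upperFun_eq_iff _ _).1 h
        rw [hi] at hj; cases hj
    have ha : ∀ s, a (a s) = s := by
      rcases hab with ⟨h1, h2⟩ | ⟨h1, h2⟩ <;> intro s
      · rw [h1, h1, lowerFun_lowerFun]
      · rw [h2, h2, upperFun_upperFun]
    have hb : ∀ s, b (b s) = s := by
      rcases hab with ⟨h1, h2⟩ | ⟨h1, h2⟩ <;> intro s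
      · rw [h2, h2, upperFun_upperFun]
      · rw [h1, h1, lowerFun_lowerFun]
    obtain ⟨y, ⟨hy1, hy2, hy3⟩, huniq⟩ := exists_unique_end_aux a b ha hb _ hbs has
    obtain ⟨t, rfl⟩ := (hfix y).1 hy2
    refine ⟨t, ⟨fun h => hy1 (by rw [h]), (reachable_iff D₁ D₂ a b hab _ _ hbs).2 hy3⟩, ?_⟩
    rintro t' ⟨h1, h2⟩
    exact inj (huniq _ ⟨fun h => h1 (inj h), (hfix _).2 ⟨t', rfl⟩,
      (reachable_iff D₁ D₂ a b hab _ _ hbs).1 h2⟩)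
  rcases s with s | s
  · exact main A B (Or.inl ⟨fun _ => rfl, fun _ => rfl⟩) rfl
  · exact main B A (Or.inr ⟨fun _ => rfl, fun _ => rfl⟩) rfl

/-- The other free end of the component of `s` in `D₁ # D₂`. -/
noncomputable def compPartner (D₁ : Diagram l p) (D₂ : Diagram k l) (s : Fin k ⊕ Fin p) :
    Fin k ⊕ Fin p := (existsUnique_partner D₁ D₂ s).choose

theorem compPartner_spec (D₁ : Diagram l p) (D₂ : Diagram k l) (s : Fin k ⊕ Fin p) :
    compPartner D₁ D₂ s ≠ s ∧
      (concat D₁ D₂).Reachable (outer k l p s) (outer k l p (compPartner D₁ D₂ s)) :=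
  (existsUnique_partner D₁ D₂ s).choose_spec.1

theorem eq_compPartner (D₁ : Diagram l p) (D₂ : Diagram k l) {s t : Fin k ⊕ Fin p} (h : t ≠ s)
    (h' : (concat D₁ D₂).Reachable (outer k l p s) (outer k l p t)) :
    t = compPartner D₁ D₂ s :=
  (existsUnique_partner D₁ D₂ s).choose_spec.2 t ⟨h, h'⟩

/-- The diagram underlying `D₁ ∘ D₂`: two free ends of `D₁ # D₂` are joined when they are connected
in the concatenation. -/
noncomputable def comp (D₁ : Diagram l p) (D₂ : Diagram k l) : Diagram k p where
  partner := compPartner D₁ D₂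
  partner_partner s := (eq_compPartner D₁ D₂ (compPartner_spec D₁ D₂ s).1.symm
    (compPartner_spec D₁ D₂ s).2.symm).symm
  partner_ne s := (compPartner_spec D₁ D₂ s).1

/-- The number (`0` or `1`) of extensions of a two-colouring of the nodes to the arcs of a diagram;
used only to prove that composition is associative and unital. -/
noncomputable def colour (D : Diagram k l) (u : Fin k → Bool) (v : Fin l → Bool) : ℕ :=
  open scoped Classical in
  if ∀ s, Sum.elim u v (D.partner s) = Sum.elim u v s then 1 else 0

theorem sum_colour (D₁ : Diagram l p) (D₂ : Diagram k l) (u : Fin k → Bool) (v : Fin p → Bool) :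
    ∑ m : Fin l → Bool, colour D₁ m v * colour D₂ u m =
      2 ^ loops D₁ D₂ * colour (comp D₁ D₂) u v := by
  classical
  set G := concat D₁ D₂ with hG
  have hL : ∑ m : Fin l → Bool, colour D₁ m v * colour D₂ u m =
      Nat.card {h : G.ConnectedComponent → Bool // ∀ s, h (G.connectedComponentMk (outer k l p s)) =
        Sum.elim u v s} := by
    have h1 : ∀ m : Fin l → Bool, colour D₁ m v * colour D₂ u m =
        if (∀ s, Sum.elim m v (D₁.partner s) = Sum.elim m v s) ∧
          (∀ s, Sum.elim u m (D₂.partner s) = Sum.elim u m s) then 1 else 0 := by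
      intro m; unfold colour; split_ifs <;> simp_all
    simp_rw [h1]
    rw [Finset.sum_boole, Nat.cast_id, ← Fintype.card_subtype, ← Nat.card_eq_fintype_card]
    let f : (Fin l → Bool) → (Fin k ⊕ Fin l ⊕ Fin p → Bool) := fun m => Sum.elim u (Sum.elim m v)
    have hf : ∀ m, ((∀ s, Sum.elim m v (D₁.partner s) = Sum.elim m v s) ∧
          (∀ s, Sum.elim u m (D₂.partner s) = Sum.elim u m s)) →
          ∀ x y, G.Reachable x y → f m x = f m y := by
      rintro m ⟨h1, h2⟩ x y hxy
      have hadj : ∀ x y, ((∃ s, x = Sum.map id Sum.inl s ∧ y = Sum.map id Sum.inl (D₂.partner s)) ∨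
          (∃ s, x = Sum.inr s ∧ y = Sum.inr (D₁.partner s))) → f m x = f m y := by
        have e : ∀ s : Fin k ⊕ Fin l, f m (Sum.map id Sum.inl s) = Sum.elim u m s := by
          rintro (s | s) <;> rfl
        rintro x y (⟨s, rfl, rfl⟩ | ⟨s, rfl, rfl⟩)
        · rw [e, e, h2]
        · exact (h1 s).symm
      rw [SimpleGraph.reachable_iff_reflTransGen] at hxy
      induction hxy with
      | refl => rfl
      | tail _ h ih =>
        rw [ih]
        rw [hG, concat, SimpleGraph.fromRel_adj] at h
        rcases h.2 with h | h
        · exact hadj _ _ h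
        · exact (hadj _ _ h).symm
    have hadj : ∀ x y, ((∃ s, x = Sum.map id Sum.inl s ∧ y = Sum.map id Sum.inl (D₂.partner s)) ∨
          (∃ s, x = Sum.inr s ∧ y = Sum.inr (D₁.partner s))) →
          G.connectedComponentMk x = G.connectedComponentMk y := by
      intro x y hxy
      by_cases h : x = y
      · rw [h]
      · refine SimpleGraph.ConnectedComponent.sound (SimpleGraph.Adj.reachable ?_)
        rw [hG, concat, SimpleGraph.fromRel_adj]
        exact ⟨h, Or.inl hxy⟩
    refine Nat.card_congr
      { toFun := fun m => ⟨fun C => C.lift (f m.1) (fun x y w _ => hf m.1 m.2 x y w.reachable), ?_⟩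
        invFun := fun h => ⟨fun j => h.1 (G.connectedComponentMk (.inr (.inl j))), ?_⟩
        left_inv := ?_
        right_inv := ?_ }
    · rintro (s | s) <;> rfl
    · obtain ⟨h, hh⟩ := h
      have e1 : ∀ s, Sum.elim (fun j => h (G.connectedComponentMk (.inr (.inl j)))) v s =
          h (G.connectedComponentMk (.inr s)) := by
        rintro (s | s)
        · rfl
        · exact (hh (.inr s)).symm
      have e2 : ∀ s, Sum.elim u (fun j => h (G.connectedComponentMk (.inr (.inl j)))) s =
          h (G.connectedComponentMk (Sum.map id Sum.inl s)) := by
        rintro (s | s)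
        · exact (hh (.inl s)).symm
        · rfl
      constructor
      · intro s
        rw [e1, e1]
        exact congrArg h (hadj _ _ (Or.inr ⟨s, rfl, rfl⟩)).symm
      · intro s
        rw [e2, e2]
        exact congrArg h (hadj _ _ (Or.inl ⟨s, rfl, rfl⟩)).symm
    · rintro ⟨m, hm⟩
      rfl
    · rintro ⟨h, hh⟩
      apply Subtype.ext
      funext C
      induction C using SimpleGraph.ConnectedComponent.ind with
      | _ x =>
        rcases x with x | x | x
        · exact (hh (.inl x)).symm
        · rfl
        · exact (hh (.inr x)).symm
  rw [hL]
  by_cases huv : ∀ s, Sum.elim u v ((comp D₁ D₂).partner s) = Sum.elim u v s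
  · rw [colour, if_pos huv, mul_one]
    have huv' : ∀ s t, G.connectedComponentMk (outer k l p s) = G.connectedComponentMk (outer k l p t) →
        Sum.elim u v s = Sum.elim u v t := by
      intro s t h
      by_cases hst : t = s
      · rw [hst]
      · rw [eq_compPartner D₁ D₂ hst (SimpleGraph.ConnectedComponent.exact h)]
        exact (huv s).symm
    have : Nat.card {h : G.ConnectedComponent → Bool //
        ∀ s, h (G.connectedComponentMk (outer k l p s)) = Sum.elim u v s} =
        Nat.card (FreeLoop D₁ D₂ → Bool) := by
      refine Nat.card_congr
        { toFun := fun h C => h.1 C.1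
          invFun := fun g => ⟨fun C => if hC : ∃ s, G.connectedComponentMk (outer k l p s) = C then
            Sum.elim u v hC.choose else g ⟨C, fun s hs => hC ⟨s, hs⟩⟩, ?_⟩
          left_inv := ?_
          right_inv := ?_ }
      · intro s
        have hC : ∃ t, G.connectedComponentMk (outer k l p t) =
          G.connectedComponentMk (outer k l p s) := ⟨s, rfl⟩
        simp only [dif_pos hC]
        exact huv' _ _ hC.choose_spec
      · rintro ⟨h, hh⟩
        apply Subtype.ext
        funext C
        by_cases hC : ∃ s, G.connectedComponentMk (outer k l p s) = C
        · simp only [dif_pos hC]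
          rw [← hh, hC.choose_spec]
        · simp only [dif_neg hC]
      · intro g
        funext C
        have hC : ¬ ∃ s, G.connectedComponentMk (outer k l p s) = C.1 := fun ⟨s, hs⟩ => C.2 s hs
        simp only [dif_neg hC]
    rw [this, Nat.card_fun, loops]
    simp
  · rw [colour, if_neg huv, mul_zero, Nat.card_eq_zero]
    left
    constructor
    rintro ⟨h, hh⟩
    apply huv
    intro s
    rw [← hh, ← hh]
    exact congrArg h (SimpleGraph.ConnectedComponent.sound (compPartner_spec D₁ D₂ s).2.symm)

theorem eq_of_colour {D D' : Diagram k l} {a b : ℕ}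
    (h : ∀ u v, 2 ^ a * colour D u v = 2 ^ b * colour D' u v) : D = D' ∧ a = b := by
  classical
  have hab : a = b := by
    have := h (fun _ => true) (fun _ => true)
    have e : ∀ s : Fin k ⊕ Fin l, Sum.elim (fun _ => true) (fun _ => true) s = true := by
      rintro (s | s) <;> rfl
    simp only [colour, e, implies_true, if_true, mul_one] at this
    exact Nat.pow_right_injective le_rfl this
  refine ⟨?_, hab⟩
  subst hab
  ext1
  funext s
  let w : Fin k ⊕ Fin l → Bool := fun t => decide (t = s ∨ t = D.partner s)
  have hw : Sum.elim (fun i => w (.inl i)) (fun j => w (.inr j)) = w := by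
    funext t; rcases t with t | t <;> rfl
  have h1 := h (fun i => w (.inl i)) (fun j => w (.inr j))
  simp only [colour, hw] at h1
  rw [if_pos] at h1
  · have h2 : ∀ t, w (D'.partner t) = w t := by
      by_contra hcon
      rw [if_neg hcon] at h1
      simp at h1
    have h3 := h2 s
    have h4 : w s = true := by simp [w]
    rw [h4] at h3
    have h5 : D'.partner s = s ∨ D'.partner s = D.partner s := by simpa [w] using h3
    rcases h5 with h5 | h5
    · exact (D'.partner_ne s h5).elim
    · exact h5.symm
  · intro t
    simp only [w, decide_eq_decide]
    constructor
    · rintro (h | h)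
      · right; rw [← h, D.partner_partner]
      · left; rw [← D.partner_partner t, h, D.partner_partner]
    · rintro (h | h)
      · right; rw [h]
      · left; rw [h, D.partner_partner]

theorem comp_assoc_aux (D₁ : Diagram p q) (D₂ : Diagram l p) (D₃ : Diagram k l) :
    comp D₁ (comp D₂ D₃) = comp (comp D₁ D₂) D₃ ∧
      loops D₂ D₃ + loops D₁ (comp D₂ D₃) = loops D₁ D₂ + loops (comp D₁ D₂) D₃ := by
  apply eq_of_colour
  intro u v
  rw [pow_add, pow_add, mul_assoc, mul_assoc, ← sum_colour, ← sum_colour, Finset.mul_sum,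
    Finset.mul_sum]
  have h1 : ∀ m, 2 ^ loops D₂ D₃ * (colour D₁ m v * colour (comp D₂ D₃) u m) =
      ∑ m', colour D₁ m v * (colour D₂ m' m * colour D₃ u m') := by
    intro m
    rw [← Finset.mul_sum, sum_colour]; ring
  have h2 : ∀ m, 2 ^ loops D₁ D₂ * (colour (comp D₁ D₂) m v * colour D₃ u m) =
      ∑ m', colour D₁ m' v * (colour D₂ m m' * colour D₃ u m) := by
    intro m
    rw [← mul_assoc, ← sum_colour, Finset.sum_mul]
    exact Finset.sum_congr rfl fun _ _ => by ring
  simp_rw [h1, h2]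
  rw [Finset.sum_comm]

/-- The diagram of a permutation: the lower node `i` is joined to the upper node `σ i`. -/
def ofPerm {r : ℕ} (σ : Equiv.Perm (Fin r)) : Diagram r r where
  partner := Sum.elim (fun i => .inr (σ i)) (fun j => .inl (σ.symm j))
  partner_partner := by rintro (x | x) <;> simp
  partner_ne := by rintro (x | x) <;> simp

theorem colour_ofPerm_one {r : ℕ} (u v : Fin r → Bool) :
    colour (ofPerm 1) u v = if u = v then 1 else 0 := by
  unfold colour
  congr 1
  simp only [ofPerm, Sum.forall, eq_iff_iff]
  constructor
  · rintro ⟨h, -⟩; funext i; simpa using (h i).symm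
  · rintro rfl; exact ⟨fun _ => rfl, fun _ => rfl⟩

theorem one_comp_aux (D : Diagram k l) : comp (ofPerm 1) D = D ∧ loops (ofPerm 1) D = 0 := by
  apply eq_of_colour
  intro u v
  rw [← sum_colour]
  simp [colour_ofPerm_one]

theorem comp_one_aux (D : Diagram k l) : comp D (ofPerm 1) = D ∧ loops D (ofPerm 1) = 0 := by
  apply eq_of_colour
  intro u v
  rw [← sum_colour]
  simp [colour_ofPerm_one]

end Composition

/-- The diagram `X`: two crossing through strings. -/
def X : Diagram 2 2 := ofPerm (Equiv.swap 0 1)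

/-- The diagram `A`: one arc joining two lower nodes. -/
def A : Diagram 2 0 where
  partner := Sum.map Fin.rev id
  partner_partner := by decide
  partner_ne := by decide

/-- The diagram `U`: one arc joining two upper nodes. -/
def U : Diagram 0 2 where
  partner := Sum.map id Fin.rev
  partner_partner := by decide
  partner_ne := by decide

/-- The nodes of a juxtaposition, the left diagram first on both lines. -/
def juxtapose (p q k l : ℕ) :
    (Fin p ⊕ Fin q) ⊕ (Fin k ⊕ Fin l) ≃ Fin (p + k) ⊕ Fin (q + l) :=
  (Equiv.sumSumSumComm _ _ _ _).trans (Equiv.sumCongr finSumFinEquiv finSumFinEquiv)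

/-- The tensor product `D ⊗ D'`: `D'` is placed on the right of `D`. -/
def tensor {p q k l : ℕ} (D : Diagram p q) (D' : Diagram k l) : Diagram (p + k) (q + l) where
  partner x := juxtapose p q k l (Sum.map D.partner D'.partner ((juxtapose p q k l).symm x))
  partner_partner x := by
    obtain ⟨y, rfl⟩ := (juxtapose p q k l).surjective x
    rcases y with y | y <;> simp [D.partner_partner, D'.partner_partner]
  partner_ne x := by
    obtain ⟨y, rfl⟩ := (juxtapose p q k l).surjective x
    rcases y with y | y <;> simp [D.partner_ne, D'.partner_ne]

/-- Rotation of the nodes by a half turn: upper and lower line are exchanged, and so are left and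
right. -/
def halfTurn (k l : ℕ) : Fin k ⊕ Fin l ≃ Fin l ⊕ Fin k :=
  (Equiv.sumComm _ _).trans (Equiv.sumCongr Fin.revPerm Fin.revPerm)

/-- `*D`: the diagram `D` reflected in a horizontal and in a vertical line. -/
def star {k l : ℕ} (D : Diagram k l) : Diagram l k where
  partner x := halfTurn k l (D.partner ((halfTurn k l).symm x))
  partner_partner x := by simp [D.partner_partner]
  partner_ne x := by
    obtain ⟨y, rfl⟩ := (halfTurn k l).surjective x
    simp [D.partner_ne]

/-- The diagram `s_{i+1}` on `n + 1` strings (`i = 0, …, n - 1`): the strings at the adjacent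
positions `i.castSucc` and `i.succ` cross, all others are vertical. -/
def sDiagram {n : ℕ} (i : Fin n) : Diagram (n + 1) (n + 1) := ofPerm (Equiv.swap i.castSucc i.succ)

/-- The diagram `e_{i+1}` on `n + 1` strings (`i = 0, …, n - 1`): the positions `i.castSucc` and
`i.succ` are joined by an arc on the lower line and by an arc on the upper line, all other strings
are vertical. -/
def eDiagram {n : ℕ} (i : Fin n) : Diagram (n + 1) (n + 1) where
  partner := Sum.elim
    (fun x => if x = i.castSucc then .inl i.succ else if x = i.succ then .inl i.castSucc else .inr x)
    (fun x => if x = i.castSucc then .inr i.succ else if x = i.succ then .inr i.castSucc else .inl x)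
  partner_partner := by
    have h : i.succ ≠ i.castSucc := i.castSucc_lt_succ.ne'
    rintro (x | x) <;> by_cases h1 : x = i.castSucc <;> by_cases h2 : x = i.succ <;>
      simp [h1, h2, h]
  partner_ne := by
    have h : i.succ ≠ i.castSucc := i.castSucc_lt_succ.ne'
    rintro (x | x) <;> by_cases h1 : x = i.castSucc <;> by_cases h2 : x = i.succ <;>
      simp [h1, h2, h, h.symm]

/-- The number of crossings of a diagram drawn with as few crossings as possible: with the nodes
read around the boundary (lower line from left to right, then upper line from right to left), two
arcs cross exactly when their ends interleave. -/
def crossings {k l : ℕ} (D : Diagram k l) : ℕ :=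
  let pos : Fin k ⊕ Fin l → ℕ := Sum.elim (fun i => i) (fun j => k + (l - 1 - j))
  (Finset.univ.filter fun x : (Fin k ⊕ Fin l) × (Fin k ⊕ Fin l) =>
    pos x.1 < pos x.2 ∧ pos x.2 < pos (D.partner x.1) ∧
      pos (D.partner x.1) < pos (D.partner x.2)).card

end Diagram

/-- `B_k^l(δ)`: the free `K`-module on the `(k, l)` Brauer diagrams. -/
def Hom {K : Type*} [CommRing K] (_δ : K) (k l : ℕ) : Type _ := Diagram k l →₀ K

section Hom

variable {K : Type*} [CommRing K] {δ : K} {k l p q : ℕ}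

noncomputable instance : AddCommGroup (Hom δ k l) := inferInstanceAs (AddCommGroup (Diagram k l →₀ K))

noncomputable instance : Module K (Hom δ k l) := inferInstanceAs (Module K (Diagram k l →₀ K))

/-- A diagram as an element of `B_k^l(δ)`. -/
noncomputable def diag (δ : K) (D : Diagram k l) : Hom δ k l := Finsupp.single D (1 : K)

/-- A linear map out of `B_k^l(δ)` is given by its values on diagrams. -/
noncomputable def Hom.lift {M : Type*} [AddCommGroup M] [Module K M] (f : Diagram k l → M) :
    Hom δ k l →ₗ[K] M := Finsupp.linearCombination K f

@[simp]
theorem Hom.lift_diag {M : Type*} [AddCommGroup M] [Module K M] (f : Diagram k l → M)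
    (D : Diagram k l) : Hom.lift f (diag δ D) = f D :=
  (Finsupp.linearCombination_single K (1 : K) D).trans (one_smul K (f D))

theorem Hom.induction {P : Hom δ k l → Prop} (x : Hom δ k l) (zero : P 0)
    (add : ∀ x y, P x → P y → P (x + y)) (smul : ∀ (c : K) D, P (c • diag δ D)) : P x := by
  refine Finsupp.induction_linear (motive := P) x zero (fun f g hf hg => add f g hf hg) ?_
  intro D c
  have h : (Finsupp.single D c : Diagram k l →₀ K) = c • Finsupp.single D (1 : K) := by simp
  exact h ▸ smul c D

/-- Composition `B_l^p(δ) × B_k^l(δ) → B_k^p(δ)`: the bilinear map with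
`D₁ ∘ D₂ = δ ^ f(D₁, D₂) D`, where `D` is the composite diagram and `f(D₁, D₂)` the number of free
loops of the concatenation. -/
noncomputable def Hom.comp : Hom δ l p →ₗ[K] Hom δ k l →ₗ[K] Hom δ k p :=
  Hom.lift fun D₁ => Hom.lift fun D₂ => δ ^ D₁.loops D₂ • diag δ (D₁.comp D₂)

@[simp]
theorem Hom.comp_diag (D₁ : Diagram l p) (D₂ : Diagram k l) :
    Hom.comp (diag δ D₁) (diag δ D₂) = δ ^ D₁.loops D₂ • diag δ (D₁.comp D₂) := by
  simp [Hom.comp]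

/-- The identity morphism. -/
noncomputable def Hom.id (δ : K) (r : ℕ) : Hom δ r r := diag δ (Diagram.ofPerm 1)

theorem Hom.comp_assoc (x : Hom δ p q) (y : Hom δ l p) (z : Hom δ k l) :
    Hom.comp (Hom.comp x y) z = Hom.comp x (Hom.comp y z) := by
  induction x using Hom.induction with
  | zero => simp
  | add x x' hx hx' => simp [hx, hx']
  | smul c D₁ =>
    induction y using Hom.induction with
    | zero => simp
    | add y y' hy hy' => simp only [map_add, LinearMap.add_apply, hy, hy']
    | smul c' D₂ =>
      induction z using Hom.induction with
      | zero => simp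
      | add z z' hz hz' => simp only [map_add, hz, hz']
      | smul c'' D₃ =>
        obtain ⟨h1, h2⟩ := Diagram.comp_assoc_aux D₁ D₂ D₃
        simp only [map_smul, LinearMap.smul_apply, Hom.comp_diag, smul_smul, h1]
        congr 1
        have h3 : δ ^ D₂.loops D₃ * δ ^ D₁.loops (D₂.comp D₃) =
            δ ^ D₁.loops D₂ * δ ^ (D₁.comp D₂).loops D₃ := by rw [← pow_add, h2, pow_add]
        linear_combination (-c * c' * c'') * h3

theorem Hom.id_comp (x : Hom δ k l) : Hom.comp (Hom.id δ l) x = x := by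
  induction x using Hom.induction with
  | zero => simp
  | add x x' hx hx' => rw [map_add, hx, hx']
  | smul c D =>
    obtain ⟨h1, h2⟩ := Diagram.one_comp_aux D
    rw [map_smul, Hom.id, Hom.comp_diag, h1, h2, pow_zero, one_smul]

theorem Hom.comp_id (x : Hom δ k l) : Hom.comp x (Hom.id δ k) = x := by
  induction x using Hom.induction with
  | zero => simp
  | add x x' hx hx' => rw [map_add, LinearMap.add_apply, hx, hx']
  | smul c D =>
    obtain ⟨h1, h2⟩ := Diagram.comp_one_aux D
    rw [map_smul, LinearMap.smul_apply, Hom.id, Hom.comp_diag, h1, h2, pow_zero, one_smul]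

/-- The linear map `* : B_k^l(δ) → B_l^k(δ)`. -/
noncomputable def Hom.star : Hom δ k l →ₗ[K] Hom δ l k := Hom.lift fun D => diag δ D.star

end Hom

/-- The Brauer algebra `B_r(δ) = B_r^r(δ)`; its product is the composition of diagrams. -/
abbrev BrauerAlgebra {K : Type*} [CommRing K] (δ : K) (r : ℕ) : Type _ := Hom δ r r

section BrauerAlgebra

variable {K : Type*} [CommRing K] {δ : K} {r : ℕ}

noncomputable instance : Mul (BrauerAlgebra δ r) := ⟨fun x y => Hom.comp x y⟩

noncomputable instance : One (BrauerAlgebra δ r) := ⟨Hom.id δ r⟩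

noncomputable instance : Ring (BrauerAlgebra δ r) where
  __ := (inferInstance : AddCommGroup (Hom δ r r))
  mul_assoc x y z := Hom.comp_assoc x y z
  one_mul x := Hom.id_comp x
  mul_one x := Hom.comp_id x
  left_distrib x y z := map_add (Hom.comp x) y z
  right_distrib x y z := by
    change Hom.comp (x + y) z = Hom.comp x z + Hom.comp y z
    rw [map_add, LinearMap.add_apply]
  zero_mul x := by
    change Hom.comp 0 x = 0
    rw [map_zero, LinearMap.zero_apply]
  mul_zero x := map_zero (Hom.comp x)

noncomputable instance : Algebra K (BrauerAlgebra δ r) :=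
  Algebra.ofModule
    (fun c x y => by
      change Hom.comp (c • x) y = c • Hom.comp x y
      rw [map_smul, LinearMap.smul_apply])
    (fun c x y => map_smul (Hom.comp x) c y)

/-- The element `Σ(r)`: the sum of all permutations (the case `ε = -1` of
`∑ (-ε) ^ |σ| σ`). -/
noncomputable def symmetrizer (δ : K) (r : ℕ) : BrauerAlgebra δ r :=
  ∑ σ : Equiv.Perm (Fin r), diag δ (Diagram.ofPerm σ)

/-- The generator `s_{i+1}` of `B_{n+1}(δ)`. -/
noncomputable def s (δ : K) {n : ℕ} (i : Fin n) : BrauerAlgebra δ (n + 1) :=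
  diag δ (Diagram.sDiagram i)

/-- The generator `e_{i+1}` of `B_{n+1}(δ)`. -/
noncomputable def e (δ : K) {n : ℕ} (i : Fin n) : BrauerAlgebra δ (n + 1) :=
  diag δ (Diagram.eDiagram i)

/-- `E(k) = e_n e_{n-2} ⋯ e_{n+2-2k}` in `B_{n+1}(δ)`, for `2k ≤ n + 1`; the factors are counted by
`j = 0, …, k - 1`, and `e_{n-2j}` is the generator with (shifted) index `n - 1 - 2j`. -/
noncomputable def E (δ : K) (n k : ℕ) (hk : 2 * k ≤ n + 1) : BrauerAlgebra δ (n + 1) :=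
  (List.ofFn fun j : Fin k => e δ (⟨n - 1 - 2 * j, by omega⟩ : Fin n)).prod

/-- `Ξ_k = Σ(n+1) E(k) Σ(n+1)`. -/
noncomputable def Xi (δ : K) (n k : ℕ) (hk : 2 * k ≤ n + 1) : BrauerAlgebra δ (n + 1) :=
  symmetrizer δ (n + 1) * E δ n k hk * symmetrizer δ (n + 1)

end BrauerAlgebra

/-- The element `Φ = ∑_{k = 0}^{⌊(n+1)/2⌋} a_k Ξ_k` of `B_{n+1}(-2n)`, where
`a_k = 1 / ((2 ^ k k!) ^ 2 (n + 1 - 2k)!)`. -/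
noncomputable def Phi (K : Type*) [Field K] (n : ℕ) : BrauerAlgebra (-2 * n : K) (n + 1) :=
  ∑ k : Fin ((n + 1) / 2 + 1),
    (((2 ^ (k : ℕ) * (k : ℕ).factorial) ^ 2 * (n + 1 - 2 * (k : ℕ)).factorial : ℕ) : K)⁻¹ •
      Xi (-2 * n : K) n k (by omega)

/-- `z` is the central idempotent of the algebra `R` which corresponds to the one-dimensional
representation `ρ`: it acts as the identity in `ρ`, and `R` acts on `z` through `ρ`. -/
structure IsCentralIdempotentOf {K R : Type*} [CommRing K] [Ring R] [Algebra K R]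
    (ρ : R →ₐ[K] K) (z : R) : Prop where
  idempotent : z * z = z
  central : ∀ a, a * z = z * a
  apply_eq_one : ρ z = 1
  mul_eq : ∀ a, a * z = ρ a • z

section Functor

open scoped TensorProduct

variable {K V : Type*} [Field K] [AddCommGroup V] [Module K V] {ι : Type*} [Fintype ι]
  [DecidableEq ι]

/-- The element `c₀ = ∑ b_i ⊗ b̄_i` of `V ⊗ V`, where `b̄` is the dual basis of `b`:
`ω (b̄_i) (b_j) = δ_{ij}`. -/
noncomputable def canonicalTensor (ω : LinearMap.BilinForm K V) (hω : ω.Nondegenerate)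
    (b : Module.Basis ι K V) : ⨂[K]^2 V :=
  ∑ i, PiTensorProduct.tprod K ![b i, ω.dualBasis hω b i]

/-- The contribution of a pair of nodes `x`, `y` joined by an arc to the matrix entry of a diagram
at the basis vectors `b_{c 0} ⊗ b_{c 1} ⊗ ⋯` (source) and `b_{d 0} ⊗ b_{d 1} ⊗ ⋯` (target): a
through string is the identity of `V`, an arc joining two lower nodes is the form `ω`, and an arc
joining two upper nodes is `c₀`. Each arc is counted at one of its ends only. -/
noncomputable def arcFactor (ω : LinearMap.BilinForm K V) (hω : ω.Nondegenerate)
    (b : Module.Basis ι K V) {k l : ℕ} (c : Fin k → ι) (d : Fin l → ι) :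
    Fin k ⊕ Fin l → Fin k ⊕ Fin l → K
  | .inl i, .inl j => if i < j then ω (b (c i)) (b (c j)) else 1
  | .inl i, .inr j => if c i = d j then 1 else 0
  | .inr _, .inl _ => 1
  | .inr i, .inr j => if i < j then b.repr (ω.dualBasis hω b (d i)) (d j) else 1

/-- The value `F(D) : V^{⊗k} → V^{⊗l}` on a diagram of the functor `F` attached to a skew symmetric
form `ω`. It is built from `id_V`, `ω`, `c₀` and `- P` (`P` the flip of `V ⊗ V`, one factor for
each crossing) along a drawing of `D` with as few crossings as possible, and is given here by its
matrix in the basis `b`. -/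
noncomputable def functorOnDiagram (ω : LinearMap.BilinForm K V) (hω : ω.Nondegenerate)
    (b : Module.Basis ι K V) {k l : ℕ} (D : Diagram k l) : ⨂[K]^k V →ₗ[K] ⨂[K]^l V :=
  (Basis.piTensorProduct fun _ : Fin k => b).constr K fun c =>
    ∑ d : Fin l → ι, ((-1) ^ D.crossings * ∏ x, arcFactor ω hω b c d x (D.partner x)) •
      PiTensorProduct.tprod K fun j => b (d j)

/-- The linear map `F_k^l : B_k^l(δ) → Hom(V^{⊗k}, V^{⊗l})`. -/
noncomputable def functorF (ω : LinearMap.BilinForm K V) (hω : ω.Nondegenerate)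
    (b : Module.Basis ι K V) (δ : K) {k l : ℕ} : Hom δ k l →ₗ[K] (⨂[K]^k V →ₗ[K] ⨂[K]^l V) :=
  Hom.lift (functorOnDiagram ω hω b)

/-- The characterisation of the functor `F` attached to a skew symmetric form: a `K`-linear
functor from the category of Brauer diagrams to tensor powers of `V` which respects tensor
products and sends the crossing `X` to `- P`, the arc `A` to the form and the arc `U` to `c₀`
(that `I` is sent to `id_V` is the case `r = 1` of `map_id`). -/
structure TensorFunctor (ω : LinearMap.BilinForm K V) (hω : ω.Nondegenerate)
    (b : Module.Basis ι K V) (δ : K) where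
  map : ∀ {k l : ℕ}, Hom δ k l →ₗ[K] (⨂[K]^k V →ₗ[K] ⨂[K]^l V)
  map_id : ∀ r, map (Hom.id δ r) = LinearMap.id
  map_comp : ∀ {k l p : ℕ} (x : Hom δ l p) (y : Hom δ k l),
    map (Hom.comp x y) = map x ∘ₗ map y
  map_tensor : ∀ {p q k l : ℕ} (D : Diagram p q) (D' : Diagram k l)
    (x : ⨂[K]^p V) (y : ⨂[K]^k V),
    map (diag δ (D.tensor D')) (TensorPower.mulEquiv (x ⊗ₜ[K] y)) =
      TensorPower.mulEquiv (map (diag δ D) x ⊗ₜ[K] map (diag δ D') y)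
  map_X : ∀ v w : V, map (diag δ Diagram.X) (PiTensorProduct.tprod K ![v, w]) =
    - PiTensorProduct.tprod K ![w, v]
  map_A : ∀ v w : V, map (diag δ Diagram.A) (PiTensorProduct.tprod K ![v, w]) =
    ω v w • PiTensorProduct.tprod K ![]
  map_U : map (diag δ Diagram.U) (PiTensorProduct.tprod K ![]) = canonicalTensor ω hω b

end Functor

end Brauer

/-! The element `Phi` is the sum of all Brauer diagrams on `n + 1` strings (`Phi_eq_totalSum`): the
symmetric groups acting on the lower and upper nodes permute the diagrams with `k` lower arcs
transitively, and the denominator of `a_k` is the order of a stabiliser, so that `a_k Ξ_k` is the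
sum of these diagrams, each taken once. In `orbitSum_eq` this is proved by induction on `k`, joining
two through strings at a time.

For the sum of all diagrams annihilation is a count (`cap_comp_totalSum`). A cap joining `i` and `j`
turns a diagram into one with the arc `i j`; each such result arises from one diagram for every
possible partner of `i`. The partner `j` closes a loop and contributes `δ`, each of the other `k + l
- 2` contributes `1`, and `δ + k + l - 2 = 0` for `δ = -2n`, `k = l = n + 1`. A diagram with a lower
arc is `δ⁻¹` times its product with a cap, so it also kills the sum, while permutations fix it.
Hence every `a` acts on the sum by the scalar `permCoeff a` (`mul_totalSum`), and by reflection also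
from the right (`totalSum_mul`). The square, the trivial representation, the central idempotent and
the ideal all follow.

For the explicit `functorF`, each matrix entry of the sum is a signed sum over all pairings, that
is, the Pfaffian of a Gram matrix of `2n + 2` vectors of `V`. It is alternating and multilinear in
these vectors, hence vanishes in dimension `2n` (`functorF_totalSum`). An arbitrary `TensorFunctor`
is handled without comparing it with `functorF` (`TensorFunctor.map_totalSum`): a tensor `T` in the
image of `F(Φ)` is antisymmetric and has zero contractions, so every permutation diagram fixes `T`
and all other diagrams kill it under `functorF`. Thus `0 = functorF(Φ) T = (n + 1)! T`. -/

namespace Brauer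

/-! ### Composition with permutations and caps as renaming and recoupling of nodes; reflection. -/

namespace Diagram

variable {k l p q r : ℕ}

/-- The diagram obtained from `D` by renaming the nodes along a permutation. -/
def conj (π : Equiv.Perm (Fin k ⊕ Fin l)) (D : Diagram k l) : Diagram k l where
  partner x := π (D.partner (π.symm x))
  partner_partner x := by simp [D.partner_partner]
  partner_ne x h := D.partner_ne (π.symm x) (by
    rw [Equiv.eq_symm_apply]; exact h)

theorem conj_partner (π : Equiv.Perm (Fin k ⊕ Fin l)) (D : Diagram k l) (x) :
    (conj π D).partner x = π (D.partner (π.symm x)) := rfl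

theorem conj_partner_apply (π : Equiv.Perm (Fin k ⊕ Fin l)) (D : Diagram k l) (x) :
    (conj π D).partner (π x) = π (D.partner x) := by simp [conj_partner]

theorem conj_one (D : Diagram k l) : conj 1 D = D := rfl

theorem conj_conj (π π' : Equiv.Perm (Fin k ⊕ Fin l)) (D : Diagram k l) :
    conj π (conj π' D) = conj (π * π') D := rfl

theorem partner_injective (D : Diagram k l) : Function.Injective D.partner :=
  fun x y h => by rw [← D.partner_partner x, h, D.partner_partner]

theorem partner_eq_iff (D : Diagram k l) {x y} : D.partner x = y ↔ x = D.partner y :=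
  ⟨fun h => by rw [← h, D.partner_partner], fun h => by rw [h, D.partner_partner]⟩

theorem conj_eq_self {π : Equiv.Perm (Fin k ⊕ Fin l)} {D : Diagram k l}
    (h : ∀ x, D.partner (π x) = π (D.partner x)) : conj π D = D := by
  ext1
  funext x
  obtain ⟨y, rfl⟩ := π.surjective x
  rw [conj_partner_apply, h]

/-- Recoupling of the arcs at `a` and `b`: the node `a` is joined to `b`, and their former partners
are joined. -/
def recouple (a b : Fin k ⊕ Fin l) (D : Diagram k l) : Diagram k l :=
  conj (Equiv.swap b (D.partner a)) D

theorem colour_eq_zero {D : Diagram k l} {u : Fin k → Bool} {v : Fin l → Bool} (s)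
    (h : Sum.elim u v (D.partner s) ≠ Sum.elim u v s) : colour D u v = 0 :=
  if_neg fun h' => h (h' s)

theorem colour_congr {k' l' : ℕ} {D : Diagram k l} {u : Fin k → Bool} {v : Fin l → Bool}
    {D' : Diagram k' l'} {u' : Fin k' → Bool} {v' : Fin l' → Bool}
    (h : (∀ s, Sum.elim u v (D.partner s) = Sum.elim u v s) ↔
      ∀ s, Sum.elim u' v' (D'.partner s) = Sum.elim u' v' s) : colour D u v = colour D' u' v' := by
  unfold colour
  congr 1
  exact propext h

theorem colour_conj (π : Equiv.Perm (Fin k ⊕ Fin l)) (D : Diagram k l)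
    {u : Fin k → Bool} {v : Fin l → Bool} {u' : Fin k → Bool} {v' : Fin l → Bool}
    (h : ∀ s, Sum.elim u v (π s) = Sum.elim u' v' s) :
    colour (conj π D) u v = colour D u' v' := by
  apply colour_congr
  rw [π.symm.forall_congr_left]
  simp [conj_partner_apply, h]

theorem colour_ofPerm (σ : Equiv.Perm (Fin r)) (u v : Fin r → Bool) :
    colour (ofPerm σ) u v = if u = v ∘ σ then 1 else 0 := by
  unfold colour
  congr 1
  simp only [ofPerm, Sum.forall, eq_iff_iff]
  constructor
  · rintro ⟨h, -⟩; funext i; simpa using (h i).symm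
  · rintro rfl; exact ⟨fun _ => rfl, fun _ => by simp⟩

/-- By `sum_colour` and `eq_of_colour` a composite and its loop number can be read off from counting
two-colourings of the glued nodes. For a permutation the colour function is a Kronecker delta, so
just one glued colouring contributes. -/
theorem ofPerm_comp_aux (σ : Equiv.Perm (Fin l)) (D : Diagram k l) :
    comp (ofPerm σ) D = conj (Equiv.sumCongr 1 σ) D ∧ loops (ofPerm σ) D = 0 := by
  apply eq_of_colour
  intro u v
  rw [← sum_colour]
  simp only [colour_ofPerm, ite_mul, one_mul, zero_mul, Finset.sum_ite_eq',
    Finset.mem_univ, if_true, pow_zero]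
  refine (colour_conj _ _ ?_).symm
  rintro (s | s) <;> rfl

theorem comp_ofPerm_aux (σ : Equiv.Perm (Fin k)) (D : Diagram k l) :
    comp D (ofPerm σ) = conj (Equiv.sumCongr σ⁻¹ 1) D ∧ loops D (ofPerm σ) = 0 := by
  apply eq_of_colour
  intro u v
  rw [← sum_colour]
  have h : ∀ m : Fin k → Bool, u = m ∘ σ ↔ m = u ∘ σ.symm := fun m =>
    ⟨by rintro rfl; funext; simp, by rintro rfl; funext; simp⟩
  simp only [colour_ofPerm, h, mul_ite, mul_one, mul_zero, Finset.sum_ite_eq',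
    Finset.mem_univ, if_true, pow_zero, one_mul]
  refine (colour_conj _ _ ?_).symm
  rintro (s | s) <;> rfl

/-- The diagram with an arc joining the nodes `i` and `j` on both lines, all other strings being
vertical. -/
def cap (i j : Fin r) (hij : i ≠ j) : Diagram r r where
  partner := Sum.elim
    (fun x => if x = i then .inl j else if x = j then .inl i else .inr x)
    (fun x => if x = i then .inr j else if x = j then .inr i else .inl x)
  partner_partner := by
    rintro (x | x) <;> by_cases h1 : x = i <;> by_cases h2 : x = j <;>
      simp [h1, h2, hij.symm]
  partner_ne := by
    rintro (x | x) <;> by_cases h1 : x = i <;> by_cases h2 : x = j <;>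
      simp [h1, h2, hij, hij.symm]

theorem eDiagram_eq_cap {n : ℕ} (i : Fin n) :
    eDiagram i = cap i.castSucc i.succ i.castSucc_lt_succ.ne := rfl

theorem colour_cap (i j : Fin r) (hij : i ≠ j) (u v : Fin r → Bool) :
    colour (cap i j hij) u v =
      if u i = u j ∧ v i = v j ∧ ∀ x, x ≠ i → x ≠ j → u x = v x then 1 else 0 := by
  unfold colour
  congr 1
  simp only [cap, Sum.forall, eq_iff_iff, Sum.elim_inl, Sum.elim_inr]
  constructor
  · rintro ⟨h1, h2⟩
    refine ⟨?_, ?_, ?_⟩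
    · simpa using (h1 i).symm
    · simpa using (h2 i).symm
    · intro x hx hx'
      simpa [hx, hx'] using (h1 x).symm
  · rintro ⟨h1, h2, h3⟩
    constructor <;> intro x <;> by_cases hx : x = i <;> by_cases hx' : x = j <;>
      simp_all

/-- The ends of an arc may carry either colour, independently of all other nodes. -/
theorem colour_update (D : Diagram k l) (u : Fin k → Bool) (v : Fin l → Bool) {i j : Fin l}
    (h : D.partner (.inr i) = .inr j) (hv : v i = v j) (m : Fin l → Bool) (hm : m i = m j)
    (hmv : ∀ x, x ≠ i → x ≠ j → m x = v x) : colour D u m = colour D u v := by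
  have key : ∀ (m v : Fin l → Bool), v i = v j → m i = m j →
      (∀ x, x ≠ i → x ≠ j → m x = v x) →
      (∀ s, Sum.elim u m (D.partner s) = Sum.elim u m s) →
      ∀ s, Sum.elim u v (D.partner s) = Sum.elim u v s := by
    intro m v hv hm hmv H s
    have h' : D.partner (.inr j) = .inr i := by rw [← h, D.partner_partner]
    by_cases h1 : s = .inr i
    · subst h1; rw [h]; exact hv.symm
    by_cases h2 : s = .inr j
    · subst h2; rw [h']; exact hv
    have h3 : D.partner s ≠ .inr i := by rw [Ne, partner_eq_iff, h]; exact h2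
    have h4 : D.partner s ≠ .inr j := by rw [Ne, partner_eq_iff, h']; exact h1
    have e : ∀ t : Fin k ⊕ Fin l, t ≠ .inr i → t ≠ .inr j → Sum.elim u m t = Sum.elim u v t := by
      rintro (t | t) h1 h2
      · rfl
      · exact hmv t (fun h => h1 (by rw [h])) (fun h => h2 (by rw [h]))
    rw [← e _ h1 h2, ← e _ h3 h4, H]
  exact colour_congr ⟨key m v hv hm hmv, key v m hm hv fun x h1 h2 => (hmv x h1 h2).symm⟩

theorem recouple_partner (D : Diagram k l) {a b : Fin k ⊕ Fin l} (hab : a ≠ b) :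
    (recouple a b D).partner a = b := by
  rw [recouple, conj_partner, Equiv.symm_swap, Equiv.swap_apply_of_ne_of_ne hab (D.partner_ne a).symm,
    Equiv.swap_apply_right]

theorem recouple_recouple (D : Diagram k l) {a b : Fin k ⊕ Fin l} (hab : a ≠ b) :
    recouple a (D.partner a) (recouple a b D) = D := by
  rw [recouple, recouple_partner D hab, recouple, conj_conj, Equiv.swap_comm, Equiv.swap_mul_self,
    conj_one]

theorem recouple_of_partner_eq {D : Diagram k l} {a b : Fin k ⊕ Fin l} (h : D.partner a = b) :
    recouple a b D = D := by
  rw [recouple, h, Equiv.swap_self]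
  rfl

theorem conj_recouple (π : Equiv.Perm (Fin k ⊕ Fin l)) (a b : Fin k ⊕ Fin l) (D : Diagram k l) :
    conj π (recouple a b D) = recouple (π a) (π b) (conj π D) := by
  rw [recouple, recouple, conj_partner_apply, conj_conj, conj_conj, Equiv.swap_apply_apply]
  simp

/-- Count glued colourings. If `D` already joins `i` and `j`, their common colour is free, which
gives the factor `2` of one loop. Otherwise it is forced by the former partner of `i`, and the
remaining condition is that of the recoupled diagram. -/
theorem cap_comp_aux (i j : Fin l) (hij : i ≠ j) (D : Diagram k l) :
    comp (cap i j hij) D = recouple (.inr i) (.inr j) D ∧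
      loops (cap i j hij) D = if D.partner (.inr i) = .inr j then 1 else 0 := by
  apply eq_of_colour
  intro u v
  rw [← sum_colour]
  by_cases hD : D.partner (.inr i) = .inr j
  · rw [if_pos hD, recouple_of_partner_eq hD]
    by_cases hv : v i = v j
    -- Exactly two glued colourings are compatible with the cap, one for each common value at `i`
    -- and `j`.
    · have hsum : ∀ m : Fin l → Bool, colour (cap i j hij) m v * colour D u m =
          if m = (fun x => if x = i ∨ x = j then true else v x) ∨
            m = (fun x => if x = i ∨ x = j then false else v x) then colour D u v else 0 := by
        intro m
        rw [colour_cap]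
        by_cases hm : m i = m j ∧ v i = v j ∧ ∀ x, x ≠ i → x ≠ j → m x = v x
        · rw [if_pos hm, one_mul, if_pos, colour_update D u v hD hv m hm.1 hm.2.2]
          have : m i = true ∨ m i = false := by cases m i <;> simp
          refine this.imp (fun h => ?_) (fun h => ?_) <;>
          · funext x
            by_cases h1 : x = i
            · simp [h1, h]
            · by_cases h2 : x = j
              · simp [h2, ← hm.1, h]
              · simp [h1, h2, hm.2.2 x h1 h2]
        · rw [if_neg hm, zero_mul, if_neg]
          contrapose! hm
          rcases hm with rfl | rfl <;> simp +contextual [hv]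
      simp_rw [hsum, ← Finset.mem_singleton (a := (_ : Fin l → Bool)), ← Finset.mem_union]
      rw [Finset.sum_ite_mem, Finset.univ_inter, Finset.sum_const, Finset.card_union_of_disjoint]
      · simp
      · rw [Finset.disjoint_singleton]
        intro h
        simpa using congrFun h i
    · rw [colour_eq_zero (.inr i) (by rw [hD]; exact fun h => hv h.symm), mul_zero]
      refine Finset.sum_eq_zero fun m _ => ?_
      rw [colour_cap, if_neg (fun h => hv h.2.1), zero_mul]
  · rw [if_neg hD, pow_zero, one_mul, recouple]
    have hDi : D.partner (.inr i) ≠ .inr i := D.partner_ne _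
    set x := D.partner (.inr i) with hx
    have hxi : D.partner x = .inr i := by rw [hx, D.partner_partner]
    set w := Sum.elim u v with hw
    -- The only glued colouring that can contribute: outside `i`, `j` it agrees with `v` through the
    -- vertical strings, and at `i`, `j` it has the colour of the partner `x` of `i`.
    set m₀ : Fin l → Bool := fun z => if z = i ∨ z = j then w x else v z with hm₀
    have hm₀e : ∀ t : Fin k ⊕ Fin l, t ≠ .inr i → t ≠ .inr j → Sum.elim u m₀ t = w t := by
      rintro (t | t) h1 h2
      · rfl
      · have h1' : t ≠ i := fun h => h1 (by rw [h])
        have h2' : t ≠ j := fun h => h2 (by rw [h])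
        simp [hm₀, h1', h2', hw]
    have hwx : Sum.elim u m₀ x = w x := hm₀e x hDi hD
    rw [Finset.sum_eq_single m₀]
    · by_cases hv : v i = v j
      · rw [colour_cap, if_pos ⟨by simp [hm₀], hv, fun z h1 h2 => by simp [hm₀, h1, h2]⟩, one_mul]
        apply colour_congr
        set π := Equiv.swap (.inr j) x with hπ
        have hπe : ∀ t : Fin k ⊕ Fin l, t ≠ .inr i → t ≠ .inr j → t ≠ x → π t = t :=
          fun t _ h2 h3 => Equiv.swap_apply_of_ne_of_ne h2 h3
        have hπi : π (.inr i) = .inr i :=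
          Equiv.swap_apply_of_ne_of_ne (fun h => hij (Sum.inr_injective h)) hDi.symm
        have hwij : w (.inr i) = w (.inr j) := hv
        have hDj : D.partner (.inr j) ≠ .inr i := by
          rw [Ne, partner_eq_iff]; exact fun h => hD h.symm
        have hDjx : D.partner (.inr j) ≠ x := by
          rw [Ne, partner_eq_iff, hxi]; exact fun h => hij (Sum.inr_injective h).symm
        have hmi : Sum.elim u m₀ (.inr i) = w x := by simp [hm₀]
        have hmj : Sum.elim u m₀ (.inr j) = w x := by simp [hm₀]
        constructor
        · intro H s
          obtain ⟨t, rfl⟩ := π.surjective s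
          rw [conj_partner_apply]
          change w _ = w _
          have Hj := H (.inr j)
          rw [hmj, hm₀e _ hDj (D.partner_ne _)] at Hj
          by_cases h1 : t = .inr i
          · subst h1
            rw [hπi, ← hx, hπ, Equiv.swap_apply_right, hwij]
          by_cases h2 : t = .inr j
          · subst h2
            rw [hπe _ hDj (D.partner_ne _) hDjx, hπ, Equiv.swap_apply_left, Hj]
          by_cases h3 : t = x
          · subst h3
            rw [hxi, hπi, hπ, Equiv.swap_apply_right, hwij]
          have g1 : D.partner t ≠ .inr i := by rw [Ne, partner_eq_iff]; exact h3
          have g3 : D.partner t ≠ x := by rw [Ne, partner_eq_iff, hxi]; exact h1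
          have Ht := H t
          rw [hm₀e t h1 h2] at Ht
          rw [hπe t h1 h2 h3]
          by_cases h4 : D.partner t = .inr j
          · rw [h4, hmj] at Ht
            rw [h4, hπ, Equiv.swap_apply_left, Ht]
          · rw [hπe _ g1 h4 g3, ← Ht, hm₀e _ g1 h4]
        · intro H t
          have H' : ∀ t, w (π (D.partner t)) = w (π t) := fun t => by
            rw [← conj_partner_apply]; exact H _
          have Hj := H' (.inr j)
          rw [hπe _ hDj (D.partner_ne _) hDjx, hπ, Equiv.swap_apply_left] at Hj
          by_cases h1 : t = .inr i
          · subst h1; rw [← hx, hmi, hwx]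
          by_cases h2 : t = .inr j
          · subst h2; rw [hmj, hm₀e _ hDj (D.partner_ne _), Hj]
          by_cases h3 : t = x
          · subst h3; rw [hxi, hmi, hwx]
          have g1 : D.partner t ≠ .inr i := by rw [Ne, partner_eq_iff]; exact h3
          have g3 : D.partner t ≠ x := by rw [Ne, partner_eq_iff, hxi]; exact h1
          have Ht := H' t
          rw [hπe t h1 h2 h3] at Ht
          rw [hm₀e t h1 h2]
          by_cases h4 : D.partner t = .inr j
          · rw [h4, hπ, Equiv.swap_apply_left] at Ht
            rw [h4, hmj, Ht]
          · rw [hπe _ g1 h4 g3] at Ht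
            rw [hm₀e _ g1 h4, Ht]
      -- Both sides vanish here: the cap and the recoupled diagram each have the upper arc `i j`,
      -- whose ends carry different colours.
      · rw [colour_cap, if_neg (fun h => hv h.2.1), zero_mul]
        refine (colour_eq_zero (.inr i) ?_).symm
        have : (conj (Equiv.swap (.inr j) x) D).partner (.inr i) = .inr j := by
          rw [conj_partner, Equiv.symm_swap, Equiv.swap_apply_of_ne_of_ne
            (fun h => hij (Sum.inr_injective h)) hDi.symm, ← hx, Equiv.swap_apply_right]
        rw [this]
        exact fun h => hv h.symm
    · intro m _ hm
      rw [colour_cap]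
      split_ifs with h
      · rw [one_mul]
        apply colour_eq_zero (.inr i)
        rw [← hx]
        have : Sum.elim u m x = w x := by
          rcases hxc : x with z | z
          · rfl
          · exact h.2.2 z (fun h => hDi (by rw [hxc, h])) (fun h => hD (by rw [hxc, h]))
        rw [this]
        intro hwm
        apply hm
        funext z
        by_cases h1 : z = i
        · simp [hm₀, h1, hwm]
        · by_cases h2 : z = j
          · simp [hm₀, h2, hwm, h.1]
          · simp [hm₀, h1, h2, h.2.2]
      · simp
    · simp

theorem halfTurn_halfTurn (x : Fin k ⊕ Fin l) : halfTurn l k (halfTurn k l x) = x := by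
  rcases x with x | x <;> simp [halfTurn]

theorem star_partner_halfTurn (D : Diagram k l) (x) :
    D.star.partner (halfTurn k l x) = halfTurn k l (D.partner x) := by simp [star]

theorem star_star (D : Diagram k l) : D.star.star = D := by
  ext1
  funext x
  rw [← halfTurn_halfTurn x, star_partner_halfTurn, star_partner_halfTurn, halfTurn_halfTurn,
    halfTurn_halfTurn]

theorem star_injective : Function.Injective (star : Diagram k l → Diagram l k) :=
  fun D D' h => by rw [← star_star D, h, star_star]

theorem colour_star (D : Diagram k l) (u : Fin l → Bool) (v : Fin k → Bool) :
    colour D.star u v = colour D (v ∘ Fin.rev) (u ∘ Fin.rev) := by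
  apply colour_congr
  have h : ∀ s, Sum.elim u v (halfTurn k l s) = Sum.elim (v ∘ Fin.rev) (u ∘ Fin.rev) s := by
    rintro (s | s) <;> rfl
  rw [← (halfTurn k l).forall_congr_right]
  simp [star_partner_halfTurn, h]

/-- The half turn reverses the order of the glued nodes, so the two counts of glued colourings agree
after reindexing by `Fin.rev`. -/
theorem star_comp_aux (D₁ : Diagram l p) (D₂ : Diagram k l) :
    (comp D₁ D₂).star = comp D₂.star D₁.star ∧ loops D₁ D₂ = loops D₂.star D₁.star := by
  apply eq_of_colour
  intro u v
  rw [colour_star, ← sum_colour, ← sum_colour]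
  simp only [colour_star]
  refine Fintype.sum_equiv (Equiv.arrowCongr Fin.revPerm (Equiv.refl _)) _ _ fun m => ?_
  rw [mul_comm]
  congr 2 <;> (funext x; simp [Equiv.arrowCongr])

theorem star_conj (π : Equiv.Perm (Fin k ⊕ Fin l)) (D : Diagram k l) :
    (conj π D).star = conj ((halfTurn k l).permCongr π) D.star := by
  ext1
  funext x
  simp [star, conj_partner, Equiv.permCongr_def]

theorem star_cap (i j : Fin r) (hij : i ≠ j) :
    (cap i j hij).star = cap i.rev j.rev (fun h => hij (Fin.rev_injective h)) := by
  ext1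
  funext x
  obtain ⟨y, rfl⟩ := (halfTurn r r).surjective x
  rw [star_partner_halfTurn]
  rcases y with y | y <;> by_cases h1 : y = i <;> by_cases h2 : y = j <;>
    simp [halfTurn, cap, h1, h2, hij.symm]

/-- The half turn carries this to `cap_comp_aux`. -/
theorem comp_cap_aux (i j : Fin k) (hij : i ≠ j) (D : Diagram k l) :
    comp D (cap i j hij) = recouple (.inl i) (.inl j) D ∧
      loops D (cap i j hij) = if D.partner (.inl i) = .inl j then 1 else 0 := by
  have h1 := star_comp_aux D (cap i j hij)
  have h3 : ∀ i : Fin k, halfTurn k l (.inl i) = .inr i.rev := fun _ => rfl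
  have h2 := cap_comp_aux i.rev j.rev (fun h => hij (Fin.rev_injective h)) D.star
  rw [← h3, ← h3, star_partner_halfTurn] at h2
  simp only [(halfTurn k l).apply_eq_iff_eq] at h2
  rw [star_cap, h2.1, h2.2] at h1
  refine ⟨star_injective ?_, h1.2⟩
  rw [h1.1, recouple, recouple, star_partner_halfTurn, star_conj]
  congr 1
  ext x : 1
  simp [Equiv.permCongr_def, Equiv.swap_apply_def]

end Diagram
-- The sum of all diagrams and its annihilation by caps.
namespace Diagram

variable {k l p q r : ℕ}

noncomputable instance : Fintype (Diagram k l) :=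
  open scoped Classical in Fintype.ofInjective partner fun _ _ h => Diagram.ext h

/-- Renaming of the nodes as a permutation of the diagrams. -/
def conjEquiv (π : Equiv.Perm (Fin k ⊕ Fin l)) : Diagram k l ≃ Diagram k l where
  toFun := conj π
  invFun := conj π.symm
  left_inv D := by
    change conj (π⁻¹ * π) D = D
    rw [inv_mul_cancel, conj_one]
  right_inv D := by
    change conj (π * π⁻¹) D = D
    rw [mul_inv_cancel, conj_one]

/-- Recoupling the arcs at `a` and `b` so that `a` is joined to `b`: a diagram is determined by the
result and by the original partner of `a`. -/
def recoupleEquiv (a b : Fin k ⊕ Fin l) (hab : a ≠ b) :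
    Diagram k l ≃ {D : Diagram k l // D.partner a = b} × {x // x ≠ a} where
  toFun D := (⟨recouple a b D, recouple_partner D hab⟩, ⟨D.partner a, D.partner_ne a⟩)
  invFun y := recouple a y.2.1 y.1.1
  left_inv D := recouple_recouple D hab
  right_inv := by
    rintro ⟨⟨D, hD⟩, x, hx⟩
    refine Prod.ext (Subtype.ext ?_) (Subtype.ext (recouple_partner D hx.symm))
    -- Writing `b` as `D.partner a` turns the outer recoupling into the one that undoes the inner
    -- one.
    exact (congrArg (fun y => recouple a y _) hD.symm).trans (recouple_recouple D hx.symm)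

end Diagram

open Diagram

section

variable {K : Type*} [CommRing K] {δ : K} {k l p q r : ℕ}

theorem diag_mul_diag (D₁ D₂ : Diagram r r) :
    (diag δ D₁ * diag δ D₂ : BrauerAlgebra δ r) = δ ^ D₁.loops D₂ • diag δ (D₁.comp D₂) :=
  Hom.comp_diag D₁ D₂

theorem mul_eq_comp (x y : BrauerAlgebra δ r) : x * y = Hom.comp x y := rfl

theorem comp_ofPerm_left (σ : Equiv.Perm (Fin l)) (D : Diagram k l) :
    Hom.comp (diag δ (ofPerm σ)) (diag δ D) = diag δ (conj (Equiv.sumCongr 1 σ) D) := by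
  rw [Hom.comp_diag, (ofPerm_comp_aux σ D).1, (ofPerm_comp_aux σ D).2, pow_zero, one_smul]

theorem comp_ofPerm_right (σ : Equiv.Perm (Fin k)) (D : Diagram k l) :
    Hom.comp (diag δ D) (diag δ (ofPerm σ)) = diag δ (conj (Equiv.sumCongr σ⁻¹ 1) D) := by
  rw [Hom.comp_diag, (comp_ofPerm_aux σ D).1, (comp_ofPerm_aux σ D).2, pow_zero, one_smul]

/-- The lower arc of `D` closes a loop with the upper arc of the cap, and the lower arc of the cap
takes its place. For invertible `δ` this lets `D` factor through a cap. -/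
theorem comp_cap_right_of_partner_eq {i j : Fin k} (hij : i ≠ j) (D : Diagram k l)
    (hD : D.partner (.inl i) = .inl j) :
    Hom.comp (diag δ D) (diag δ (cap i j hij)) = δ • diag δ D := by
  rw [Hom.comp_diag, (comp_cap_aux i j hij D).1, (comp_cap_aux i j hij D).2, if_pos hD, pow_one,
    recouple_of_partner_eq hD]

variable (δ k l) in
/-- The sum of all diagrams. -/
noncomputable def totalSum : Hom δ k l := ∑ D, diag δ D

theorem ofPerm_comp_totalSum (σ : Equiv.Perm (Fin l)) :
    Hom.comp (diag δ (ofPerm σ)) (totalSum δ k l) = totalSum δ k l := by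
  simp only [totalSum, map_sum, comp_ofPerm_left]
  exact Fintype.sum_equiv (conjEquiv _) _ _ fun _ => rfl

/-- By `recoupleEquiv` the fibre over a result is indexed by the original partner of `i`: the
partner `j` yields a loop, the other `k + l - 2` yield none. -/
theorem cap_comp_totalSum (i j : Fin l) (hij : i ≠ j) :
    Hom.comp (diag δ (cap i j hij)) (totalSum δ k l) =
      (δ + (k + l) - 2) •
        ∑ D : {D : Diagram k l // D.partner (.inr i) = .inr j}, diag δ D.1 := by
  have hij' : (Sum.inr i : Fin k ⊕ Fin l) ≠ .inr j := fun h => hij (Sum.inr_injective h)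
  have h1 : ∑ x : {x : Fin k ⊕ Fin l // x ≠ .inr i}, δ ^ (if x.1 = .inr j then 1 else 0) =
      δ + (k + l) - 2 := by
    rw [← Finset.sum_subtype (Finset.univ.erase (Sum.inr i : Fin k ⊕ Fin l)) (by simp)
      (fun x => δ ^ (if x = .inr j then 1 else 0)),
      ← Finset.add_sum_erase _ _ (a := Sum.inr j) (by simp [hij.symm]), if_pos rfl, pow_one]
    have h2 : ∀ x ∈ (Finset.univ.erase (Sum.inr i : Fin k ⊕ Fin l)).erase (.inr j),
        δ ^ (if x = .inr j then 1 else 0) = 1 := by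
      intro x hx
      rw [if_neg (Finset.ne_of_mem_erase hx), pow_zero]
    rw [Finset.sum_congr rfl h2, Finset.sum_const, Finset.card_erase_of_mem (by simp [hij.symm]),
      Finset.card_erase_of_mem (by simp), Finset.card_univ, Fintype.card_sum, Fintype.card_fin,
      Fintype.card_fin, nsmul_one]
    have hi := i.2
    have hj := j.2
    -- Needed to cast the natural subtraction; two distinct elements of `Fin l` force `l ≥ 2`.
    have : 2 ≤ k + l := by
      have : i.1 ≠ j.1 := fun h => hij (Fin.ext h)
      omega
    rw [Nat.sub_sub, Nat.cast_sub this]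
    push_cast
    ring
  simp only [totalSum, map_sum, Hom.comp_diag, (cap_comp_aux i j hij _).1,
    (cap_comp_aux i j hij _).2]
  rw [← h1, Finset.smul_sum]
  simp only [Finset.sum_smul]
  rw [← Fintype.sum_prod_type'
    (f := fun (D : {D : Diagram k l // D.partner (.inr i) = .inr j})
      (x : {x : Fin k ⊕ Fin l // x ≠ .inr i}) =>
      δ ^ (if x.1 = .inr j then 1 else 0) • diag δ D.1)]
  exact Fintype.sum_equiv (recoupleEquiv _ _ hij') _ _ fun D => rfl

theorem star_star (x : Hom δ k l) : Hom.star (Hom.star x) = x := by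
  induction x using Hom.induction with
  | zero => simp
  | add x y hx hy => simp only [map_add, hx, hy]
  | smul c D => simp only [map_smul, Hom.star, Hom.lift_diag, Diagram.star_star]

theorem star_comp (x : Hom δ l p) (y : Hom δ k l) :
    Hom.star (Hom.comp x y) = Hom.comp (Hom.star y) (Hom.star x) := by
  induction x using Hom.induction with
  | zero => simp
  | add x x' hx hx' => simp only [map_add, LinearMap.add_apply, hx, hx']
  | smul c D₁ =>
    induction y using Hom.induction with
    | zero => simp
    | add y y' hy hy' => simp only [map_add, LinearMap.add_apply, hy, hy']
    | smul c' D₂ =>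
      obtain ⟨h1, h2⟩ := star_comp_aux D₁ D₂
      simp only [map_smul, LinearMap.smul_apply, Hom.comp_diag, Hom.star, Hom.lift_diag, h1, h2,
        smul_comm c c']

theorem star_mul (x y : BrauerAlgebra δ r) : Hom.star (x * y) = Hom.star y * Hom.star x :=
  star_comp x y

theorem star_totalSum : Hom.star (totalSum δ k l) = totalSum δ l k := by
  simp only [totalSum, map_sum, Hom.star, Hom.lift_diag]
  exact Fintype.sum_equiv ⟨Diagram.star, Diagram.star, Diagram.star_star, Diagram.star_star⟩ _ _
    fun _ => rfl

end

section

variable {K : Type*} [Field K] {n l : ℕ}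

theorem cap_mul_totalSum (i j : Fin (n + 1)) (hij : i ≠ j) :
    Hom.comp (diag (-2 * n : K) (cap i j hij)) (totalSum (-2 * n : K) (n + 1) (n + 1)) = 0 := by
  rw [cap_comp_totalSum]
  have : (-2 * n + ((n + 1 : ℕ) + (n + 1 : ℕ)) - 2 : K) = 0 := by push_cast; ring
  rw [this, zero_smul]

/-- Up to the factor `δ`, `D` is `D` composed with the cap at its own lower arc, and the cap kills
the sum. An arc needs two nodes, so `n > 0` and `δ = -2n` can be cancelled. -/
theorem comp_totalSum_eq_zero [CharZero K] {i j : Fin (n + 1)} (D : Diagram (n + 1) l)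
    (hD : D.partner (.inl i) = .inl j) :
    Hom.comp (diag (-2 * n : K) D) (totalSum (-2 * n : K) (n + 1) (n + 1)) = 0 := by
  have hij : i ≠ j := by
    rintro rfl
    exact D.partner_ne _ hD
  have hn : (n : K) ≠ 0 := by
    rintro h
    rw [Nat.cast_eq_zero] at h
    subst h
    exact hij (Fin.ext (by omega))
  have hδ : (-2 * n : K) ≠ 0 := mul_ne_zero (by norm_num) hn
  have h := congrArg (fun x => Hom.comp x (totalSum (-2 * n : K) (n + 1) (n + 1)))
    (comp_cap_right_of_partner_eq (δ := (-2 * n : K)) hij D hD)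
  simp only [Hom.comp_assoc, cap_mul_totalSum, map_zero, map_smul, LinearMap.smul_apply] at h
  exact (smul_eq_zero.1 h.symm).resolve_left hδ

end

/-! ### Arcs on one line, through strings, and the effect of recoupling on them. -/

namespace Diagram

variable {k l r : ℕ}

theorem recouple_partner_right (D : Diagram k l) {a b : Fin k ⊕ Fin l} (hab : a ≠ b) :
    (recouple a b D).partner b = a := by
  rw [partner_eq_iff, recouple_partner D hab]

theorem recouple_partner_partner (D : Diagram k l) {a b : Fin k ⊕ Fin l} (hab : a ≠ b) :
    (recouple a b D).partner (D.partner a) = D.partner b := by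
  rw [recouple, conj_partner, Equiv.symm_swap, Equiv.swap_apply_right,
    Equiv.swap_apply_of_ne_of_ne (D.partner_ne b)]
  exact fun h => hab (D.partner_injective h).symm

theorem recouple_partner_of_ne (D : Diagram k l) {a b x : Fin k ⊕ Fin l} (ha : x ≠ a) (hb : x ≠ b)
    (ha' : x ≠ D.partner a) (hb' : x ≠ D.partner b) :
    (recouple a b D).partner x = D.partner x := by
  rw [recouple, conj_partner, Equiv.symm_swap, Equiv.swap_apply_of_ne_of_ne hb ha',
    Equiv.swap_apply_of_ne_of_ne]
  · rw [Ne, partner_eq_iff]; exact hb'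
  · exact fun h => ha (D.partner_injective h)

/-- The involution of the nodes given by the arcs, as a permutation. -/
def toPerm (D : Diagram k l) : Equiv.Perm (Fin k ⊕ Fin l) :=
  ⟨D.partner, D.partner, D.partner_partner, D.partner_partner⟩

theorem conj_swap_partner (D : Diagram k l) (x) : conj (Equiv.swap x (D.partner x)) D = D := by
  apply conj_eq_self
  intro y
  by_cases h1 : y = x
  · subst h1; simp [D.partner_partner]
  · by_cases h2 : y = D.partner x
    · subst h2; simp [D.partner_partner]
    · rw [Equiv.swap_apply_of_ne_of_ne h1 h2, Equiv.swap_apply_of_ne_of_ne]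
      · rw [Ne, partner_eq_iff]; exact h2
      · exact fun h => h1 (D.partner_injective h)

/-- Exchanging two whole arcs is a symmetry of `D`: conjugation by the involution of `D`
interchanges the two transpositions, and these commute because they are disjoint. -/
theorem conj_swap_mul_swap (D : Diagram k l) {a b : Fin k ⊕ Fin l} (h : D.partner a ≠ b) :
    conj (Equiv.swap a b * Equiv.swap (D.partner a) (D.partner b)) D = D := by
  apply conj_eq_self
  by_cases hab : a = b
  · subst hab; intro x; simp
  have hcomm : Equiv.swap a b * Equiv.swap (D.partner a) (D.partner b) =
      Equiv.swap (D.partner a) (D.partner b) * Equiv.swap a b := by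
    refine (Equiv.Perm.disjoint_swap_swap ?_).commute.eq
    have hb : b ≠ D.partner a := Ne.symm h
    have ha : a ≠ D.partner b := fun h' => h (by rw [h', D.partner_partner])
    have hDab : D.partner a ≠ D.partner b := fun h => hab (D.partner_injective h)
    simp [hab, hb, ha, hDab, (D.partner_ne _).symm]
  have h1 : D.toPerm * (Equiv.swap a b * Equiv.swap (D.partner a) (D.partner b)) * D.toPerm⁻¹ =
      Equiv.swap a b * Equiv.swap (D.partner a) (D.partner b) := by
    have e1 : ∀ x, D.toPerm x = D.partner x := fun _ => rfl
    rw [hcomm, ← conj_mul, ← Equiv.swap_apply_apply, ← Equiv.swap_apply_apply]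
    simp only [e1, D.partner_partner]
    exact hcomm
  intro x
  have h2 := congrArg (fun p => p (D.partner x)) h1
  have e2 : D.toPerm⁻¹ (D.partner x) = x := D.partner_partner x
  rw [Equiv.Perm.mul_apply, e2] at h2
  exact h2

/-- The lower nodes which are joined to lower nodes. -/
def capped (D : Diagram k l) : Finset (Fin k) :=
  Finset.univ.filter fun i => (D.partner (.inl i)).isLeft

/-- The upper nodes which are joined to upper nodes. -/
def cupped (D : Diagram k l) : Finset (Fin l) :=
  Finset.univ.filter fun i => (D.partner (.inr i)).isRight

/-- The upper end of a string which starts at the lower node `i`. -/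
def upper (D : Diagram r r) (i : Fin r) : Fin r := Sum.elim (fun _ => i) id (D.partner (.inl i))

/-- The lower node joined to the lower node `i`. -/
def lower (D : Diagram k l) (i : Fin k) : Fin k := Sum.elim id (fun _ => i) (D.partner (.inl i))

theorem mem_capped {D : Diagram k l} {i : Fin k} :
    i ∈ D.capped ↔ D.partner (.inl i) = .inl (D.lower i) := by
  rcases h : D.partner (.inl i) with x | x <;> simp [capped, lower, h]

theorem mem_capped_of_eq {D : Diagram k l} {i j : Fin k} (h : D.partner (.inl i) = .inl j) :
    i ∈ D.capped := by simp [capped, h]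

theorem not_mem_capped {D : Diagram r r} {i : Fin r} :
    i ∉ D.capped ↔ D.partner (.inl i) = .inr (D.upper i) := by
  rcases h : D.partner (.inl i) with x | x <;> simp [capped, upper, h]

theorem not_mem_capped_of_eq {D : Diagram k l} {i : Fin k} {j : Fin l}
    (h : D.partner (.inl i) = .inr j) : i ∉ D.capped := by simp [capped, h]

theorem mem_cupped_of_eq {D : Diagram k l} {i j : Fin l} (h : D.partner (.inr i) = .inr j) :
    i ∈ D.cupped := by simp [cupped, h]

theorem exists_of_mem_cupped {D : Diagram k l} {i : Fin l} (h : i ∈ D.cupped) :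
    ∃ j, D.partner (.inr i) = .inr j := by
  rcases h' : D.partner (.inr i) with x | x
  · simp [cupped, h'] at h
  · exact ⟨x, rfl⟩

theorem exists_of_not_mem_cupped {D : Diagram k l} {i : Fin l} (h : i ∉ D.cupped) :
    ∃ j, D.partner (.inr i) = .inl j := by
  rcases h' : D.partner (.inr i) with x | x
  · exact ⟨x, rfl⟩
  · simp [cupped, h'] at h

/-- The through strings match the remaining nodes of the two lines, which have equal length. -/
theorem card_cupped (D : Diagram r r) : D.cupped.card = D.capped.card := by
  have h : D.cappedᶜ.card = D.cuppedᶜ.card := by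
    refine Finset.card_bij (fun i _ => D.upper i) ?_ ?_ ?_
    · intro i hi
      rw [Finset.mem_compl, not_mem_capped, partner_eq_iff] at hi
      simp [cupped, ← hi]
    · intro i hi j hj hij
      rw [Finset.mem_compl, not_mem_capped] at hi hj
      exact Sum.inl_injective (D.partner_injective (by rw [hi, hj, hij]))
    · intro j hj
      obtain ⟨i, hi⟩ := exists_of_not_mem_cupped (Finset.mem_compl.1 hj)
      rw [partner_eq_iff, eq_comm] at hi
      have hi' := not_mem_capped_of_eq hi
      refine ⟨i, Finset.mem_compl.2 hi', ?_⟩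
      rw [not_mem_capped, hi] at hi'
      exact (Sum.inr_injective hi').symm
  rw [Finset.card_compl, Finset.card_compl] at h
  have h1 := Finset.card_le_univ D.cupped
  have h2 := Finset.card_le_univ D.capped
  omega

/-- The lower arcs define a fixed-point-free involution on these nodes, so their number vanishes in
`ZMod 2`. -/
theorem even_card_capped (D : Diagram k l) : Even D.capped.card := by
  have h : ∑ i ∈ D.capped, (1 : ZMod 2) = 0 := by
    refine Finset.sum_involution (fun i _ => D.lower i) (fun _ _ => by decide) ?_ ?_ ?_
    · intro i hi _ h
      rw [mem_capped, h] at hi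
      exact D.partner_ne _ hi
    · intro i hi
      rw [mem_capped, partner_eq_iff, eq_comm] at hi
      exact mem_capped_of_eq hi
    · intro i hi
      have hi' := hi
      rw [mem_capped, partner_eq_iff, eq_comm] at hi
      have := mem_capped.1 (mem_capped_of_eq hi)
      rw [hi] at this
      exact (Sum.inl_injective this).symm
  rw [Finset.sum_const, nsmul_one, ZMod.natCast_eq_zero_iff_even] at h
  exact h

theorem capped_conj (D : Diagram r r) (τ σ : Equiv.Perm (Fin r)) :
    (conj (Equiv.sumCongr τ σ) D).capped = D.capped.map τ.toEmbedding := by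
  ext i
  obtain ⟨j, rfl⟩ := τ.surjective i
  have h : (conj (Equiv.sumCongr τ σ) D).partner (.inl (τ j)) =
    Equiv.sumCongr τ σ (D.partner (.inl j)) := conj_partner_apply (Equiv.sumCongr τ σ) D (.inl j)
  rcases hD : D.partner (.inl j) with x | x <;> simp [capped, h, hD]

theorem capped_recouple_lower (D : Diagram r r) {p q : Fin r} (hpq : p ≠ q) (hp : p ∉ D.capped)
    (hq : q ∉ D.capped) :
    (recouple (.inl p) (.inl q) D).capped = insert p (insert q D.capped) := by
  have hpq' : (Sum.inl p : Fin r ⊕ Fin r) ≠ .inl q := fun h => hpq (Sum.inl_injective h)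
  rw [not_mem_capped] at hp hq
  ext x
  rw [Finset.mem_insert, Finset.mem_insert]
  by_cases h1 : x = p
  · subst h1
    simpa using mem_capped_of_eq (recouple_partner D hpq')
  by_cases h2 : x = q
  · subst h2
    simpa using mem_capped_of_eq (recouple_partner_right D hpq')
  have h : (recouple (.inl p) (.inl q) D).partner (.inl x) = D.partner (.inl x) :=
    recouple_partner_of_ne D (by simpa using h1) (by simpa using h2) (by simp [hp]) (by simp [hq])
  simp [capped, h, h1, h2]

theorem capped_recouple_upper (D : Diagram r r) {i i' j : Fin r} (hi : D.partner (.inl i) = .inl j)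
    (hi' : i' ∈ D.cupped) :
    (recouple (.inl i) (.inr i') D).capped = (D.capped.erase i).erase j := by
  obtain ⟨j', hj'⟩ := exists_of_mem_cupped hi'
  have hne : (Sum.inl i : Fin r ⊕ Fin r) ≠ .inr i' := by simp
  have hij : j ≠ i := by
    rintro rfl
    exact D.partner_ne _ hi
  ext x
  rw [Finset.mem_erase, Finset.mem_erase]
  by_cases h1 : x = i
  · subst h1
    simpa using not_mem_capped_of_eq (recouple_partner D hne)
  by_cases h2 : x = j
  · subst h2
    have h := recouple_partner_partner D hne
    rw [hi, hj'] at h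
    simpa using not_mem_capped_of_eq h
  have h : (recouple (.inl i) (.inr i') D).partner (.inl x) = D.partner (.inl x) :=
    recouple_partner_of_ne D (by simpa using h1) (by simp) (by simpa [hi] using h2) (by simp [hj'])
  simp [capped, h, h1, h2]

theorem exists_ofPerm (D : Diagram r r) (hD : D.capped = ∅) : ∃ σ, D = ofPerm σ := by
  have h : ∀ i, D.partner (.inl i) = .inr (D.upper i) := fun i => by
    rw [← not_mem_capped, hD]; simp
  have hinj : Function.Injective D.upper := fun i j hij =>
    Sum.inl_injective (D.partner_injective (by rw [h, h, hij]))
  let σ := Equiv.ofBijective D.upper (Finite.injective_iff_bijective.1 hinj)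
  refine ⟨σ, ?_⟩
  ext1
  funext x
  rcases x with x | x
  · exact h x
  · obtain ⟨y, rfl⟩ := σ.surjective x
    rw [partner_eq_iff]
    simp only [ofPerm, Sum.elim_inr, Equiv.symm_apply_apply]
    exact (h y).symm

theorem capped_ofPerm (σ : Equiv.Perm (Fin r)) : (ofPerm σ).capped = ∅ := by
  ext; simp [capped, ofPerm]

theorem ofPerm_injective : Function.Injective (ofPerm : Equiv.Perm (Fin r) → Diagram r r) := by
  intro σ τ h
  ext i
  have := congrArg (fun D => D.partner (.inl i)) h
  simpa [ofPerm, Fin.ext_iff] using this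

theorem conj_ofPerm (σ τ ρ : Equiv.Perm (Fin r)) :
    conj (Equiv.sumCongr τ σ) (ofPerm ρ) = ofPerm (σ * ρ * τ⁻¹) := by
  ext1
  funext x
  rcases x with x | x
  · simp [conj_partner, ofPerm, Equiv.Perm.mul_def]
  · simp [conj_partner, ofPerm, Equiv.Perm.mul_def]
    rfl

end Diagram

open Diagram

/-! ### Orbit sums, and the identification of `Phi` with the sum of all diagrams. -/

section

variable {K : Type*} [CommRing K] {δ : K} {k r : ℕ}

variable (δ) in
/-- The sum of the diagrams obtained from `D` by permuting the lower and the upper nodes. -/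
noncomputable def orbitSum (D : Diagram r r) : Hom δ r r :=
  ∑ τ : Equiv.Perm (Fin r), ∑ σ : Equiv.Perm (Fin r), diag δ (conj (Equiv.sumCongr τ σ) D)

variable (δ r) in
/-- The sum of the diagrams with `k` arcs on the lower line. -/
noncomputable def levelSum (k : ℕ) : Hom δ r r :=
  ∑ D : Diagram r r with D.capped.card = 2 * k, diag δ D

theorem sumCongr_mul (τ σ τ' σ' : Equiv.Perm (Fin r)) :
    (Equiv.sumCongr τ σ * Equiv.sumCongr τ' σ' : Equiv.Perm (Fin r ⊕ Fin r)) =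
      Equiv.sumCongr (τ * τ') (σ * σ') := by
  ext x : 1
  rcases x with x | x <;> rfl

theorem symmetrizer_mul_diag_mul (D : Diagram r r) :
    symmetrizer δ r * diag δ D * symmetrizer δ r = orbitSum δ D := by
  simp only [symmetrizer, mul_eq_comp, map_sum, LinearMap.sum_apply, comp_ofPerm_left,
    comp_ofPerm_right, orbitSum, conj_conj, sumCongr_mul]
  refine Fintype.sum_equiv (Equiv.inv _) _ _ fun τ => Finset.sum_congr rfl fun σ _ => ?_
  simp

theorem orbitSum_conj (D : Diagram r r) (τ σ : Equiv.Perm (Fin r)) :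
    orbitSum δ (conj (Equiv.sumCongr τ σ) D) = orbitSum δ D := by
  simp only [orbitSum, conj_conj, sumCongr_mul]
  refine Fintype.sum_equiv (Equiv.mulRight τ) _ _ fun τ' => ?_
  exact Fintype.sum_equiv (Equiv.mulRight σ) _ _ fun σ' => rfl

/-- Exchanging the through strings at `a` and `b`, at both of their ends, fixes `D`; it therefore
moves the recoupled pair without leaving the orbit. -/
theorem orbitSum_recouple_swap (D : Diagram r r) {a b : Fin r} (ha : a ∉ D.capped)
    (hb : b ∉ D.capped) (p q : Fin r) :
    orbitSum δ (recouple (.inl (Equiv.swap a b p)) (.inl (Equiv.swap a b q)) D) =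
      orbitSum δ (recouple (.inl p) (.inl q) D) := by
  rw [not_mem_capped] at ha hb
  have h := conj_swap_mul_swap D (a := .inl a) (b := .inl b) (by simp [ha])
  have h' : Equiv.swap (Sum.inl a) (Sum.inl b) *
      Equiv.swap (D.partner (Sum.inl a)) (D.partner (Sum.inl b)) =
      Equiv.sumCongr (Equiv.swap a b) (Equiv.swap (D.upper a) (D.upper b)) := by
    rw [ha, hb, ← Equiv.Perm.sumCongr_swap_one, ← Equiv.Perm.sumCongr_one_swap]
    exact (sumCongr_mul _ _ _ _).trans (by simp)
  rw [h'] at h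
  rw [← orbitSum_conj (recouple (.inl p) (.inl q) D) (Equiv.swap a b)
    (Equiv.swap (D.upper a) (D.upper b)), conj_recouple, h]
  rfl

theorem orbitSum_recouple_eq (D : Diagram r r) {p q p' q' : Fin r} (hp : p ∉ D.capped)
    (hq : q ∉ D.capped) (hp' : p' ∉ D.capped) (hq' : q' ∉ D.capped) (hpq : p ≠ q) (hpq' : p' ≠ q') :
    orbitSum δ (recouple (.inl p) (.inl q) D) = orbitSum δ (recouple (.inl p') (.inl q') D) := by
  rw [← orbitSum_recouple_swap D hp hp' p q, Equiv.swap_apply_left]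
  -- The first exchange has moved `p` to `p'` and `q` to `q₁`. As `q₁ ≠ p'`, a second exchange takes
  -- `q₁` to `q'` and leaves `p'` in place.
  set q₁ := Equiv.swap p p' q with hq₁
  have hq₁p : p' ≠ q₁ := by
    intro h
    rw [hq₁, ← Equiv.swap_apply_eq_iff, Equiv.swap_apply_right] at h
    exact hpq h
  have hq₁c : q₁ ∉ D.capped := by
    rw [hq₁, Equiv.swap_apply_def]
    split_ifs <;> assumption
  rw [← orbitSum_recouple_swap D hq₁c hq' p' q₁, Equiv.swap_apply_left,
    Equiv.swap_apply_of_ne_of_ne hq₁p hpq']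

variable (δ r) in
/-- The sum of all recouplings of two through strings. -/
noncomputable def recoupleSum : Hom δ r r →ₗ[K] Hom δ r r :=
  Hom.lift fun D => ∑ x ∈ D.cappedᶜ.offDiag, diag δ (recouple (.inl x.1) (.inl x.2) D)

theorem recoupleSum_orbitSum (D : Diagram r r) :
    recoupleSum δ r (orbitSum δ D) =
      ∑ x ∈ D.cappedᶜ.offDiag, orbitSum δ (recouple (.inl x.1) (.inl x.2) D) := by
  simp only [orbitSum, map_sum, recoupleSum, Hom.lift_diag]
  rw [Finset.sum_comm' (t' := Finset.univ) (s' := fun _ => D.cappedᶜ.offDiag) (by simp)]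
  refine Finset.sum_congr rfl fun τ _ => ?_
  rw [Finset.sum_comm' (t' := Finset.univ) (s' := fun _ => D.cappedᶜ.offDiag) (by simp)]
  refine Finset.sum_congr rfl fun σ _ => ?_
  refine (Finset.sum_bij (fun x _ => (τ x.1, τ x.2)) ?_ ?_ ?_ ?_).symm
  · rintro ⟨p, q⟩ h
    simpa [capped_conj] using h
  · rintro ⟨p, q⟩ _ ⟨p', q'⟩ _ h
    simpa using h
  · rintro ⟨p, q⟩ h
    refine ⟨(τ.symm p, τ.symm q), ?_, by simp⟩
    simpa [capped_conj, ← Equiv.symm_apply_eq] using h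
  · rintro ⟨p, q⟩ _
    rw [conj_recouple]
    rfl

/-- Double counting: a recoupling can be undone once a capped lower node and a cupped upper node of
the result are chosen, and there are `2 * (k + 1)` nodes of each kind. -/
theorem recoupleSum_levelSum (k : ℕ) :
    recoupleSum δ r (levelSum δ r k) = ((2 * (k + 1)) ^ 2 : ℕ) • levelSum δ r (k + 1) := by
  have hR : ((2 * (k + 1)) ^ 2 : ℕ) • levelSum δ r (k + 1) =
      ∑ D : Diagram r r with D.capped.card = 2 * (k + 1),
        ∑ x ∈ D.capped ×ˢ D.cupped, diag δ D := by
    rw [levelSum, Finset.smul_sum]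
    refine Finset.sum_congr rfl fun D hD => ?_
    rw [Finset.sum_const, Finset.card_product, card_cupped, (Finset.mem_filter.1 hD).2, sq]
  rw [hR]
  simp only [levelSum, map_sum, recoupleSum, Hom.lift_diag]
  rw [Finset.sum_sigma', Finset.sum_sigma']
  -- The joined through strings start at `p` and `q`. The result remembers `p` and the former upper
  -- end of the string at `p`; joining these two again restores both strings, and `q` is the node to
  -- which `p` is joined in the result.
  refine Finset.sum_bij'
    (fun y _ => ⟨recouple (.inl y.2.1) (.inl y.2.2) y.1, (y.2.1, y.1.upper y.2.1)⟩)
    (fun y _ => ⟨recouple (.inl y.2.1) (.inr y.2.2) y.1, (y.2.1, y.1.lower y.2.1)⟩) ?_ ?_ ?_ ?_ ?_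
  · rintro ⟨D, p, q⟩ h
    simp only [Finset.mem_sigma, Finset.mem_filter_univ, Finset.mem_offDiag, Finset.mem_compl,
      Finset.mem_product] at h ⊢
    obtain ⟨hD, hp, hq, hpq⟩ := h
    refine ⟨?_, ?_, ?_⟩
    · rw [capped_recouple_lower D hpq hp hq, Finset.card_insert_of_notMem (by simp [hpq, hp]),
        Finset.card_insert_of_notMem hq, hD]
      ring
    · rw [capped_recouple_lower D hpq hp hq]
      simp
    · have h := recouple_partner_partner D (a := .inl p) (b := .inl q) (by simpa using hpq)
      rw [not_mem_capped.1 hp, not_mem_capped.1 hq] at h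
      exact mem_cupped_of_eq h
  · rintro ⟨D, i, i'⟩ h
    simp only [Finset.mem_sigma, Finset.mem_filter_univ, Finset.mem_offDiag, Finset.mem_compl,
      Finset.mem_product] at h ⊢
    obtain ⟨hD, hi, hi'⟩ := h
    have hi₁ := mem_capped.1 hi
    have hj : D.lower i ∈ D.capped := by
      rw [partner_eq_iff] at hi₁
      exact mem_capped_of_eq hi₁.symm
    have hij : i ≠ D.lower i := by
      intro h
      rw [← h] at hi₁
      exact D.partner_ne _ hi₁
    rw [capped_recouple_upper D hi₁ hi']
    refine ⟨?_, by simp, by simp, hij⟩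
    rw [Finset.card_erase_of_mem (by simp [hj, hij.symm]), Finset.card_erase_of_mem hi, hD]
    omega
  · rintro ⟨D, p, q⟩ h
    simp only [Finset.mem_sigma, Finset.mem_filter_univ, Finset.mem_offDiag, Finset.mem_compl] at h
    obtain ⟨hD, hp, hq, hpq⟩ := h
    have hpq' : (Sum.inl p : Fin r ⊕ Fin r) ≠ .inl q := by simpa using hpq
    have h1 : recouple (.inl p) (.inr (D.upper p)) (recouple (.inl p) (.inl q) D) = D := by
      rw [← not_mem_capped.1 hp]
      exact recouple_recouple D hpq'
    have h2 : (recouple (.inl p) (.inl q) D).lower p = q := by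
      simp [lower, recouple_partner D hpq']
    simp only [h1, h2]
  · rintro ⟨D, i, i'⟩ h
    simp only [Finset.mem_sigma, Finset.mem_filter_univ, Finset.mem_product] at h
    obtain ⟨hD, hi, hi'⟩ := h
    have hne : (Sum.inl i : Fin r ⊕ Fin r) ≠ .inr i' := by simp
    have h1 : recouple (.inl i) (.inl (D.lower i)) (recouple (.inl i) (.inr i') D) = D := by
      rw [← mem_capped.1 hi]
      exact recouple_recouple D hne
    have h2 : (recouple (.inl i) (.inr i') D).upper i = i' := by
      simp [upper, recouple_partner D hne]
    simp only [h1, h2]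
  · intro _ _
    rfl

end

section

variable {K : Type*} [Field K] {δ : K} {k r : ℕ}

/-- The coefficient is the order of the stabiliser of `D`: arcs may be permuted and flipped on each
line, through strings permuted. The induction compares the recoupling operator on both sides of the
identity for `k`: on the left all recouplings have the same orbit sum, on the right the level sums
are double counted. -/
theorem orbitSum_eq [CharZero K] (k : ℕ) (D : Diagram r r) (hD : D.capped.card = 2 * k) :
    orbitSum δ D = ((2 ^ k * k.factorial) ^ 2 * (r - 2 * k).factorial : ℕ) • levelSum δ r k := by
  induction k generalizing D with
  | zero =>
    obtain ⟨ρ, rfl⟩ := exists_ofPerm D (Finset.card_eq_zero.1 hD)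
    have h1 : levelSum δ r 0 = ∑ σ : Equiv.Perm (Fin r), diag δ (ofPerm σ) := by
      rw [levelSum]
      symm
      refine Finset.sum_bij (fun σ _ => ofPerm σ) ?_ (fun _ _ _ _ h => ofPerm_injective h) ?_ ?_
      · intro σ _
        simp [capped_ofPerm]
      · intro D hD
        simp only [Finset.mem_filter_univ, mul_zero, Finset.card_eq_zero] at hD
        obtain ⟨σ, rfl⟩ := exists_ofPerm D hD
        exact ⟨σ, Finset.mem_univ _, rfl⟩
      · intro _ _
        rfl
    have h2 : ∀ τ : Equiv.Perm (Fin r), ∑ σ : Equiv.Perm (Fin r),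
        diag δ (conj (Equiv.sumCongr τ σ) (ofPerm ρ)) = levelSum δ r 0 := by
      intro τ
      simp only [h1, conj_ofPerm]
      exact Fintype.sum_equiv (Equiv.mulRight (ρ * τ⁻¹)) _ _ fun σ => by simp [mul_assoc]
    rw [orbitSum, Finset.sum_congr rfl fun τ _ => h2 τ, Finset.sum_const, Finset.card_univ,
      Fintype.card_perm, Fintype.card_fin]
    simp
  | succ k ih =>
    obtain ⟨i, hi⟩ := Finset.card_pos.1 (by omega : 0 < D.capped.card)
    obtain ⟨i', hi'⟩ := Finset.card_pos.1 (by rw [card_cupped]; omega : 0 < D.cupped.card)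
    have hi₁ := mem_capped.1 hi
    set j := D.lower i
    have hj : j ∈ D.capped := by
      rw [partner_eq_iff] at hi₁
      exact mem_capped_of_eq hi₁.symm
    have hij : i ≠ j := by
      intro h
      rw [← h] at hi₁
      exact D.partner_ne _ hi₁
    -- Turning one lower and one upper arc of `D` into two through strings gives a diagram of level
    -- `k` that has `D` among its recouplings.
    set D₀ := recouple (.inl i) (.inr i') D with hD₀
    have hc := capped_recouple_upper D hi₁ hi'
    rw [← hD₀] at hc
    have hcard : D₀.capped.card = 2 * k := by
      rw [hc, Finset.card_erase_of_mem (by simp [hj, hij.symm]), Finset.card_erase_of_mem hi, hD]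
      omega
    have hD₁ : recouple (.inl i) (.inl j) D₀ = D := by
      rw [← hi₁]
      exact recouple_recouple D (by simp)
    have hi₀ : i ∉ D₀.capped := by simp [hc]
    have hj₀ : j ∉ D₀.capped := by simp [hc]
    have h := congrArg (recoupleSum δ r) (ih D₀ hcard)
    rw [recoupleSum_orbitSum, map_nsmul, recoupleSum_levelSum] at h
    have hsum : ∀ x ∈ D₀.cappedᶜ.offDiag,
        orbitSum δ (recouple (.inl x.1) (.inl x.2) D₀) = orbitSum δ D := by
      rintro ⟨p, q⟩ hx
      simp only [Finset.mem_offDiag, Finset.mem_compl] at hx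
      rw [orbitSum_recouple_eq D₀ hx.1 hx.2.1 hi₀ hj₀ hx.2.2 hij, hD₁]
    rw [Finset.sum_congr rfl hsum, Finset.sum_const, Finset.offDiag_card, Finset.card_compl,
      Fintype.card_fin, hcard, smul_smul] at h
    have hle : 2 * (k + 1) ≤ r := by
      rw [← hD]
      simpa using Finset.card_le_univ D.capped
    obtain ⟨m, rfl⟩ := Nat.exists_eq_add_of_le hle
    have e1 : 2 * (k + 1) + m - 2 * k = m + 2 := by omega
    have e2 : 2 * (k + 1) + m - 2 * (k + 1) = m := by omega
    have e3 : (m + 2) * (m + 2) - (m + 2) = (m + 2) * (m + 1) := by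
      rw [Nat.sub_eq_iff_eq_add (by nlinarith)]
      ring
    rw [e1, e3] at h
    rw [e2]
    -- The number of ordered pairs of distinct through strings of `D₀`, where `m = r - 2 * (k + 1)`;
    -- characteristic zero allows division by it.
    have h0 : (((m + 2) * (m + 1) : ℕ) : K) ≠ 0 := by
      rw [Nat.cast_ne_zero]
      positivity
    rw [← Nat.cast_smul_eq_nsmul K, ← Nat.cast_smul_eq_nsmul K] at h
    rw [← Nat.cast_smul_eq_nsmul K]
    apply smul_right_injective _ h0
    simp only
    rw [h, smul_smul, ← Nat.cast_mul]
    congr 2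
    rw [Nat.factorial_succ, Nat.factorial_succ k, Nat.factorial_succ m]
    ring

/-- The generators are placed from the right and use disjoint pairs of positions, so no loops occur.
The last clause keeps the strings further left through, as the induction needs for the next
generator. -/
theorem exists_E_eq_diag (n k : ℕ) (hk : 2 * k ≤ n + 1) :
    ∃ D : Diagram (n + 1) (n + 1), E δ n k hk = diag δ D ∧ D.capped.card = 2 * k ∧
      ∀ i : Fin (n + 1), i.1 + 2 * k < n + 1 → i ∉ D.capped := by
  induction k with
  | zero => exact ⟨ofPerm 1, rfl, by simp [capped_ofPerm], by simp [capped_ofPerm]⟩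
  | succ k ih =>
    obtain ⟨D, hE, hcard, hthrough⟩ := ih (by omega)
    set i : Fin n := ⟨n - 1 - 2 * k, by omega⟩ with hi
    have hne : i.castSucc ≠ i.succ := i.castSucc_lt_succ.ne
    have h1 : i.castSucc ∉ D.capped := hthrough _ (by simp [hi]; omega)
    have h2 : i.succ ∉ D.capped := hthrough _ (by simp [hi]; omega)
    have hc := capped_recouple_lower D hne h1 h2
    refine ⟨recouple (.inl i.castSucc) (.inl i.succ) D, ?_, ?_, ?_⟩
    · have h : E δ n (k + 1) hk = E δ n k (by omega) * e δ i := by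
        rw [E, E, List.ofFn_succ', List.concat_eq_append, List.prod_append, List.prod_singleton]
        rfl
      rw [h, hE, e, eDiagram_eq_cap, diag_mul_diag, (comp_cap_aux _ _ hne D).1,
        (comp_cap_aux _ _ hne D).2, if_neg, pow_zero, one_smul]
      rw [not_mem_capped.1 h1]
      simp
    · rw [hc, Finset.card_insert_of_notMem (by simp [hne, h1]), Finset.card_insert_of_notMem h2,
        hcard]
      ring
    · intro x hx
      rw [hc]
      simp only [Finset.mem_insert, not_or]
      refine ⟨?_, ?_, hthrough x (by omega)⟩
      · rintro rfl
        simp [hi] at hx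
        omega
      · rintro rfl
        simp [hi] at hx
        omega

/-- Each normalised `Xi` is a level sum, and since the number of capped nodes is even and at most `n
+ 1`, the levels partition the diagrams. -/
theorem Phi_eq_totalSum [CharZero K] (n : ℕ) : Phi K n = totalSum (-2 * n : K) (n + 1) (n + 1) := by
  have h1 : ∀ k : Fin ((n + 1) / 2 + 1),
      (((2 ^ (k : ℕ) * (k : ℕ).factorial) ^ 2 * (n + 1 - 2 * (k : ℕ)).factorial : ℕ) : K)⁻¹ •
        Xi (-2 * n : K) n k (by omega) = levelSum (-2 * n : K) (n + 1) k := by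
    intro k
    obtain ⟨D, hE, hcard, -⟩ := exists_E_eq_diag (δ := (-2 * n : K)) n k (by omega)
    rw [Xi, hE, symmetrizer_mul_diag_mul, orbitSum_eq k D hcard, ← Nat.cast_smul_eq_nsmul K,
      smul_smul, inv_mul_cancel₀, one_smul]
    rw [Nat.cast_ne_zero]
    positivity
  rw [Phi, Finset.sum_congr rfl fun k _ => h1 k]
  simp only [levelSum, totalSum]
  rw [← Finset.sum_fiberwise_of_maps_to (s := Finset.univ) (t := Finset.range ((n + 1) / 2 + 1))
    (g := fun D : Diagram (n + 1) (n + 1) => D.capped.card / 2), Finset.sum_range]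
  · refine Finset.sum_congr rfl fun k _ => Finset.sum_congr ?_ fun _ _ => rfl
    ext D
    obtain ⟨m, hm⟩ := even_card_capped D
    simp only [Finset.mem_filter_univ]
    omega
  · intro D _
    have := Finset.card_le_univ D.capped
    rw [Fintype.card_fin] at this
    rw [Finset.mem_range]
    omega

end

/-! ### Crossing numbers under exchange of neighbouring boundary nodes. -/

namespace Diagram

variable {k l r m : ℕ}

/-- The position of a node on the boundary: the lower line from left to right, then the upper line
from right to left. -/
def pos : Fin k ⊕ Fin l → ℕ := Sum.elim (fun i => i) (fun j => k + (l - 1 - j))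

theorem pos_injective : Function.Injective (pos : Fin k ⊕ Fin l → ℕ) := by
  rintro (x | x) (y | y) h <;> simp only [pos, Sum.elim_inl, Sum.elim_inr] at h <;>
    first
    | (congr 1; ext; omega)
    | omega

/-- The set of the pairs of crossing arcs, each given by its first two ends. -/
def crossingSet (D : Diagram k l) : Finset ((Fin k ⊕ Fin l) × (Fin k ⊕ Fin l)) :=
  Finset.univ.filter fun x =>
    pos x.1 < pos x.2 ∧ pos x.2 < pos (D.partner x.1) ∧ pos (D.partner x.1) < pos (D.partner x.2)

theorem crossings_eq (D : Diagram k l) : D.crossings = D.crossingSet.card := rfl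

theorem pos_swap (x y z : Fin k ⊕ Fin l) :
    pos (Equiv.swap x y z) =
      if pos z = pos x then pos y else if pos z = pos y then pos x else pos z := by
  simp only [pos_injective.eq_iff, Equiv.swap_apply_def]
  split_ifs <;> rfl

/-- The arithmetic of undoing one crossing. `X`, `Y` are neighbouring positions with partners `p`,
`q`, and `h` lists the three orders in which their arcs cross, with `A₀`, `B₀` the first ends of
these arcs. The transposition `t` keeps every order relation except that between `X` and `Y`, so
only this crossing disappears. -/
theorem crossing_swap_iff {X Y p q A A' B B' A₀ B₀ : ℕ} (hY : Y = X + 1)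
    (hp : p ≠ X ∧ p ≠ Y) (hq : q ≠ X ∧ q ≠ Y)
    (h : (p < q ∧ Y < p ∧ A₀ = X ∧ B₀ = Y) ∨ (p < q ∧ q < X ∧ A₀ = p ∧ B₀ = q) ∨
      (q < X ∧ Y < p ∧ A₀ = q ∧ B₀ = X))
    (hA : (A = X ∧ A' = p) ∨ (A = Y ∧ A' = q) ∨ (A = p ∧ A' = X) ∨ (A = q ∧ A' = Y) ∨
      (A ≠ X ∧ A ≠ Y ∧ A' ≠ X ∧ A' ≠ Y ∧ A ≠ p ∧ A ≠ q))
    (hB : (B = X ∧ B' = p) ∨ (B = Y ∧ B' = q) ∨ (B = p ∧ B' = X) ∨ (B = q ∧ B' = Y) ∨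
      (B ≠ X ∧ B ≠ Y ∧ B' ≠ X ∧ B' ≠ Y ∧ B ≠ p ∧ B ≠ q)) (t : ℕ → ℕ) (htX : t X = Y)
    (htY : t Y = X) (ht : ∀ z, z ≠ X → z ≠ Y → t z = z) :
    (t A < t B ∧ t B < t A' ∧ t A' < t B') ↔
      (A < B ∧ B < A' ∧ A' < B') ∧ ¬ (A = A₀ ∧ B = B₀) := by
  have htp := ht p hp.1 hp.2
  have htq := ht q hq.1 hq.2
  rcases hA with ⟨rfl, rfl⟩ | ⟨rfl, rfl⟩ | ⟨rfl, rfl⟩ | ⟨rfl, rfl⟩ | hA <;>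
  rcases hB with ⟨h1, h2⟩ | ⟨h1, h2⟩ | ⟨h1, h2⟩ | ⟨h1, h2⟩ | hB <;>
  first
  | (have eA := ht A hA.1 hA.2.1
     have eA' := ht A' hA.2.2.1 hA.2.2.2.1
     have eB := ht B hB.1 hB.2.1
     have eB' := ht B' hB.2.2.1 hB.2.2.2.1
     omega)
  | (have eA := ht A hA.1 hA.2.1
     have eA' := ht A' hA.2.2.1 hA.2.2.2.1
     rw [h1, h2]
     omega)
  | (have eB := ht B hB.1 hB.2.1
     have eB' := ht B' hB.2.2.1 hB.2.2.2.1
     omega)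
  | (rw [h1, h2]
     omega)

theorem crossings_conj_swap_aux (D : Diagram k l) {x y a₀ b₀ : Fin k ⊕ Fin l}
    (hxy : pos y = pos x + 1) (hD : D.partner x ≠ y)
    (h : (pos (D.partner x) < pos (D.partner y) ∧ pos y < pos (D.partner x) ∧ a₀ = x ∧ b₀ = y) ∨
      (pos (D.partner x) < pos (D.partner y) ∧ pos (D.partner y) < pos x ∧ a₀ = D.partner x ∧
        b₀ = D.partner y) ∨
      (pos (D.partner y) < pos x ∧ pos y < pos (D.partner x) ∧ a₀ = D.partner y ∧ b₀ = x)) :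
    D.crossings = (conj (Equiv.swap x y) D).crossings + 1 := by
  have hD' : D.partner y ≠ x := by rw [Ne, partner_eq_iff]; exact fun h => hD h.symm
  have hA : ∀ a, (pos a = pos x ∧ pos (D.partner a) = pos (D.partner x)) ∨
      (pos a = pos y ∧ pos (D.partner a) = pos (D.partner y)) ∨
      (pos a = pos (D.partner x) ∧ pos (D.partner a) = pos x) ∨
      (pos a = pos (D.partner y) ∧ pos (D.partner a) = pos y) ∨
      (pos a ≠ pos x ∧ pos a ≠ pos y ∧ pos (D.partner a) ≠ pos x ∧ pos (D.partner a) ≠ pos y ∧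
        pos a ≠ pos (D.partner x) ∧ pos a ≠ pos (D.partner y)) := by
    intro a
    simp only [pos_injective.eq_iff, ne_eq, D.partner_injective.eq_iff, D.partner_eq_iff]
    tauto
  have key : ∀ a b, (pos (Equiv.swap x y a) < pos (Equiv.swap x y b) ∧
      pos (Equiv.swap x y b) < pos (Equiv.swap x y (D.partner a)) ∧
      pos (Equiv.swap x y (D.partner a)) < pos (Equiv.swap x y (D.partner b))) ↔
      (pos a < pos b ∧ pos b < pos (D.partner a) ∧ pos (D.partner a) < pos (D.partner b)) ∧
        ¬ (a = a₀ ∧ b = b₀) := by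
    intro a b
    simp only [pos_swap, ← pos_injective.eq_iff (a := a), ← pos_injective.eq_iff (a := b)]
    refine crossing_swap_iff (t := fun z => if z = pos x then pos y else
      if z = pos y then pos x else z) hxy
      ⟨fun h => D.partner_ne _ (pos_injective h), fun h => hD (pos_injective h)⟩
      ⟨fun h => hD' (pos_injective h), fun h => D.partner_ne _ (pos_injective h)⟩ ?_ (hA a) (hA b)
      ?_ ?_ ?_
    · rcases h with ⟨h1, h2, rfl, rfl⟩ | ⟨h1, h2, rfl, rfl⟩ | ⟨h1, h2, rfl, rfl⟩
      · exact Or.inl ⟨h1, h2, rfl, rfl⟩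
      · exact Or.inr (Or.inl ⟨h1, h2, rfl, rfl⟩)
      · exact Or.inr (Or.inr ⟨h1, h2, rfl, rfl⟩)
    · simp
    · simp [hxy]
    · intro z h1 h2
      simp [h1, h2]
  have hmem : (a₀, b₀) ∈ D.crossingSet := by
    rw [crossingSet, Finset.mem_filter_univ]
    rcases h with ⟨h1, h2, rfl, rfl⟩ | ⟨h1, h2, rfl, rfl⟩ | ⟨h1, h2, rfl, rfl⟩ <;>
      simp only [D.partner_partner] <;> omega
  rw [crossings_eq, crossings_eq, ← Finset.card_erase_add_one hmem]
  congr 1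
  refine Finset.card_bij' (fun z _ => (Equiv.swap x y z.1, Equiv.swap x y z.2))
    (fun z _ => (Equiv.swap x y z.1, Equiv.swap x y z.2)) ?_ ?_ ?_ ?_
  · rintro ⟨a, b⟩ hz
    rw [Finset.mem_erase, crossingSet, Finset.mem_filter_univ, Ne, Prod.mk.injEq, and_comm,
      ← key a b] at hz
    rw [crossingSet, Finset.mem_filter_univ]
    simpa only [conj_partner_apply] using hz
  · rintro ⟨a, b⟩ hz
    obtain ⟨a, rfl⟩ := (Equiv.swap x y).surjective a
    obtain ⟨b, rfl⟩ := (Equiv.swap x y).surjective b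
    rw [crossingSet, Finset.mem_filter_univ] at hz
    simp only [conj_partner_apply] at hz
    rw [key a b] at hz
    rw [Finset.mem_erase, crossingSet, Finset.mem_filter_univ, Ne, Prod.mk.injEq, and_comm]
    simpa using hz
  · simp
  · simp

/-- The two arcs at `x` and `y` cross either before or after the exchange. In the second case
`crossings_conj_swap_aux` is applied to the exchanged diagram, whose exchange is `D` again. -/
theorem crossings_conj_swap (D : Diagram k l) {x y : Fin k ⊕ Fin l}
    (hxy : pos y = pos x + 1) (hD : D.partner x ≠ y) :
    D.crossings = (conj (Equiv.swap x y) D).crossings + 1 ∨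
      (conj (Equiv.swap x y) D).crossings = D.crossings + 1 := by
  have hD' : D.partner y ≠ x := by rw [Ne, partner_eq_iff]; exact fun h => hD h.symm
  have hx := D.partner_ne x
  have hy := D.partner_ne y
  set D' := conj (Equiv.swap x y) D with hD''
  have hDD' : D = conj (Equiv.swap x y) D' := by
    rw [hD'', conj_conj, Equiv.swap_mul_self, conj_one]
  have h1 : D'.partner x = D.partner y := by
    rw [hD'', conj_partner, Equiv.symm_swap, Equiv.swap_apply_left,
      Equiv.swap_apply_of_ne_of_ne hD' hy]
  have h2 : D'.partner y = D.partner x := by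
    rw [hD'', conj_partner, Equiv.symm_swap, Equiv.swap_apply_right,
      Equiv.swap_apply_of_ne_of_ne hx hD]
  have h3 : D'.partner x ≠ y := by rw [h1]; exact hy
  have hne : D.partner x ≠ D.partner y := by
    intro h
    rw [D.partner_injective h] at hxy
    omega
  rw [← pos_injective.ne_iff] at hD hD' hx hy hne
  by_cases hlt : pos (D.partner x) < pos (D.partner y)
  · by_cases hb : pos y < pos (D.partner x)
    · exact Or.inl (crossings_conj_swap_aux D hxy (pos_injective.ne_iff.1 hD)
        (Or.inl ⟨hlt, hb, rfl, rfl⟩))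
    by_cases hb' : pos (D.partner y) < pos x
    · exact Or.inl (crossings_conj_swap_aux D hxy (pos_injective.ne_iff.1 hD)
        (Or.inr (Or.inl ⟨hlt, hb', rfl, rfl⟩)))
    right
    rw [hDD']
    exact crossings_conj_swap_aux D' hxy h3
      (Or.inr (Or.inr ⟨by rw [h2]; omega, by rw [h1]; omega, rfl, rfl⟩))
  · by_cases hb : pos (D.partner y) < pos x ∧ pos y < pos (D.partner x)
    · exact Or.inl (crossings_conj_swap_aux D hxy (pos_injective.ne_iff.1 hD)
        (Or.inr (Or.inr ⟨hb.1, hb.2, rfl, rfl⟩)))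
    right
    rw [hDD']
    by_cases hb' : pos y < pos (D.partner y)
    · exact crossings_conj_swap_aux D' hxy h3
        (Or.inl ⟨by rw [h1, h2]; omega, by rw [h1]; omega, rfl, rfl⟩)
    · exact crossings_conj_swap_aux D' hxy h3
        (Or.inr (Or.inl ⟨by rw [h1, h2]; omega, by rw [h2]; omega, rfl, rfl⟩))

theorem neg_one_pow_crossings_conj_swap {K : Type*} [CommRing K] (D : Diagram k l)
    {x y : Fin k ⊕ Fin l} (hxy : pos y = pos x + 1) (hD : D.partner x ≠ y) :
    (-1 : K) ^ (conj (Equiv.swap x y) D).crossings = - (-1) ^ D.crossings := by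
  rcases crossings_conj_swap D hxy hD with h | h
  · rw [h, pow_succ]
    ring
  · rw [h, pow_succ]
    ring

end Diagram

open Diagram

/-! ### The Pfaffian as an alternating form. -/

section

variable {K V : Type*} [Field K] [AddCommGroup V] [Module K V] {k l m : ℕ}

/-- The product of the values of the form at the arcs of a diagram whose nodes carry vectors. -/
noncomputable def arcProd (ω : LinearMap.BilinForm K V) (D : Diagram k l)
    (v : Fin k ⊕ Fin l → V) : K :=
  ∏ x, if pos x < pos (D.partner x) then ω (v x) (v (D.partner x)) else 1

/-- The vector at `x` enters just one factor, that of the arc through `x`; the two cases are that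
`x` is its first or its second end. -/
theorem exists_arcProd_update (ω : LinearMap.BilinForm K V) (D : Diagram k l)
    (v : Fin k ⊕ Fin l → V) (x : Fin k ⊕ Fin l) :
    ∃ L : V →ₗ[K] K, ∀ u, arcProd ω D (Function.update v x u) = L u := by
  have hx := D.partner_ne x
  by_cases h : pos x < pos (D.partner x)
  · refine ⟨(∏ z ∈ Finset.univ.erase x, if pos z < pos (D.partner z) then
      ω (v z) (v (D.partner z)) else 1) • ω.flip (v (D.partner x)), fun u => ?_⟩
    rw [arcProd, ← Finset.mul_prod_erase _ _ (Finset.mem_univ x), if_pos h, Function.update_self,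
      Function.update_of_ne hx, mul_comm]
    rw [LinearMap.smul_apply, smul_eq_mul, LinearMap.BilinForm.flip_apply]
    congr 1
    refine Finset.prod_congr rfl fun z hz => ?_
    have hzx := Finset.ne_of_mem_erase hz
    split_ifs with hlt
    · rw [Function.update_of_ne hzx, Function.update_of_ne]
      rw [Ne, partner_eq_iff]
      rintro rfl
      rw [D.partner_partner] at hlt
      omega
    · rfl
  · have h' : pos (D.partner x) < pos (D.partner (D.partner x)) := by
      rw [D.partner_partner]
      have := pos_injective.ne hx
      omega
    refine ⟨(∏ z ∈ Finset.univ.erase (D.partner x), if pos z < pos (D.partner z) then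
      ω (v z) (v (D.partner z)) else 1) • ω (v (D.partner x)), fun u => ?_⟩
    rw [arcProd, ← Finset.mul_prod_erase _ _ (Finset.mem_univ (D.partner x)), if_pos h',
      D.partner_partner, Function.update_self, Function.update_of_ne hx, mul_comm]
    rw [LinearMap.smul_apply, smul_eq_mul]
    congr 1
    refine Finset.prod_congr rfl fun z hz => ?_
    have hzx := Finset.ne_of_mem_erase hz
    split_ifs with hlt
    · rw [Function.update_of_ne, Function.update_of_ne]
      · rwa [Ne, partner_eq_iff]
      · rintro rfl
        exact h hlt
    · rfl

/-- `arcProd` as a multilinear map. -/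
noncomputable def arcProdMultilinear (ω : LinearMap.BilinForm K V) (D : Diagram k l) :
    MultilinearMap K (fun _ : Fin k ⊕ Fin l => V) K where
  toFun := arcProd ω D
  map_update_add' := by
    intro hdec v x u u'
    rw [Subsingleton.elim hdec instDecidableEqSum]
    obtain ⟨L, hL⟩ := exists_arcProd_update ω D v x
    rw [hL, hL, hL, map_add]
  map_update_smul' := by
    intro hdec v x c u
    rw [Subsingleton.elim hdec instDecidableEqSum]
    obtain ⟨L, hL⟩ := exists_arcProd_update ω D v x
    rw [hL, hL, map_smul]

/-- The sign has two possible sources. If `x` and `y` are joined, the diagram is unchanged and skew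
symmetry reverses the factor of this arc. Otherwise the crossing number changes by one, while the
first end of each arc is carried to a first end. -/
theorem arcProd_conj_swap (ω : LinearMap.BilinForm K V) (hω : ∀ v w, ω v w = - ω w v)
    (D : Diagram k l) {x y : Fin k ⊕ Fin l} (hxy : pos y = pos x + 1) (v : Fin k ⊕ Fin l → V) :
    (-1) ^ D.crossings * arcProd ω D (v ∘ Equiv.swap x y) =
      - ((-1) ^ (conj (Equiv.swap x y) D).crossings * arcProd ω (conj (Equiv.swap x y) D) v) := by
  have hne : x ≠ y := by
    rintro rfl
    omega
  have h1 : arcProd ω (conj (Equiv.swap x y) D) v =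
      ∏ z, if pos (Equiv.swap x y z) < pos (Equiv.swap x y (D.partner z)) then
        ω (v (Equiv.swap x y z)) (v (Equiv.swap x y (D.partner z))) else 1 := by
    rw [arcProd, ← Equiv.prod_comp (Equiv.swap x y)]
    simp only [conj_partner_apply]
  rw [h1, arcProd]
  by_cases hD : D.partner x = y
  · have hD' : D.partner y = x := by rw [← hD, D.partner_partner]
    have h2 : conj (Equiv.swap x y) D = D := by
      rw [← hD, conj_swap_partner]
    have hy : y ∈ Finset.univ.erase x := by simp [hne.symm]
    rw [h2, ← Finset.mul_prod_erase _ _ (Finset.mem_univ x), ← Finset.mul_prod_erase _ _ hy,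
      ← Finset.mul_prod_erase Finset.univ _ (Finset.mem_univ x), ← Finset.mul_prod_erase _ _ hy]
    have h3 : ∀ z ∈ (Finset.univ.erase x).erase y,
        (if pos (Equiv.swap x y z) < pos (Equiv.swap x y (D.partner z)) then
          ω (v (Equiv.swap x y z)) (v (Equiv.swap x y (D.partner z))) else 1) =
        if pos z < pos (D.partner z) then
          ω ((v ∘ Equiv.swap x y) z) ((v ∘ Equiv.swap x y) (D.partner z)) else 1 := by
      intro z hz
      have hzy := Finset.ne_of_mem_erase hz
      have hzx := Finset.ne_of_mem_erase (Finset.mem_of_mem_erase hz)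
      have hzy' : D.partner z ≠ y := by rw [Ne, partner_eq_iff, hD']; exact hzx
      have hzx' : D.partner z ≠ x := by rw [Ne, partner_eq_iff, hD]; exact hzy
      simp only [Function.comp, Equiv.swap_apply_of_ne_of_ne hzx hzy,
        Equiv.swap_apply_of_ne_of_ne hzx' hzy']
    rw [Finset.prod_congr rfl h3, hD, hD']
    simp only [Function.comp, Equiv.swap_apply_left, Equiv.swap_apply_right]
    rw [if_pos (by omega), if_neg (by omega), if_neg (by omega), if_pos (by omega),
      hω (v y) (v x)]
    ring
  · rw [neg_one_pow_crossings_conj_swap D hxy hD, neg_mul, neg_neg]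
    congr 1
    have hD' : D.partner y ≠ x := by rw [Ne, partner_eq_iff]; exact fun h => hD h.symm
    refine Finset.prod_congr rfl fun z _ => ?_
    have h4 : pos (Equiv.swap x y z) < pos (Equiv.swap x y (D.partner z)) ↔
        pos z < pos (D.partner z) := by
      have e1 := pos_injective.ne (D.partner_ne z)
      have e2 : ¬ (pos z = pos x ∧ pos (D.partner z) = pos y) := fun ⟨h1, h2⟩ => hD (by
        rw [← pos_injective h1, pos_injective h2])
      have e3 : ¬ (pos z = pos y ∧ pos (D.partner z) = pos x) := fun ⟨h1, h2⟩ => hD' (by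
        rw [← pos_injective h1, pos_injective h2])
      rw [pos_swap, pos_swap]
      split_ifs <;> omega
    simp only [h4, Function.comp]

/-- The signed sum over all diagrams of the products of the values of a skew symmetric form at the
arcs: the Pfaffian of the Gram matrix. -/
noncomputable def pfaffianMultilinear (k l : ℕ) (ω : LinearMap.BilinForm K V) :
    MultilinearMap K (fun _ : Fin k ⊕ Fin l => V) K :=
  ∑ D : Diagram k l, (-1 : K) ^ D.crossings • arcProdMultilinear ω D

theorem pfaffianMultilinear_apply (ω : LinearMap.BilinForm K V) (v : Fin k ⊕ Fin l → V) :
    pfaffianMultilinear k l ω v = ∑ D : Diagram k l, (-1 : K) ^ D.crossings * arcProd ω D v := by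
  simp [pfaffianMultilinear]
  rfl

theorem pfaffianMultilinear_comp_swap (ω : LinearMap.BilinForm K V) (hω : ∀ v w, ω v w = - ω w v)
    {x y : Fin k ⊕ Fin l} (hxy : pos y = pos x + 1) (v : Fin k ⊕ Fin l → V) :
    pfaffianMultilinear k l ω (v ∘ Equiv.swap x y) = - pfaffianMultilinear k l ω v := by
  rw [pfaffianMultilinear_apply, pfaffianMultilinear_apply, ← Finset.sum_neg_distrib]
  exact Fintype.sum_equiv (conjEquiv (Equiv.swap x y)) _ _ fun D => arcProd_conj_swap ω hω D hxy v

/-- The numbering of the nodes by their positions. -/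
def posEquiv (r : ℕ) : Fin (r + 1) ⊕ Fin (r + 1) ≃ Fin (2 * r + 1 + 1) :=
  ((Equiv.sumCongr (Equiv.refl _) Fin.revPerm).trans finSumFinEquiv).trans
    (finCongr (by omega))

theorem posEquiv_val (r : ℕ) (x : Fin (r + 1) ⊕ Fin (r + 1)) : (posEquiv r x).val = pos x := by
  rcases x with x | x
  · simp [posEquiv, pos]
  · simp [posEquiv, pos, add_comm]

/-- Exchanges of neighbouring positions generate the symmetric group once the nodes are numbered
along the boundary. -/
theorem pfaffianMultilinear_comp_perm (r : ℕ) (ω : LinearMap.BilinForm K V)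
    (hω : ∀ v w, ω v w = - ω w v) (σ : Equiv.Perm (Fin (r + 1) ⊕ Fin (r + 1)))
    (v : Fin (r + 1) ⊕ Fin (r + 1) → V) :
    pfaffianMultilinear (r + 1) (r + 1) ω (v ∘ σ) =
      (Equiv.Perm.sign σ : ℤ) • pfaffianMultilinear (r + 1) (r + 1) ω v := by
  have key : ∀ π : Equiv.Perm (Fin (2 * r + 1 + 1)), ∀ v : Fin (r + 1) ⊕ Fin (r + 1) → V,
      pfaffianMultilinear (r + 1) (r + 1) ω (v ∘ (posEquiv r).symm.permCongr π) =
      (Equiv.Perm.sign π : ℤ) • pfaffianMultilinear (r + 1) (r + 1) ω v := by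
    intro π
    have hπ : π ∈ Submonoid.closure
        (Set.range fun i : Fin (2 * r + 1) => Equiv.swap i.castSucc i.succ) := by
      rw [Equiv.Perm.mclosure_swap_castSucc_succ]
      trivial
    induction hπ using Submonoid.closure_induction with
    | mem π hπ =>
      obtain ⟨i, rfl⟩ := hπ
      intro v
      have h : (posEquiv r).symm.permCongr (Equiv.swap i.castSucc i.succ) =
          Equiv.swap ((posEquiv r).symm i.castSucc) ((posEquiv r).symm i.succ) := by
        ext z : 1
        simp [Equiv.permCongr_def, Equiv.swap_apply_def, Equiv.eq_symm_apply]
      simp only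
      rw [h, pfaffianMultilinear_comp_swap ω hω, Equiv.Perm.sign_swap i.castSucc_lt_succ.ne]
      · simp
      · rw [← posEquiv_val, ← posEquiv_val]
        simp
    | one => intro v; simp [Equiv.permCongr_def]
    | mul π π' _ _ h1 h2 =>
      intro v
      have : v ∘ (posEquiv r).symm.permCongr (π * π') =
          (v ∘ (posEquiv r).symm.permCongr π) ∘ (posEquiv r).symm.permCongr π' := by
        funext z
        simp [Equiv.permCongr_def]
      rw [this, h2, h1, Equiv.Perm.sign_mul, smul_smul, mul_comm]
      rfl
  have h := key ((posEquiv r).permCongr σ) v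
  rw [Equiv.Perm.sign_permCongr] at h
  rw [← h]
  congr 2
  ext z : 1
  simp [Equiv.permCongr_def]

theorem pfaffianMultilinear_eq_zero [CharZero K] (r : ℕ) (ω : LinearMap.BilinForm K V)
    (hω : ∀ v w, ω v w = - ω w v) (v : Fin (r + 1) ⊕ Fin (r + 1) → V)
    (hv : ¬ LinearIndependent K v) : pfaffianMultilinear (r + 1) (r + 1) ω v = 0 := by
  let f : V [⋀^Fin (r + 1) ⊕ Fin (r + 1)]→ₗ[K] K :=
    { pfaffianMultilinear (r + 1) (r + 1) ω with
      map_eq_zero_of_eq' := by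
        intro v i j hv hij
        have h := pfaffianMultilinear_comp_perm r ω hω (Equiv.swap i j) v
        have h' : v ∘ Equiv.swap i j = v := by
          funext z
          simp only [Function.comp, Equiv.swap_apply_def]
          split_ifs with h1 h2
          · rw [h1, hv]
          · rw [h2, hv]
          · rfl
        rw [h', Equiv.Perm.sign_swap hij] at h
        -- Equal arguments make the value its own negative; characteristic zero then gives zero.
        simpa [self_eq_neg] using h }
  exact f.map_linearDependent v hv

end

/-! ### Matrix entries of `functorF` as Pfaffians. -/

section

variable {K V : Type*} [Field K] [AddCommGroup V] [Module K V] {ι : Type*} [Fintype ι]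
  [DecidableEq ι] {k l : ℕ}

theorem repr_dualBasis (ω : LinearMap.BilinForm K V) (hω : ω.Nondegenerate)
    (b : Module.Basis ι K V) (x : V) (i : ι) : b.repr x i = ω (ω.dualBasis hω b i) x := by
  conv_rhs => rw [← b.sum_repr x]
  simp only [map_sum, map_smul, LinearMap.BilinForm.apply_dualBasis_left, smul_eq_mul, mul_ite,
    mul_one, mul_zero, Finset.sum_ite_eq', Finset.mem_univ, if_true]

/-- The vectors carried by the nodes of a diagram at a given pair of basis vectors. -/
noncomputable def nodeVector (ω : LinearMap.BilinForm K V) (hω : ω.Nondegenerate)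
    (b : Module.Basis ι K V) (c : Fin k → ι) (d : Fin l → ι) : Fin k ⊕ Fin l → V :=
  Sum.elim (fun i => b (c i)) (fun j => - ω.dualBasis hω b (d j))

/-- With basis vectors at the lower nodes and negated dual vectors at the upper ones, the form
yields the Kronecker delta on through strings and the coefficients of `c₀` on upper arcs, where the
two minus signs cancel. -/
theorem prod_arcFactor (ω : LinearMap.BilinForm K V) (hω : ω.Nondegenerate)
    (hskew : ∀ v w, ω v w = - ω w v) (b : Module.Basis ι K V) (c : Fin k → ι) (d : Fin l → ι)
    (D : Diagram k l) :
    ∏ x, arcFactor ω hω b c d x (D.partner x) = arcProd ω D (nodeVector ω hω b c d) := by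
  -- `arcFactor` counts an upper arc at its left end, `arcProd` at its right end, because `pos` runs
  -- along the upper line from right to left. The involution `θ` exchanges the two ends of these
  -- arcs.
  let θ : Fin k ⊕ Fin l → Fin k ⊕ Fin l := fun x =>
    if x.isRight ∧ (D.partner x).isRight then D.partner x else x
  have hθ : Function.Involutive θ := by
    intro x
    by_cases h : x.isRight ∧ (D.partner x).isRight
    · simp [θ, h, D.partner_partner]
    · simp [θ, h]
  rw [arcProd, ← Equiv.prod_comp hθ.toPerm]
  refine Finset.prod_congr rfl fun x _ => ?_
  change arcFactor ω hω b c d (θ x) (D.partner (θ x)) = _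
  rcases x with i | i
  · have h : θ (.inl i) = .inl i := by simp [θ]
    rw [h]
    rcases hD : D.partner (.inl i) with j | j
    · simp [arcFactor, pos, nodeVector]
    · have : i.1 < k + (l - 1 - j.1) := by omega
      simp only [arcFactor, pos, nodeVector, Sum.elim_inl, Sum.elim_inr, this, if_true]
      rw [map_neg, hskew, neg_neg, LinearMap.BilinForm.apply_dualBasis_left]
  · rcases hD : D.partner (.inr i) with j | j
    · have h : θ (.inr i) = .inr i := by simp [θ, hD]
      rw [h, hD]
      have : ¬ k + (l - 1 - i.1) < j.1 := by omega
      simp [arcFactor, pos, this]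
    · have h : θ (.inr i) = .inr j := by simp [θ, hD]
      have hD' : D.partner (.inr j) = .inr i := by rw [← hD, D.partner_partner]
      rw [h, hD']
      have : k + (l - 1 - i.1) < k + (l - 1 - j.1) ↔ j < i := by
        rw [Fin.lt_def]
        omega
      simp only [arcFactor, pos, nodeVector, Sum.elim_inr, this, repr_dualBasis ω hω b]
      simp

theorem functorOnDiagram_basis (ω : LinearMap.BilinForm K V) (hω : ω.Nondegenerate)
    (b : Module.Basis ι K V) (D : Diagram k l) (c : Fin k → ι) :
    functorOnDiagram ω hω b D (PiTensorProduct.tprod K fun i => b (c i)) =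
      ∑ d : Fin l → ι, ((-1) ^ D.crossings * ∏ x, arcFactor ω hω b c d x (D.partner x)) •
        PiTensorProduct.tprod K fun j => b (d j) := by
  rw [← Basis.piTensorProduct_apply, functorOnDiagram, Module.Basis.constr_basis]

/-- Each matrix entry is the Pfaffian of `2 * (r + 1)` node vectors, which are dependent because
they outnumber a basis. -/
theorem functorF_totalSum [CharZero K] (r : ℕ) (ω : LinearMap.BilinForm K V) (hω : ω.Nondegenerate)
    (hskew : ∀ v w, ω v w = - ω w v) (b : Module.Basis ι K V) (hι : Fintype.card ι < 2 * (r + 1))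
    (δ : K) : functorF ω hω b δ (totalSum δ (r + 1) (r + 1)) = 0 := by
  refine (Basis.piTensorProduct fun _ : Fin (r + 1) => b).ext fun c => ?_
  rw [Basis.piTensorProduct_apply, totalSum, functorF, map_sum, LinearMap.sum_apply]
  simp only [Hom.lift_diag, functorOnDiagram_basis]
  rw [Finset.sum_comm, LinearMap.zero_apply]
  refine Finset.sum_eq_zero fun d _ => ?_
  rw [← Finset.sum_smul]
  simp only [prod_arcFactor ω hω hskew]
  rw [← pfaffianMultilinear_apply, pfaffianMultilinear_eq_zero r ω hskew, zero_smul]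
  intro h
  have := b.finiteDimensional_of_finite
  have h1 := h.fintype_card_le_finrank
  rw [Module.finrank_eq_card_basis b] at h1
  simp at h1
  omega

end

/-! ### Arbitrary tensor functors: signs, generators as tensor products, and vanishing. -/

namespace Diagram

variable {k l r : ℕ}

theorem crossings_ofPerm_one : (ofPerm (1 : Equiv.Perm (Fin r))).crossings = 0 := by
  rw [crossings_eq, Finset.card_eq_zero, crossingSet, Finset.filter_eq_empty_iff]
  rintro ⟨a | a, b | b⟩ - <;> simp [ofPerm, pos] <;> omega

theorem neg_one_pow_crossings_ofPerm (K : Type*) [CommRing K] (ρ : Equiv.Perm (Fin r)) :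
    (-1 : K) ^ (ofPerm ρ).crossings = (Equiv.Perm.sign ρ : ℤ) := by
  obtain _ | r := r
  · rw [Subsingleton.elim ρ 1, crossings_ofPerm_one]
    simp
  have key : ∀ π ρ : Equiv.Perm (Fin (r + 1)), (-1 : K) ^ (ofPerm (π * ρ)).crossings =
      (Equiv.Perm.sign π : ℤ) * (-1) ^ (ofPerm ρ).crossings := by
    intro π
    have hπ : π ∈ Submonoid.closure
        (Set.range fun i : Fin r => Equiv.swap i.castSucc i.succ) := by
      rw [Equiv.Perm.mclosure_swap_castSucc_succ]
      trivial
    induction hπ using Submonoid.closure_induction with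
    | mem π hπ =>
      obtain ⟨i, rfl⟩ := hπ
      intro ρ
      -- The arguments of the transposition are reversed because on the upper line `i.succ` comes
      -- directly before `i.castSucc` in the order of `pos`.
      have h1 : ofPerm (Equiv.swap i.castSucc i.succ * ρ) =
          conj (Equiv.swap (.inr i.succ) (.inr i.castSucc)) (ofPerm ρ) := by
        have := conj_ofPerm (Equiv.swap i.castSucc i.succ) 1 ρ
        rw [inv_one, mul_one] at this
        rw [← this, Equiv.swap_comm, ← Equiv.Perm.sumCongr_one_swap]
      simp only
      rw [h1, neg_one_pow_crossings_conj_swap _ _ (by simp [ofPerm]),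
        Equiv.Perm.sign_swap i.castSucc_lt_succ.ne]
      · simp
      · simp only [pos, Sum.elim_inr, Fin.val_succ, Fin.val_castSucc]
        omega
    | one => intro ρ; simp
    | mul π π' _ _ h1 h2 =>
      intro ρ
      rw [mul_assoc, h1, h2, Equiv.Perm.sign_mul]
      push_cast
      ring
  simpa [crossings_ofPerm_one] using key ρ 1

theorem tensor_partner {p q : ℕ} (D : Diagram p q) (D' : Diagram k l) (y) :
    (D.tensor D').partner (juxtapose p q k l y) =
      juxtapose p q k l (Sum.map D.partner D'.partner y) := by
  simp [tensor]

theorem ofPerm_tensor_ofPerm {p q : ℕ} (σ : Equiv.Perm (Fin p)) (τ : Equiv.Perm (Fin q)) :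
    (ofPerm σ).tensor (ofPerm τ) = ofPerm (finSumFinEquiv.permCongr (Equiv.sumCongr σ τ)) := by
  ext1
  funext x
  obtain ⟨y, rfl⟩ := (juxtapose p p q q).surjective x
  rw [tensor_partner]
  rcases y with (y | y) | (y | y) <;> simp [juxtapose, ofPerm, Equiv.permCongr_def]

theorem ofPerm_eq_of_forall {σ τ : Equiv.Perm (Fin r)} (h : ∀ i, σ i = τ i) :
    ofPerm σ = ofPerm τ := congrArg _ (Equiv.ext h)

/-- With `sDiagram_last` this builds every generator from `X` and vertical strings by tensor
products, the form in which the axioms of a `TensorFunctor` determine its value. -/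
theorem sDiagram_castSucc (i : Fin r) :
    sDiagram i.castSucc = (sDiagram i).tensor (ofPerm (1 : Equiv.Perm (Fin 1))) := by
  rw [sDiagram, sDiagram, ofPerm_tensor_ofPerm]
  refine ofPerm_eq_of_forall fun x => ?_
  refine Fin.addCases (fun x => ?_) (fun x => ?_) x
  · simp only [Equiv.permCongr_apply, finSumFinEquiv_symm_apply_castAdd, Equiv.sumCongr_apply,
      Sum.map_inl, finSumFinEquiv_apply_left, Equiv.swap_apply_def]
    simp only [Fin.ext_iff, Fin.val_castAdd, Fin.val_castSucc, Fin.val_succ]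
    split_ifs <;> simp
  · simp only [Equiv.permCongr_apply, finSumFinEquiv_symm_apply_natAdd, Equiv.sumCongr_apply,
      Sum.map_inr, finSumFinEquiv_apply_right, Equiv.swap_apply_def]
    have := i.2
    simp only [Fin.ext_iff, Fin.val_natAdd, Fin.val_castSucc, Fin.val_succ]
    split_ifs <;> simp <;> omega

theorem sDiagram_last (r : ℕ) :
    sDiagram (Fin.last r) = (ofPerm (1 : Equiv.Perm (Fin r))).tensor X := by
  rw [sDiagram, X, ofPerm_tensor_ofPerm]
  refine ofPerm_eq_of_forall fun x => ?_
  refine Fin.addCases (m := r) (n := 2) (fun x => ?_) (fun x => ?_) x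
  · simp only [Equiv.permCongr_apply, finSumFinEquiv_symm_apply_castAdd, Equiv.sumCongr_apply,
      Sum.map_inl, finSumFinEquiv_apply_left, Equiv.swap_apply_def]
    have := x.2
    simp only [Fin.ext_iff, Fin.val_castAdd, Fin.val_castSucc, Fin.val_succ, Fin.val_last]
    split_ifs <;> simp <;> omega
  · simp only [Equiv.permCongr_apply, finSumFinEquiv_symm_apply_natAdd, Equiv.sumCongr_apply,
      Sum.map_inr, finSumFinEquiv_apply_right]
    fin_cases x
    · simp [Equiv.swap_apply_def, Fin.ext_iff]
    · simp [Equiv.swap_apply_def, Fin.ext_iff]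

end Diagram

open Diagram

theorem apply_comp_perm_of_swap {K ι : Type*} [Field K] {r : ℕ} {t : (Fin (r + 1) → ι) → K}
    (ht : ∀ (i : Fin r) c, t (c ∘ Equiv.swap i.castSucc i.succ) = - t c)
    (σ : Equiv.Perm (Fin (r + 1))) (c) : t (c ∘ σ) = (Equiv.Perm.sign σ : ℤ) * t c := by
  have hσ : σ ∈ Submonoid.closure
      (Set.range fun i : Fin r => Equiv.swap i.castSucc i.succ) := by
    rw [Equiv.Perm.mclosure_swap_castSucc_succ]
    trivial
  induction hσ using Submonoid.closure_induction generalizing c with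
  | mem π hπ =>
    obtain ⟨i, rfl⟩ := hπ
    simp only
    rw [ht, Equiv.Perm.sign_swap i.castSucc_lt_succ.ne]
    simp
  | one => simp
  | mul π π' _ _ h1 h2 =>
    rw [Equiv.Perm.coe_mul, ← Function.comp_assoc, h2, h1, Equiv.Perm.sign_mul]
    push_cast
    ring

theorem exists_perm_apply_eq {α : Type*} [DecidableEq α] {i j p q : α} (hij : i ≠ j) (hpq : p ≠ q) :
    ∃ σ : Equiv.Perm α, σ p = i ∧ σ q = j := by
  refine ⟨Equiv.swap (Equiv.swap p i q) j * Equiv.swap p i, ?_, ?_⟩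
  · rw [Equiv.Perm.mul_apply, Equiv.swap_apply_left, Equiv.swap_apply_of_ne_of_ne _ hij]
    intro h
    rw [eq_comm, Equiv.swap_apply_eq_iff, Equiv.swap_apply_right] at h
    exact hpq h.symm
  · rw [Equiv.Perm.mul_apply, Equiv.swap_apply_left]

section

open scoped TensorProduct

variable {K V : Type*} [Field K] [AddCommGroup V] [Module K V] {ι : Type*} [Fintype ι] {r : ℕ}

/-- The tensor with coefficients `t` in the basis of products of basis vectors. -/
noncomputable def tensorOf (b : Module.Basis ι K V) (t : (Fin r → ι) → K) : ⨂[K]^r V :=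
  ∑ c, t c • PiTensorProduct.tprod K fun i => b (c i)

theorem tensorOf_injective (b : Module.Basis ι K V) :
    Function.Injective (tensorOf b : ((Fin r → ι) → K) → ⨂[K]^r V) := by
  intro t t' h
  simp only [tensorOf, ← Basis.piTensorProduct_apply, ← Module.Basis.equivFun_symm_apply] at h
  exact (Basis.piTensorProduct fun _ : Fin r => b).equivFun.symm.injective h

theorem exists_eq_tensorOf (b : Module.Basis ι K V) (T : ⨂[K]^r V) : ∃ t, T = tensorOf b t := by
  refine ⟨(Basis.piTensorProduct fun _ : Fin r => b).repr T, ?_⟩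
  simp only [tensorOf, ← Basis.piTensorProduct_apply]
  exact ((Basis.piTensorProduct fun _ : Fin r => b).sum_repr T).symm

/-- Antisymmetry moves the vanishing contraction from the last two factors to the factors `i`, `j`,
up to a sign. Pairing the resulting tensor identity with a linear form gives the scalar version
weighted by `G`. -/
theorem sum_contraction_eq_zero (ω : LinearMap.BilinForm K V) (b : Module.Basis ι K V)
    {t : (Fin (r + 2) → ι) → K}
    (ht : ∀ (σ : Equiv.Perm (Fin (r + 2))) c, t (c ∘ σ) = (Equiv.Perm.sign σ : ℤ) * t c)
    (h0 : ∑ c, (t c * ω (b (c (Fin.natAdd r 0))) (b (c (Fin.natAdd r 1)))) •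
      PiTensorProduct.tprod K (fun i : Fin (r + 0) => b (c (Fin.castAdd 2 i))) = 0)
    {i j : Fin (r + 2)} (hij : i ≠ j) (G : (Fin (r + 2) → ι) → K)
    (hG : ∀ c c', (∀ z, z ≠ i → z ≠ j → c z = c' z) → G c = G c') :
    ∑ c, t c * (ω (b (c i)) (b (c j)) * G c) = 0 := by
  obtain ⟨σ, hσ₀, hσ₁⟩ := exists_perm_apply_eq (p := Fin.natAdd r (0 : Fin 2))
    (q := Fin.natAdd r (1 : Fin 2)) hij (by simp [Fin.ext_iff])
  have hσ : ∀ z : Fin (r + 2), z ≠ i → z ≠ j → ∃ y : Fin r, σ (Fin.castAdd 2 y) = z := by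
    intro z h1 h2
    obtain ⟨x, rfl⟩ := σ.surjective z
    revert h1 h2
    refine Fin.addCases (fun x _ _ => ⟨x, rfl⟩) (fun x => ?_) x
    fin_cases x
    · exact fun h _ => (h hσ₀).elim
    · exact fun _ h => (h hσ₁).elim
  have hfac : Function.FactorsThrough (fun c : Fin (r + 2) → ι => G (c ∘ σ.symm))
      (fun c (i : Fin (r + 0)) => c (Fin.castAdd 2 i)) := by
    intro c c' h
    refine hG _ _ fun z h1 h2 => ?_
    obtain ⟨y, rfl⟩ := hσ z h1 h2
    simpa using congrFun h y
  -- After transport by `σ` the weight depends on the first `r` indices only, so it descends to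
  -- them. The default `0` plays no role, as `g` is evaluated only at restrictions.
  set g := Function.extend (fun (c : Fin (r + 2) → ι) (i : Fin (r + 0)) => c (Fin.castAdd 2 i))
    (fun c => G (c ∘ σ.symm)) 0 with hg
  have hgG : ∀ c : Fin (r + 2) → ι, g (fun i => c (Fin.castAdd 2 i)) = G (c ∘ σ.symm) :=
    fun c => hfac.extend_apply 0 c
  have h1 := congrArg ((Basis.piTensorProduct fun _ : Fin (r + 0) => b).constr K g) h0
  have h2 : ∀ a : Fin (r + 0) → ι, (Basis.piTensorProduct fun _ : Fin (r + 0) => b).constr K g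
      (PiTensorProduct.tprod K fun i => b (a i)) = g a := by
    intro a
    rw [← Basis.piTensorProduct_apply, Module.Basis.constr_basis]
  have h3 : ∀ c : Fin (r + 2) → ι, (Basis.piTensorProduct fun _ : Fin (r + 0) => b).constr K g
      (PiTensorProduct.tprod K fun i : Fin (r + 0) => b (c (Fin.castAdd 2 i))) =
        G (c ∘ σ.symm) := fun c => (h2 fun i => c (Fin.castAdd 2 i)).trans (hgG c)
  simp only [map_sum, map_smul, h3, map_zero, smul_eq_mul] at h1
  have h4 : ∑ c, t c * (ω (b (c i)) (b (c j)) * G c) =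
      ∑ c, (Equiv.Perm.sign σ.symm : ℤ) * (t c *
        ω (b (c (Fin.natAdd r 0))) (b (c (Fin.natAdd r 1))) * G (c ∘ σ.symm)) := by
    symm
    refine Fintype.sum_equiv (Equiv.arrowCongr σ (Equiv.refl ι)) _ _ fun c => ?_
    have e : Equiv.arrowCongr σ (Equiv.refl ι) c = c ∘ σ.symm := rfl
    rw [e, ht, ← hσ₀, ← hσ₁]
    simp only [Function.comp, Equiv.symm_apply_apply]
    ring
  rw [h4, ← Finset.mul_sum, h1, mul_zero]

end

section

open scoped TensorProduct

variable {K V : Type*} [Field K] [AddCommGroup V] [Module K V] {ι : Type*} [Fintype ι]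
  [DecidableEq ι] {r : ℕ}

theorem mulEquiv_tprod_tmul_tprod {p q : ℕ} (v : Fin p → V) (w : Fin q → V) :
    TensorPower.mulEquiv (PiTensorProduct.tprod K v ⊗ₜ[K] PiTensorProduct.tprod K w) =
      PiTensorProduct.tprod K (Fin.append v w) := TensorPower.tprod_mul_tprod K v w

namespace TensorFunctor

variable {ω : LinearMap.BilinForm K V} {hω : ω.Nondegenerate} {b : Module.Basis ι K V} {δ : K}

theorem map_tensor_tprod (F : TensorFunctor ω hω b δ) {p q k l : ℕ} (D : Diagram p q)
    (D' : Diagram k l) (v : Fin (p + k) → V) :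
    F.map (diag δ (D.tensor D')) (PiTensorProduct.tprod K v) =
      TensorPower.mulEquiv
        (F.map (diag δ D) (PiTensorProduct.tprod K fun i => v (Fin.castAdd k i)) ⊗ₜ[K]
          F.map (diag δ D') (PiTensorProduct.tprod K fun i => v (Fin.natAdd p i))) := by
  rw [← F.map_tensor, mulEquiv_tprod_tmul_tprod, Fin.append_castAdd_natAdd]

theorem map_ofPerm_one (F : TensorFunctor ω hω b δ) (x : ⨂[K]^r V) :
    F.map (diag δ (ofPerm (1 : Equiv.Perm (Fin r)))) x = x :=
  congrArg (fun f => f x) (F.map_id r)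

theorem map_sDiagram (F : TensorFunctor ω hω b δ) (i : Fin r) (v : Fin (r + 1) → V) :
    F.map (diag δ (sDiagram i)) (PiTensorProduct.tprod K v) =
      - PiTensorProduct.tprod K (v ∘ Equiv.swap i.castSucc i.succ) := by
  induction r with
  | zero => exact i.elim0
  | succ r ih =>
    induction i using Fin.lastCases with
    | cast i =>
      rw [sDiagram_castSucc, map_tensor_tprod, ih, map_ofPerm_one, TensorProduct.neg_tmul, map_neg,
        mulEquiv_tprod_tmul_tprod]
      congr 2
      funext x
      refine Fin.addCases (fun x => ?_) (fun x => ?_) x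
      · rw [Fin.append_left]
        simp only [Function.comp]
        congr 1
        simp only [Equiv.swap_apply_def, Fin.ext_iff, Fin.val_castAdd, Fin.val_castSucc,
          Fin.val_succ]
        split_ifs <;> simp
      · rw [Fin.append_right]
        simp only [Function.comp]
        congr 1
        have := i.2
        simp only [Equiv.swap_apply_def, Fin.ext_iff, Fin.val_natAdd, Fin.val_castSucc,
          Fin.val_succ]
        split_ifs <;> simp <;> omega
    | last =>
      have h : (fun i : Fin 2 => v (Fin.natAdd r i)) = 
          ![v (Fin.natAdd r (0 : Fin 2)), v (Fin.natAdd r (1 : Fin 2))] := by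
        funext i
        fin_cases i <;> rfl
      rw [sDiagram_last]
      refine (F.map_tensor_tprod (k := 2) (l := 2) (ofPerm (1 : Equiv.Perm (Fin r))) X v).trans ?_
      rw [map_ofPerm_one, h, F.map_X, TensorProduct.tmul_neg,
        map_neg, mulEquiv_tprod_tmul_tprod]
      congr 2
      funext x
      refine Fin.addCases (m := r) (n := 2) (fun x => ?_) (fun x => ?_) x
      · rw [Fin.append_left]
        simp only [Function.comp]
        congr 1
        have := x.2
        simp only [Equiv.swap_apply_def, Fin.ext_iff, Fin.val_castAdd, Fin.val_castSucc,
          Fin.val_succ, Fin.val_last]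
        split_ifs <;> simp <;> omega
      · rw [Fin.append_right]
        simp only [Function.comp]
        fin_cases x
        · simp [Equiv.swap_apply_def, Fin.ext_iff]
          congr 1
        · simp [Equiv.swap_apply_def, Fin.ext_iff]
          congr 1

theorem map_id_tensor_A (F : TensorFunctor ω hω b δ) (v : Fin (r + 2) → V) :
    F.map (diag δ ((ofPerm (1 : Equiv.Perm (Fin r))).tensor A)) (PiTensorProduct.tprod K v) =
      ω (v (Fin.natAdd r 0)) (v (Fin.natAdd r 1)) •
        PiTensorProduct.tprod K (fun i : Fin (r + 0) => v (Fin.castAdd 2 i)) := by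
  have h : (fun i : Fin 2 => v (Fin.natAdd r i)) = ![v (Fin.natAdd r 0), v (Fin.natAdd r 1)] := by
    funext i
    fin_cases i <;> rfl
  rw [map_tensor_tprod, map_ofPerm_one, h, F.map_A, TensorProduct.tmul_smul, map_smul,
    mulEquiv_tprod_tmul_tprod]
  congr 2
  funext x
  exact Fin.append_left (m := r) (n := 0) _ _ x

end TensorFunctor

theorem functorOnDiagram_tensorOf (ω : LinearMap.BilinForm K V) (hω : ω.Nondegenerate)
    (b : Module.Basis ι K V) {k l : ℕ} (D : Diagram k l) (t : (Fin k → ι) → K) :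
    functorOnDiagram ω hω b D (tensorOf b t) =
      ∑ d : Fin l → ι, ((-1) ^ D.crossings *
        ∑ c, t c * ∏ x, arcFactor ω hω b c d x (D.partner x)) •
          PiTensorProduct.tprod K fun j => b (d j) := by
  simp only [tensorOf, map_sum, map_smul, functorOnDiagram_basis, Finset.smul_sum, smul_smul]
  rw [Finset.sum_comm]
  refine Finset.sum_congr rfl fun d _ => ?_
  rw [← Finset.sum_smul, Finset.mul_sum]
  congr 1
  refine Finset.sum_congr rfl fun c _ => ?_
  ring

/-- The sign of the crossings cancels the sign from the antisymmetry of `t`. -/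
theorem functorOnDiagram_ofPerm (ω : LinearMap.BilinForm K V) (hω : ω.Nondegenerate)
    (b : Module.Basis ι K V) {t : (Fin r → ι) → K}
    (ht : ∀ (σ : Equiv.Perm (Fin r)) c, t (c ∘ σ) = (Equiv.Perm.sign σ : ℤ) * t c)
    (ρ : Equiv.Perm (Fin r)) :
    functorOnDiagram ω hω b (ofPerm ρ) (tensorOf b t) = tensorOf b t := by
  rw [functorOnDiagram_tensorOf, tensorOf]
  refine Finset.sum_congr rfl fun d _ => ?_
  congr 1
  have h : ∀ c : Fin r → ι, ∏ x, arcFactor ω hω b c d x ((ofPerm ρ).partner x) =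
      if c = d ∘ ρ then 1 else 0 := by
    intro c
    rw [Fintype.prod_sum_type]
    simp only [ofPerm, Sum.elim_inl, Sum.elim_inr, arcFactor, Finset.prod_const_one, mul_one,
      Finset.prod_ite_zero, funext_iff, Function.comp, Finset.mem_univ, true_imp_iff]
  simp only [h, mul_ite, mul_one, mul_zero, Finset.sum_ite_eq', Finset.mem_univ, if_true]
  rw [ht, neg_one_pow_crossings_ofPerm, ← mul_assoc, ← Int.cast_mul, ← Units.val_mul,
    Int.units_mul_self]
  simp

/-- The arc from `i` to `j` splits off as a factor of every matrix entry, and the other factors do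
not involve the indices at `i` and `j`; they serve as the weight `G`. -/
theorem functorOnDiagram_eq_zero (ω : LinearMap.BilinForm K V) (hω : ω.Nondegenerate)
    (b : Module.Basis ι K V) {k l : ℕ} {t : (Fin k → ι) → K} (D : Diagram k l) {i j : Fin k}
    (hD : D.partner (.inl i) = .inl j) (hij : i < j)
    (ht : ∀ G : (Fin k → ι) → K, (∀ c c', (∀ z, z ≠ i → z ≠ j → c z = c' z) → G c = G c') →
      ∑ c, t c * (ω (b (c i)) (b (c j)) * G c) = 0) :
    functorOnDiagram ω hω b D (tensorOf b t) = 0 := by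
  rw [functorOnDiagram_tensorOf]
  refine Finset.sum_eq_zero fun d _ => ?_
  have h : ∀ c, ∏ x, arcFactor ω hω b c d x (D.partner x) = ω (b (c i)) (b (c j)) *
      ∏ x ∈ Finset.univ.erase (.inl i), arcFactor ω hω b c d x (D.partner x) := by
    intro c
    rw [← Finset.mul_prod_erase _ _ (Finset.mem_univ (.inl i)), hD]
    simp [arcFactor, hij]
  simp only [h]
  rw [ht, mul_zero, zero_smul]
  intro c c' hc
  refine Finset.prod_congr rfl fun x hx => ?_
  have hxi := Finset.ne_of_mem_erase hx
  by_cases hxj : x = .inl j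
  · subst hxj
    have : D.partner (.inl j) = .inl i := by rw [← hD, D.partner_partner]
    rw [this]
    simp [arcFactor, hij.not_gt]
  have h1 : D.partner x ≠ .inl i := by rw [Ne, partner_eq_iff, hD]; exact hxj
  have h2 : D.partner x ≠ .inl j := by rw [Ne, partner_eq_iff, ← hD, D.partner_partner]; exact hxi
  rcases x with x | x <;> rcases hDx : D.partner _ with y | y <;> rw [hDx] at h1 h2
  · simp only [arcFactor]
    rw [hc x (by simpa using hxi) (by simpa using hxj), hc y (by simpa using h1) (by simpa using h2)]
  · simp only [arcFactor]
    rw [hc x (by simpa using hxi) (by simpa using hxj)]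
  · rfl
  · rfl

namespace TensorFunctor

/-- Only the values of `F` on the generators `s_i` and on one contraction are used. They make each
tensor in the image antisymmetric and free of contractions; the explicit operators
`functorOnDiagram` then do the rest. -/
theorem map_totalSum [CharZero K] (n : ℕ) {ω : LinearMap.BilinForm K V} {hω : ω.Nondegenerate}
    {b : Module.Basis ι K V} (hskew : ∀ v w, ω v w = - ω w v)
    (hι : Fintype.card ι < 2 * (n + 1)) (F : TensorFunctor ω hω b (-2 * n : K)) :
    F.map (totalSum (-2 * n : K) (n + 1) (n + 1)) = 0 := by
  ext1
  refine MultilinearMap.ext fun v => ?_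
  obtain ⟨t, hT⟩ := exists_eq_tensorOf b
    (F.map (totalSum (-2 * n : K) (n + 1) (n + 1)) (PiTensorProduct.tprod K v))
  change F.map (totalSum (-2 * n : K) (n + 1) (n + 1)) (PiTensorProduct.tprod K v) = 0
  have hcomp : ∀ {l : ℕ} (D : Diagram (n + 1) l),
      F.map (diag _ D) (tensorOf b t) =
        F.map (Hom.comp (diag _ D) (totalSum (-2 * n : K) (n + 1) (n + 1)))
          (PiTensorProduct.tprod K v) := by
    intro l D
    rw [← hT, F.map_comp]
    rfl
  -- `s_i` fixes the sum of all diagrams, yet `F` sends it to minus the flip of two factors.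
  have hswap : ∀ (i : Fin n) c, t (c ∘ Equiv.swap i.castSucc i.succ) = - t c := by
    intro i c
    have h1 : F.map (diag _ (sDiagram i)) (tensorOf b t) = tensorOf b t := by
      rw [hcomp, sDiagram, ofPerm_comp_totalSum, hT]
    have h2 : F.map (diag _ (sDiagram i)) (tensorOf b t) =
        tensorOf b fun c => - t (c ∘ Equiv.swap i.castSucc i.succ) := by
      simp only [tensorOf, map_sum, map_smul, F.map_sDiagram]
      refine Fintype.sum_equiv (Equiv.arrowCongr (Equiv.swap i.castSucc i.succ) (Equiv.refl ι)) _ _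
        fun c => ?_
      have e : Equiv.arrowCongr (Equiv.swap i.castSucc i.succ) (Equiv.refl ι) c =
        c ∘ Equiv.swap i.castSucc i.succ := rfl
      have e' : (c ∘ Equiv.swap i.castSucc i.succ) ∘ Equiv.swap i.castSucc i.succ = c := by
        funext x
        simp
      rw [e, e', smul_neg, neg_smul]
      rfl
    have h3 := congrFun (tensorOf_injective b (h2.symm.trans h1)) c
    rw [← h3, neg_neg]
  have hperm := apply_comp_perm_of_swap hswap
  have hcontr : ∀ D : Diagram (n + 1) (n + 1), D.capped ≠ ∅ →
      functorOnDiagram ω hω b D (tensorOf b t) = 0 := by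
    intro D hD
    obtain ⟨i, j, hij, hlt⟩ : ∃ i j : Fin (n + 1), D.partner (.inl i) = .inl j ∧ i < j := by
      obtain ⟨i, hi⟩ := Finset.nonempty_iff_ne_empty.2 hD
      rw [mem_capped] at hi
      rcases lt_trichotomy i (D.lower i) with h | h | h
      · exact ⟨_, _, hi, h⟩
      · rw [← h] at hi
        exact (D.partner_ne _ hi).elim
      · exact ⟨_, _, (D.partner_eq_iff.1 hi).symm, h⟩
    refine functorOnDiagram_eq_zero ω hω b D hij hlt ?_
    obtain _ | m := n
    · exact (hlt.ne (Fin.ext (by omega))).elim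
    · refine fun G hG => sum_contraction_eq_zero ω b hperm ?_ hlt.ne G hG
      -- This diagram has a lower arc at the last two positions, so it kills the sum, and its image
      -- under `F` is the contraction of the last two factors.
      have h1 := hcomp ((ofPerm (1 : Equiv.Perm (Fin m))).tensor A)
      have h2 : ((ofPerm (1 : Equiv.Perm (Fin m))).tensor A).partner (.inl (Fin.natAdd m 0)) =
          .inl (Fin.natAdd m 1) :=
        tensor_partner (ofPerm (1 : Equiv.Perm (Fin m))) A (.inr (.inl 0))
      rw [comp_totalSum_eq_zero _ h2, map_zero, LinearMap.zero_apply] at h1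
      rw [← h1, tensorOf, map_sum]
      refine Finset.sum_congr rfl fun c _ => ?_
      rw [map_smul, map_id_tensor_A, smul_smul]
  -- Evaluating the vanishing Pfaffian operator at the tensor itself leaves one copy of the tensor
  -- for every permutation diagram.
  have h := congrArg (fun f => f (tensorOf b t)) (functorF_totalSum n ω hω hskew b hι (-2 * n : K))
  simp only [totalSum, functorF, map_sum, Hom.lift_diag, LinearMap.sum_apply,
    LinearMap.zero_apply] at h
  have hterm : ∀ D : Diagram (n + 1) (n + 1), functorOnDiagram ω hω b D (tensorOf b t) =
      if D.capped = ∅ then tensorOf b t else 0 := by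
    intro D
    split_ifs with hD
    · obtain ⟨ρ, rfl⟩ := exists_ofPerm D hD
      exact functorOnDiagram_ofPerm ω hω b hperm ρ
    · exact hcontr D hD
  simp only [hterm] at h
  rw [← Finset.sum_filter, Finset.sum_const, ← Nat.cast_smul_eq_nsmul K] at h
  rw [hT]
  refine (smul_eq_zero.1 h).resolve_left ?_
  refine Nat.cast_ne_zero.2 (Finset.card_pos.2 ?_).ne'
  exact ⟨ofPerm 1, by simp [capped_ofPerm]⟩

end TensorFunctor

end

open Diagram

/-! ### The trivial representation. -/

section

variable {K : Type*} [CommRing K] {δ : K} {r n : ℕ}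

theorem ofPerm_mul_ofPerm (σ τ : Equiv.Perm (Fin r)) :
    (diag δ (ofPerm σ) * diag δ (ofPerm τ) : BrauerAlgebra δ r) = diag δ (ofPerm (σ * τ)) := by
  rw [mul_eq_comp, comp_ofPerm_left]
  have h := conj_ofPerm σ 1 τ
  rw [inv_one, mul_one] at h
  exact congrArg (diag δ) h

theorem algHom_ofPerm (ρ : BrauerAlgebra δ (n + 1) →ₐ[K] K) (hρ : ∀ i, ρ (s δ i) = 1)
    (σ : Equiv.Perm (Fin (n + 1))) : ρ (diag δ (ofPerm σ)) = 1 := by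
  have hσ : σ ∈ Submonoid.closure
      (Set.range fun i : Fin n => Equiv.swap i.castSucc i.succ) := by
    rw [Equiv.Perm.mclosure_swap_castSucc_succ]
    trivial
  induction hσ using Submonoid.closure_induction with
  | mem π hπ =>
    obtain ⟨i, rfl⟩ := hπ
    exact hρ i
  | one => exact map_one ρ
  | mul π π' _ _ h1 h2 => rw [← ofPerm_mul_ofPerm, map_mul, h1, h2, one_mul]

/-- The linear form which is `1` on permutations and `0` on all other diagrams. -/
noncomputable def permCoeff (δ : K) (r : ℕ) : Hom δ r r →ₗ[K] K :=
  Hom.lift fun D => if D.capped = ∅ then 1 else 0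

theorem permCoeff_ofPerm (σ : Equiv.Perm (Fin r)) : permCoeff δ r (diag δ (ofPerm σ)) = 1 := by
  rw [permCoeff, Hom.lift_diag, if_pos (capped_ofPerm σ)]

theorem permCoeff_totalSum : permCoeff δ r (totalSum δ r r) = (r.factorial : K) := by
  have h : (Finset.univ.filter fun D : Diagram r r => D.capped = ∅) =
      Finset.univ.map ⟨ofPerm, ofPerm_injective⟩ := by
    ext D
    simp only [Finset.mem_filter_univ, Finset.mem_map, Finset.mem_univ, true_and,
      Function.Embedding.coeFn_mk]
    constructor
    · intro hD
      obtain ⟨σ, rfl⟩ := exists_ofPerm D hD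
      exact ⟨σ, rfl⟩
    · rintro ⟨σ, rfl⟩
      exact capped_ofPerm σ
  simp only [totalSum, permCoeff, map_sum, Hom.lift_diag]
  rw [← Finset.sum_filter, h, Finset.sum_const, Finset.card_map, Finset.card_univ,
    Fintype.card_perm, Fintype.card_fin, nsmul_one]

end

section

variable {K : Type*} [Field K] [CharZero K] {n : ℕ}

theorem mul_totalSum (a : BrauerAlgebra (-2 * n : K) (n + 1)) :
    a * totalSum (-2 * n : K) (n + 1) (n + 1) =
      permCoeff (-2 * n : K) (n + 1) a • totalSum (-2 * n : K) (n + 1) (n + 1) := by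
  rw [mul_eq_comp]
  induction a using Hom.induction with
  | zero => simp
  | add x y hx hy => rw [map_add, LinearMap.add_apply, hx, hy, map_add, add_smul]
  | smul c D =>
    rw [map_smul, LinearMap.smul_apply, map_smul, smul_eq_mul, mul_smul]
    congr 1
    rw [permCoeff, Hom.lift_diag]
    split_ifs with hD
    · obtain ⟨σ, rfl⟩ := exists_ofPerm D hD
      rw [ofPerm_comp_totalSum, one_smul]
    · obtain ⟨i, hi⟩ := Finset.nonempty_iff_ne_empty.2 hD
      rw [comp_totalSum_eq_zero D (mem_capped.1 hi), zero_smul]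

theorem totalSum_ne_zero : totalSum (-2 * n : K) (n + 1) (n + 1) ≠ 0 := by
  intro h
  have h1 := permCoeff_totalSum (δ := (-2 * n : K)) (r := n + 1)
  rw [h, map_zero] at h1
  exact Nat.cast_ne_zero.2 (n + 1).factorial_ne_zero h1.symm

/-- Reflection gives right multiplication by the scalar of `Hom.star a`. Evaluating `Φ * a * Φ` in
two ways identifies it with the scalar of `a`, after cancelling `(n + 1)!`. -/
theorem totalSum_mul (a : BrauerAlgebra (-2 * n : K) (n + 1)) :
    totalSum (-2 * n : K) (n + 1) (n + 1) * a =
      permCoeff (-2 * n : K) (n + 1) a • totalSum (-2 * n : K) (n + 1) (n + 1) := by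
  set Φ : BrauerAlgebra (-2 * n : K) (n + 1) := totalSum (-2 * n : K) (n + 1) (n + 1) with hΦ
  have h1 : Φ * a = permCoeff (-2 * n : K) (n + 1) (Hom.star a) • Φ := by
    have h := congrArg Hom.star (mul_totalSum (Hom.star a))
    rwa [star_mul, star_star, star_totalSum, map_smul, star_totalSum] at h
  have h2 : Φ * a * Φ = Φ * (a * Φ) := mul_assoc _ _ _
  rw [h1, hΦ, mul_totalSum a, smul_mul_assoc, mul_smul_comm, mul_totalSum, permCoeff_totalSum,
    smul_smul, smul_smul] at h2
  rw [h1, mul_right_cancel₀ (Nat.cast_ne_zero.2 (n + 1).factorial_ne_zero)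
    (smul_left_injective K totalSum_ne_zero h2)]

variable (K n) in
/-- The trivial representation of the Brauer algebra. -/
noncomputable def trivialRep : BrauerAlgebra (-2 * n : K) (n + 1) →ₐ[K] K :=
  AlgHom.ofLinearMap (permCoeff (-2 * n : K) (n + 1)) (permCoeff_ofPerm 1) fun x y => by
    -- Multiplicativity is inherited from associativity: `permCoeff` is the scalar by which an
    -- element acts on a nonzero vector.
    apply smul_left_injective K (totalSum_ne_zero (K := K) (n := n))
    simp only
    rw [← mul_totalSum, mul_assoc, mul_totalSum, mul_smul_comm, mul_totalSum, smul_smul]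
    congr 1
    exact mul_comm _ _

theorem trivialRep_apply (a : BrauerAlgebra (-2 * n : K) (n + 1)) :
    trivialRep K n a = permCoeff (-2 * n : K) (n + 1) a := rfl

/-- Permutations are products of the `s_i`. For a diagram with a lower arc, a permutation invisible
to `ρ` moves that arc to the first two positions; then `D e₁ = δ D` forces the value `0`, as `δ ≠
0`. -/
theorem algHom_eq_trivialRep (ρ : BrauerAlgebra (-2 * n : K) (n + 1) →ₐ[K] K)
    (hs : ∀ i, ρ (s (-2 * n : K) i) = 1) (he : ∀ i, ρ (e (-2 * n : K) i) = 0) :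
    ρ = trivialRep K n := by
  ext x
  induction x using Hom.induction with
  | zero => rw [map_zero, map_zero]
  | add x y hx hy => rw [map_add, map_add, hx, hy]
  | smul c D =>
    rw [map_smul, map_smul]
    congr 1
    rw [trivialRep_apply, permCoeff, Hom.lift_diag]
    split_ifs with hD
    · obtain ⟨σ, rfl⟩ := exists_ofPerm D hD
      exact algHom_ofPerm ρ hs σ
    · obtain ⟨i, hi⟩ := Finset.nonempty_iff_ne_empty.2 hD
      rw [mem_capped] at hi
      have hij : i ≠ D.lower i := by
        intro h
        rw [← h] at hi
        exact D.partner_ne _ hi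
      have hn : 0 < n := by
        rw [Nat.pos_iff_ne_zero]
        rintro rfl
        exact hij (Fin.ext (by omega))
      let o : Fin n := ⟨0, hn⟩
      have hne : o.castSucc ≠ o.succ := o.castSucc_lt_succ.ne
      obtain ⟨σ, hσ, hσ'⟩ := exists_perm_apply_eq hne hij
      have h1 : (diag (-2 * n : K) D * diag (-2 * n : K) (ofPerm σ⁻¹) :
          BrauerAlgebra (-2 * n : K) (n + 1)) = diag _ (conj (Equiv.sumCongr σ 1) D) := by
        rw [mul_eq_comp, comp_ofPerm_right, inv_inv]
      have h2 : (conj (Equiv.sumCongr σ 1) D).partner (.inl o.castSucc) = .inl o.succ := by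
        have h := conj_partner_apply (Equiv.sumCongr σ 1) D (.inl i)
        rw [hi] at h
        simpa [hσ, hσ'] using h
      have h3 := congrArg ρ (comp_cap_right_of_partner_eq (δ := (-2 * n : K)) hne _ h2)
      rw [← mul_eq_comp, ← eDiagram_eq_cap, map_mul, map_smul] at h3
      have h4 : ρ (diag (-2 * n : K) (eDiagram o)) = 0 := he o
      have h5 : ρ (diag (-2 * n : K) D) = ρ (diag _ (conj (Equiv.sumCongr σ 1) D)) := by
        rw [← h1, map_mul, algHom_ofPerm ρ hs, mul_one]
      rw [h4, mul_zero] at h3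
      rw [h5]
      refine (smul_eq_zero.1 h3.symm).resolve_left (mul_ne_zero (by norm_num) ?_)
      exact Nat.cast_ne_zero.2 hn.ne'

end

/-! ### Uniqueness of the central idempotent and the ideal it generates. -/

section

variable {K R : Type*} [Field K] [Ring R] [Algebra K R] {ρ : R →ₐ[K] K} {z z' : R}

/-- The chain `z = ρ(z') z = z' z = z z' = ρ(z) z' = z'`. -/
theorem IsCentralIdempotentOf.eq (hz : IsCentralIdempotentOf ρ z)
    (hz' : IsCentralIdempotentOf ρ z') : z = z' := by
  rw [← one_smul K z, ← hz'.apply_eq_one, ← hz.mul_eq, hz.central, hz'.mul_eq, hz.apply_eq_one,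
    one_smul]

/-- Every element acts on the line through `z` by scalars, from both sides by centrality, so this
line is already a two-sided ideal. -/
theorem IsCentralIdempotentOf.span_eq (hz : IsCentralIdempotentOf ρ z) :
    (TwoSidedIdeal.span {z} : Set R) = (Submodule.span K {z} : Set R) := by
  have hmul : ∀ x y : R, y ∈ Submodule.span K {z} → x * y ∈ Submodule.span K {z} ∧
      y * x ∈ Submodule.span K {z} := by
    intro x y hy
    obtain ⟨c, rfl⟩ := Submodule.mem_span_singleton.1 hy
    rw [mul_smul_comm, smul_mul_assoc, ← hz.central, hz.mul_eq]
    have h := Submodule.smul_mem _ c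
      (Submodule.smul_mem _ (ρ x) (Submodule.mem_span_singleton_self (R := K) z))
    exact ⟨h, h⟩
  let I : TwoSidedIdeal R := TwoSidedIdeal.mk' (Submodule.span K {z} : Set R)
    (Submodule.zero_mem _) (Submodule.add_mem _) (Submodule.neg_mem _)
    (fun {x y} h => (hmul x y h).1) (fun {x y} h => (hmul y x h).2)
  have hI : ∀ x, x ∈ I ↔ x ∈ Submodule.span K {z} := fun x =>
    TwoSidedIdeal.mem_mk' _ _ _ _ _ _ _
  apply Set.Subset.antisymm
  · intro x hx
    have h : TwoSidedIdeal.span {z} ≤ I := TwoSidedIdeal.span_le.2 (by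
      rintro _ rfl
      exact (hI _).2 (Submodule.mem_span_singleton_self _))
    exact (hI x).1 (h hx)
  · intro x hx
    obtain ⟨c, rfl⟩ := Submodule.mem_span_singleton.1 hx
    have h : c • z = (c • (1 : R)) * z := by rw [smul_mul_assoc, one_mul]
    rw [h]
    exact TwoSidedIdeal.mul_mem_left _ _ _ (TwoSidedIdeal.subset_span rfl)

end

end Brauer

theorem corollary5p6 {K : Type*} [Field K] [CharZero K] (n : ℕ) :
    -- annihilation by the elements `e_i`
    (∀ i : Fin n, Brauer.e (-2 * n : K) i * Brauer.Phi K n = 0 ∧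
      Brauer.Phi K n * Brauer.e (-2 * n : K) i = 0) ∧
    Brauer.Phi K n * Brauer.Phi K n = ((n + 1).factorial : K) • Brauer.Phi K n ∧
    Brauer.Hom.star (Brauer.Phi K n) = Brauer.Phi K n ∧
    -- `F(Φ) = 0` for every symplectic space `V` of dimension `2n`
    (∀ (V : Type*) [AddCommGroup V] [Module K V] (ω : LinearMap.BilinForm K V)
      (hω : ω.Nondegenerate) (_hskew : ∀ v w, ω v w = - ω w v)
      (b : Module.Basis (Fin (2 * n)) K V),
      Brauer.functorF ω hω b (-2 * n : K) (Brauer.Phi K n) = 0 ∧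
      ∀ F : Brauer.TensorFunctor ω hω b (-2 * n : K), F.map (Brauer.Phi K n) = 0) ∧
    -- the trivial representation, its central idempotent, and the ideal generated by the latter
    ∃ ρ : Brauer.BrauerAlgebra (-2 * n : K) (n + 1) →ₐ[K] K,
      ((∀ i, ρ (Brauer.s (-2 * n : K) i) = 1) ∧ ∀ i, ρ (Brauer.e (-2 * n : K) i) = 0) ∧
      (∀ ρ' : Brauer.BrauerAlgebra (-2 * n : K) (n + 1) →ₐ[K] K,
        ((∀ i, ρ' (Brauer.s (-2 * n : K) i) = 1) ∧ ∀ i, ρ' (Brauer.e (-2 * n : K) i) = 0) →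
          ρ' = ρ) ∧
      Brauer.IsCentralIdempotentOf ρ (((n + 1).factorial : K)⁻¹ • Brauer.Phi K n) ∧
      (∀ z, Brauer.IsCentralIdempotentOf ρ z →
        z = ((n + 1).factorial : K)⁻¹ • Brauer.Phi K n) ∧
      (TwoSidedIdeal.span {((n + 1).factorial : K)⁻¹ • Brauer.Phi K n} :
          Set (Brauer.BrauerAlgebra (-2 * n : K) (n + 1))) =
        (Submodule.span K {((n + 1).factorial : K)⁻¹ • Brauer.Phi K n} :
          Set (Brauer.BrauerAlgebra (-2 * n : K) (n + 1))) ∧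
      Module.finrank K (Submodule.span K {((n + 1).factorial : K)⁻¹ • Brauer.Phi K n}) = 1 := by
  have hfac : ((n + 1).factorial : K) ≠ 0 := Nat.cast_ne_zero.2 (n + 1).factorial_ne_zero
  rw [Brauer.Phi_eq_totalSum]
  have hcentral : Brauer.IsCentralIdempotentOf (Brauer.trivialRep K n)
      (((n + 1).factorial : K)⁻¹ • Brauer.totalSum (-2 * n : K) (n + 1) (n + 1)) := by
    refine ⟨?_, fun a => ?_, ?_, fun a => ?_⟩
    · rw [smul_mul_smul_comm, Brauer.mul_totalSum, Brauer.permCoeff_totalSum, smul_smul, mul_assoc,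
        inv_mul_cancel₀ hfac, mul_one]
    · rw [mul_smul_comm, smul_mul_assoc, Brauer.mul_totalSum, Brauer.totalSum_mul]
    · rw [map_smul, Brauer.trivialRep_apply, Brauer.permCoeff_totalSum, smul_eq_mul,
        inv_mul_cancel₀ hfac]
    · rw [mul_smul_comm, Brauer.mul_totalSum, smul_comm]
      rfl
  have he : ∀ i : Fin n, Brauer.e (-2 * n : K) i *
      Brauer.totalSum (-2 * n : K) (n + 1) (n + 1) = 0 :=
    fun i => Brauer.cap_mul_totalSum i.castSucc i.succ i.castSucc_lt_succ.ne
  refine ⟨fun i => ⟨he i, ?_⟩, ?_, Brauer.star_totalSum, ?_, Brauer.trivialRep K n, ⟨?_, ?_⟩, ?_,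
    hcentral, fun z hz => hz.eq hcentral, hcentral.span_eq, ?_⟩
  -- Left and right multiplication act by the same scalar, so annihilation on the right follows from
  -- the left.
  · rw [Brauer.totalSum_mul, ← Brauer.mul_totalSum, he]
  · rw [Brauer.mul_totalSum, Brauer.permCoeff_totalSum]
  · intro V _ _ ω hω hskew b
    have hcard : Fintype.card (Fin (2 * n)) < 2 * (n + 1) := by
      rw [Fintype.card_fin]
      omega
    exact ⟨Brauer.functorF_totalSum n ω hω hskew b hcard _,
      fun F => F.map_totalSum n hskew hcard⟩
  · exact fun i => Brauer.permCoeff_ofPerm _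
  -- The scalar by which `e_i` acts on the nonzero element is zero.
  · intro i
    have h := he i
    rw [Brauer.mul_totalSum] at h
    exact (smul_eq_zero.1 h).resolve_right Brauer.totalSum_ne_zero
  · exact fun ρ hρ => Brauer.algHom_eq_trivialRep ρ hρ.1 hρ.2
  · exact finrank_span_singleton (smul_ne_zero (inv_ne_zero hfac) Brauer.totalSum_ne_zero)
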